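/- **Setting.** Consider $\min_{x\in\mathcal X}F(x)$, $F(x)=\frac1n\sum_{i=1}^n f_i(g_i(x))+r(x)$, with $g_i(x)=\mathbb E_{\zeta\sim\mathbb P_i}[g_i(x;\zeta)]\in\mathbb R^m$, where $\mathcal X\subseteq\mathbb R^d$ is closed and convex and $r:\mathcal X\to(-\infty,\infty]$ is proper, lower semicontinuous and convex. For each $i$ let $\|\cdot\|$ be a norm on $\mathbb R^m$ (it may depend on $i$) with dual norm $\|\cdot\|_*$, and let $\mu_\psi,L_\psi>0$ satisfy $\mu_\psi\|v\|^2\le\|v\|_2^2\le L_\psi\|v\|^2$. Let $f_i^*$ be the convex conjugate of $f_i$, $\mathcal Y_i$ the closure of its effective domain, and $\mathcal Y=\mathcal Y_1\times\dots\times\mathcal Y_n$. A stochastic first-order oracle returns, for $x\in\mathcal X$, an integrable Jacobian $g_i'(x;\zeta)\in\partial g_i(x;\zeta)$ (rows are subgradients on $\mathcal X$ of the components of $g_i(\cdot;\zeta)$); write $g_i'(x)=\mathbb E_{\zeta\sim\mathbb P_i}[g_i'(x;\zeta)]$. Assume, with constants $C_f,C_g>0$, $\sigma_0,\sigma_1,\delta$: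 - each $g_i$ is convex in every component, $\|g_i(x)-g_i(x')\|_*\le C_g\|x-x'\|_2$ and $\|[g_i'(x)]^\top\|_{\rm op}\le C_g$ on $\mathcal X$ (where $\|A^\top\|_{\rm op}=\sup_{\|v\|\le1}\|A^\top v\|_2$); no smoothness of $g_i$ is assumed; - each $f_i:\mathbb R^m\to\mathbb R$ is convex with $|f_i(u)-f_i(u')|\le C_f\|u-u'\|_*$ (possibly non-smooth), and is non-decreasing in each coordinate unless $g_i$ is affine on $\mathcal X$ with $g_i(z)=g_i(x)+g_i'(x)(z-x)$ for all $x,z\in\mathcal X$; - for all $x\in\mathcal X$, $y\in\mathcal Y$ and all $i$: $\mathbb E_{\zeta\sim\mathbb P_i}\|g_i(x)-g_i(x;\zeta)\|_*^2\le\sigma_0^2$, $\mathbb E_{\zeta\sim\mathbb P_i}\|[g_i'(x)]^\top-[g_i'(x;\zeta)]^\top\|_{\rm op}^2\le\sigma_1^2$, and $\frac1n\sum_{j}\|[g_j'(x)]^\top y^{(j)}-\frac1n\sum_i[g_i'(x)]^\top y^{(i)}\|_2^2\le\delta^2$. **Algorithm (ALEXR with $\psi_i=\frac12\|\cdot\|_2^2$,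 $\theta=0$).** Let $1\le S\le n$, $B\ge1$, $\eta,\tau>0$. Start from deterministic $x_0\in\mathcal X$, $y_0\in\mathcal Y$. In iteration $t=0,1,\dots$ draw independently of the past a uniformly random $\mathcal S_t\subset\{1,\dots,n\}$ with $|\mathcal S_t|=S$ and independent i.i.d. batches $\mathcal B_t^{(i)},\tilde{\mathcal B}_t^{(i)}$ of size $B$ from $\mathbb P_i$; set $y_{t+1}^{(i)}=\arg\max_{v\in\mathcal Y_i}\{\langle v,g_i(x_t;\mathcal B_t^{(i)})\rangle-f_i^*(v)-\frac\tau2\|v-y_t^{(i)}\|_2^2\}$ for $i\in\mathcal S_t$, $y_{t+1}^{(i)}=y_t^{(i)}$ for $i\notin\mathcal S_t$, $G_t=\frac1S\sum_{i\in\mathcal S_t}[g_i'(x_t;\tilde{\mathcal B}_t^{(i)})]^\top y_{t+1}^{(i)}$ and $x_{t+1}=\arg\min_{x\in\mathcal X}\{\langle G_t,x\rangle+r(x)+\frac\eta2\|x-x_t\|_2^2\}$, where $g_i(x;\mathcal B)$, $g_i'(x;\mathcal B)$ are averages over the batch. **Theorem.** Let $D\ge0$. There are constants $c_\eta,c_\tau,K>0$,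 depending only on $C_f,C_g,\sigma_0,\sigma_1,\delta,\mu_\psi,L_\psi,D$, such that for every problem as above (all $d,m,n$), all $S,B$, every minimizer $x_*$ of $F$ over $\mathcal X$ with $\|x_0-x_*\|_2\le D$ and every $\epsilon>0$, ALEXR run with $\theta=0$, $\eta=c_\eta/\epsilon$ and $\tau=c_\tau/(B\epsilon)$ has the following property. For $T\ge1$ let $\bar x_T=\frac1T\sum_{t=0}^{T-1}x_{t+1}$, let $\tilde y_T$ be any random vector with $\tilde y_T^{(i)}\in\arg\max_{v\in\mathcal Y_i}\{\langle v,g_i(\bar x_T)\rangle-f_i^*(v)\}$ for all $i$, and let $\Omega_{\mathcal Y}^0=\mathbb E[U_\psi(\tilde y_T,y_0)]=\frac12\sum_{i=1}^n\mathbb E\|\tilde y_T^{(i)}-y_0^{(i)}\|_2^2$. Then $\Omega_{\mathcal Y}^0$ is finite, $\Omega_{\mathcal Y}^0\le Kn$, and $$T\ \ge\ K\max\Big\{1,\frac{\Omega_{\mathcal Y}^0}{BS}\Big\}\epsilon^{-2}\quad\Longrightarrow\quad \mathbb E[F(\bar x_T)-F(x_*)]\le\epsilon .$$ -/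

import Mathlib

open MeasureTheory ProbabilityTheory

namespace FCCO

noncomputable section

/-- `ℝᵏ` with the Euclidean norm. -/
abbrev Vec (k : ℕ) : Type := EuclideanSpace ℝ (Fin k)

/-- `a` is a maximizer of `h` over `s`. -/
def IsArgmax {E : Type*} (h : E → EReal) (s : Set E) (a : E) : Prop :=
  a ∈ s ∧ IsMaxOn h s a

/-- `a` is a minimizer of `h` over `s`. -/
def IsArgmin {E : Type*} (h : E → EReal) (s : Set E) (a : E) : Prop :=
  a ∈ s ∧ IsMinOn h s a

/-- The norm dual to `N`: `‖u‖_* = sup {⟨v, u⟩ : N v ≤ 1}`. -/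
def dualNorm {m : ℕ} (N : Seminorm ℝ (Vec m)) (u : Vec m) : ℝ :=
  sSup ((fun v => inner ℝ v u) '' {v | N v ≤ 1})

/-- The operator norm of the adjoint `Aᵀ : (ℝᵐ, N) → (ℝᵈ, ‖·‖₂)`. -/
def adjointOpNorm {d m : ℕ} (N : Seminorm ℝ (Vec m)) (A : Vec d →L[ℝ] Vec m) : ℝ :=
  sSup ((fun v => ‖ContinuousLinearMap.adjoint A v‖) '' {v | N v ≤ 1})

/-- The convex conjugate `f^*(v) = sup_u {⟨v, u⟩ - f(u)}`, with values in `(-∞, ∞]`. -/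
def conj {m : ℕ} (f : Vec m → ℝ) (v : Vec m) : EReal :=
  ⨆ u : Vec m, ((inner ℝ v u - f u : ℝ) : EReal)

/-- The dual domain of `f`: the closure of the effective domain of `f^*`. -/
def dualDomain {m : ℕ} (f : Vec m → ℝ) : Set (Vec m) :=
  closure {v | conj f v ≠ ⊤}

/-- The Bregman divergence `U_ψ(u, v)`. -/
def bregman {m : ℕ} (ψ : Vec m → ℝ) (u v : Vec m) : ℝ :=
  ψ u - ψ v - inner ℝ (gradient ψ v) (u - v)

/-- The quadratic distance-generating function `½‖·‖₂²`. -/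
def quad {m : ℕ} (u : Vec m) : ℝ := (1 / 2) * ‖u‖ ^ 2

/-- The block-separable divergence `U_ψ(u, v) = ∑ᵢ U_{ψᵢ}(u⁽ⁱ⁾, v⁽ⁱ⁾)`. -/
def bregmanSum {m n : ℕ} (ψ : Fin n → Vec m → ℝ) (u v : Fin n → Vec m) : ℝ :=
  ∑ i, bregman (ψ i) (u i) (v i)

/-- The data of a problem `min_{x ∈ X} (1/n) ∑ᵢ fᵢ(gᵢ(x)) + r(x)`, where `gᵢ(x)` is the
expectation of `gs i x ζ` over `ζ ∼ P i`, and `J i x ζ` is the first-order oracle: a Jacobian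
whose rows are subgradients of the components of `gs i · ζ` at `x`. `N i` is the norm of the
`i`-th dual block. -/
structure Problem (d m n : ℕ) (Z : Type*) [MeasurableSpace Z] where
  X : Set (Vec d)
  r : Vec d → EReal
  f : Fin n → Vec m → ℝ
  P : Fin n → Measure Z
  gs : Fin n → Vec d → Z → Vec m
  J : Fin n → Vec d → Z → (Vec d →L[ℝ] Vec m)
  N : Fin n → Seminorm ℝ (Vec m)

namespace Problem

variable {d m n : ℕ} {Z : Type*} [MeasurableSpace Z]

/-- The inner function `gᵢ(x) = 𝔼 gᵢ(x; ζ)`. -/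
def g (p : Problem d m n Z) (i : Fin n) (x : Vec d) : Vec m :=
  ∫ ζ, p.gs i x ζ ∂(p.P i)

/-- The expected oracle Jacobian `gᵢ'(x) = 𝔼 gᵢ'(x; ζ)`. -/
def meanJ (p : Problem d m n Z) (i : Fin n) (x : Vec d) : Vec d →L[ℝ] Vec m :=
  ∫ ζ, p.J i x ζ ∂(p.P i)

/-- The objective `F`. -/
def F (p : Problem d m n Z) (x : Vec d) : EReal :=
  (((1 / (n : ℝ)) * ∑ i, p.f i (p.g i x) : ℝ) : EReal) + p.r x

/-- The dual domain `𝒴ᵢ` of the `i`-th block. -/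
def Y (p : Problem d m n Z) (i : Fin n) : Set (Vec m) := dualDomain (p.f i)

/-- The standing assumptions, with their constants. -/
structure Assumptions (p : Problem d m n Z) (Cf Cg σ₀ σ₁ δ μψ Lψ : ℝ) : Prop where
  prob : ∀ i, IsProbabilityMeasure (p.P i)
  /-- comparison of the block norms with the Euclidean norm, that is, `½‖·‖₂²` is
  `μψ`-strongly convex and `Lψ`-smooth with respect to `N i` -/
  norm_lower : ∀ i v, μψ * p.N i v ^ 2 ≤ ‖v‖ ^ 2
  norm_upper : ∀ i v, ‖v‖ ^ 2 ≤ Lψ * p.N i v ^ 2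
  /-- the domain -/
  X_closed : IsClosed p.X
  X_convex : Convex ℝ p.X
  /-- the regularizer is proper, lower semicontinuous and convex (epigraph) on `X` -/
  r_ne_bot : ∀ x ∈ p.X, p.r x ≠ ⊥
  r_proper : ∃ x ∈ p.X, p.r x ≠ ⊤
  r_lsc : LowerSemicontinuousOn p.r p.X
  r_convex : Convex ℝ {q : Vec d × ℝ | q.1 ∈ p.X ∧ p.r q.1 ≤ (q.2 : EReal)}
  /-- the stochastic oracles -/
  gs_meas : ∀ i, StronglyMeasurable (Function.uncurry (p.gs i))
  J_meas : ∀ i, StronglyMeasurable (Function.uncurry (p.J i))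
  gs_int : ∀ i, ∀ x ∈ p.X, Integrable (p.gs i x) (p.P i)
  J_int : ∀ i, ∀ x ∈ p.X, Integrable (p.J i x) (p.P i)
  J_subgradient : ∀ i ζ, ∀ x ∈ p.X, ∀ z ∈ p.X, ∀ j,
    p.gs i x ζ j + p.J i x ζ (z - x) j ≤ p.gs i z ζ j
  /-- the inner functions are convex and Lipschitz, and so bounded are their subgradients -/
  g_convex : ∀ i j, ConvexOn ℝ p.X (fun x => p.g i x j)
  g_lip : ∀ i, ∀ x ∈ p.X, ∀ z ∈ p.X, dualNorm (p.N i) (p.g i x - p.g i z) ≤ Cg * ‖x - z‖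
  meanJ_bound : ∀ i, ∀ x ∈ p.X, adjointOpNorm (p.N i) (p.meanJ i x) ≤ Cg
  /-- the outer functions are convex and Lipschitz, and coordinatewise non-decreasing unless
  the inner function is affine on `X` with derivative given by `meanJ` -/
  f_convex : ∀ i, ConvexOn ℝ Set.univ (p.f i)
  f_lip : ∀ i u w, |p.f i u - p.f i w| ≤ Cf * dualNorm (p.N i) (u - w)
  f_mono : ∀ i,
    (∀ u w : Vec m, (∀ j, u j ≤ w j) → p.f i u ≤ p.f i w) ∨
    (∀ x ∈ p.X, ∀ z ∈ p.X, p.g i z = p.g i x + p.meanJ i x (z - x))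
  /-- bounded variances -/
  var₀_int : ∀ i, ∀ x ∈ p.X,
    Integrable (fun ζ => dualNorm (p.N i) (p.g i x - p.gs i x ζ) ^ 2) (p.P i)
  var₀ : ∀ i, ∀ x ∈ p.X, ∫ ζ, dualNorm (p.N i) (p.g i x - p.gs i x ζ) ^ 2 ∂(p.P i) ≤ σ₀ ^ 2
  var₁_int : ∀ i, ∀ x ∈ p.X,
    Integrable (fun ζ => adjointOpNorm (p.N i) (p.meanJ i x - p.J i x ζ) ^ 2) (p.P i)
  var₁ : ∀ i, ∀ x ∈ p.X,
    ∫ ζ, adjointOpNorm (p.N i) (p.meanJ i x - p.J i x ζ) ^ 2 ∂(p.P i) ≤ σ₁ ^ 2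
  var_blocks : ∀ x ∈ p.X, ∀ y : Fin n → Vec m, (∀ i, y i ∈ p.Y i) →
    (1 / (n : ℝ)) * ∑ j, ‖ContinuousLinearMap.adjoint (p.meanJ j x) (y j) -
      (1 / (n : ℝ)) • ∑ i, ContinuousLinearMap.adjoint (p.meanJ i x) (y i)‖ ^ 2 ≤ δ ^ 2

/-- The randomness of one iteration: the block batch `𝒮ₜ` and, for every block, two batches
of `B` samples (those of the blocks outside `𝒮ₜ` are never used by the algorithm). -/
abbrev Draw (n B : ℕ) (Z : Type*) : Type _ :=
  Finset (Fin n) × (Fin n → Fin B → Z) × (Fin n → Fin B → Z)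

/-- The law of one draw: `𝒮ₜ` is uniform among the subsets of size `S`, all samples of block
`i` have law `P i`, and everything is independent. -/
def drawLaw (p : Problem d m n Z) (S B : ℕ) : Measure (Draw n B Z) :=
  (uniformOn {A : Finset (Fin n) | A.card = S}).prod
    ((Measure.pi fun i => Measure.pi fun _ : Fin B => p.P i).prod
      (Measure.pi fun i => Measure.pi fun _ : Fin B => p.P i))

/-- `ξ` is an i.i.d. sequence of draws. -/
structure IsSampling (p : Problem d m n Z) (S B : ℕ) {Ω : Type*} [MeasurableSpace Ω]
    (Pr : Measure Ω) (ξ : ℕ → Ω → Draw n B Z) : Prop where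
  meas : ∀ t, Measurable (ξ t)
  law : ∀ t, Pr.map (ξ t) = p.drawLaw S B
  indep : iIndepFun ξ Pr

/-- The mini-batch estimator `gᵢ(x; ℬ)`. -/
def gBatch (p : Problem d m n Z) {B : ℕ} (i : Fin n) (x : Vec d) (b : Fin B → Z) : Vec m :=
  (1 / (B : ℝ)) • ∑ k, p.gs i x (b k)

/-- The mini-batch Jacobian `gᵢ'(x; ℬ)`. -/
def JBatch (p : Problem d m n Z) {B : ℕ} (i : Fin n) (x : Vec d) (b : Fin B → Z) :
    Vec d →L[ℝ] Vec m :=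
  (1 / (B : ℝ)) • ∑ k, p.J i x (b k)

/-- The extrapolated estimator
`g̃ = gᵢ(x; ℬ) + θ (gᵢ(x; ℬ) - gᵢ(x₋; ℬ))`, where `x₋` is the previous iterate. -/
def extrap (p : Problem d m n Z) {B : ℕ} (θ : ℝ) (i : Fin n) (x xprev : Vec d)
    (b : Fin B → Z) : Vec m :=
  p.gBatch i x b + θ • (p.gBatch i x b - p.gBatch i xprev b)

/-- The gradient estimator `(1/S) ∑_{i ∈ 𝒮} [gᵢ'(x; ℬ̃⁽ⁱ⁾)]ᵀ y⁽ⁱ⁾`. -/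
def gradEst (p : Problem d m n Z) {B : ℕ} (S : ℕ) (A : Finset (Fin n)) (x : Vec d)
    (b : Fin n → Fin B → Z) (y : Fin n → Vec m) : Vec d :=
  (1 / (S : ℝ)) • ∑ i ∈ A, ContinuousLinearMap.adjoint (p.JBatch i x (b i)) (y i)

/-- `(x, y)` is the sequence of iterates of ALEXR driven by the draws `ξ`. The iterate before
`x 0` is `x 0` (here through `0 - 1 = 0`). -/
structure IsALEXR (p : Problem d m n Z) (S B : ℕ) (ψ : Fin n → Vec m → ℝ) (θ η τ : ℝ)
    (x₀ : Vec d) (y₀ : Fin n → Vec m) {Ω : Type*} (ξ : ℕ → Ω → Draw n B Z)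
    (x : ℕ → Ω → Vec d) (y : ℕ → Ω → Fin n → Vec m) : Prop where
  x_zero : ∀ ω, x 0 ω = x₀
  y_zero : ∀ ω, y 0 ω = y₀
  dual_step : ∀ t ω, ∀ i ∈ (ξ t ω).1,
    IsArgmax (fun v => ((inner ℝ v (p.extrap θ i (x t ω) (x (t - 1) ω) ((ξ t ω).2.1 i))
        - τ * bregman (ψ i) v (y t ω i) : ℝ) : EReal) - conj (p.f i) v)
      (p.Y i) (y (t + 1) ω i)
  dual_stay : ∀ t ω, ∀ i ∉ (ξ t ω).1, y (t + 1) ω i = y t ω i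
  primal_step : ∀ t ω,
    IsArgmin (fun z =>
        ((inner ℝ (p.gradEst S (ξ t ω).1 (x t ω) (ξ t ω).2.2 (y (t + 1) ω)) z
          + η / 2 * ‖z - x t ω‖ ^ 2 : ℝ) : EReal) + p.r z)
      p.X (x (t + 1) ω)

/-- `yt` lists, for every block, a maximizer of `⟨v, gᵢ(x)⟩ - fᵢ^*(v)` over `𝒴ᵢ`. -/
def IsDualBest (p : Problem d m n Z) (x : Vec d) (yt : Fin n → Vec m) : Prop :=
  ∀ i, IsArgmax (fun v => ((inner ℝ v (p.g i x) : ℝ) : EReal) - conj (p.f i) v)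
    (p.Y i) (yt i)

end Problem

/-- The average `(1/T) ∑_{t < T} x_{t+1}` of the first `T` updates. -/
def avgIterate {d : ℕ} {Ω : Type*} (x : ℕ → Ω → Vec d) (T : ℕ) (ω : Ω) : Vec d :=
  (1 / (T : ℝ)) • ∑ t ∈ Finset.range T, x (t + 1) ω

end

end FCCO

open FCCO

/-
By Fenchel duality, `F x` is the supremum over `v` of the saddle function
`(1/n) ∑ᵢ (⟨vᵢ, gᵢ x⟩ - fᵢ^* vᵢ) + r x`, and convexity of the `gᵢ` (with monotonicity of the `fᵢ`)
makes it convex in `x` at every dual point of the domain. Compare the algorithm with the update that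
moves all dual blocks at once: three-point inequalities for the two proximal steps bound the saddle
gap by telescoping squared distances, the oracle errors, and the fluctuation of the block sampling.
The comparison point `ỹ` depends on the whole trajectory, so that the noise paired with it does not
vanish in expectation; but the noise has the form of a martingale difference, so the
squared norm of its sum has expectation the sum of the variances, and the part of these that is due
to block sampling is a multiple of the squared dual steps, which the strong convexity of the dual
step pays for. In the primal step the gradient estimator is only bounded, which costs `O(1/η)` and
requires no smoothness of the inner functions.
-/

namespace FCCO

open scoped NNReal
open ContinuousLinearMap (adjoint)

/-! ### Dual norms and convex conjugates -/

section Norms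

variable {d m : ℕ} {N : Seminorm ℝ (Vec m)} {μ L : ℝ}

lemma norm_le_sqrt_of_seminorm_le_one (hN : ∀ v, ‖v‖ ^ 2 ≤ L * N v ^ 2) (hL : 0 ≤ L) {v : Vec m}
    (hv : N v ≤ 1) : ‖v‖ ≤ √L := by
  refine Real.le_sqrt_of_sq_le ((hN v).trans ?_)
  exact mul_le_of_le_one_right hL (pow_le_one₀ (apply_nonneg N v) hv)

lemma seminorm_le_one_of_norm_le_sqrt (hN : ∀ v, μ * N v ^ 2 ≤ ‖v‖ ^ 2) (hμ : 0 < μ) {v : Vec m}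
    (hv : ‖v‖ ≤ √μ) : N v ≤ 1 := by
  have h : μ * N v ^ 2 ≤ μ * 1 := by
    rw [mul_one]
    exact (hN v).trans ((pow_le_pow_left₀ (norm_nonneg v) hv 2).trans_eq (Real.sq_sqrt hμ.le))
  exact (sq_le_one_iff₀ (apply_nonneg N v)).1 (le_of_mul_le_mul_left h hμ)

lemma inner_le_of_seminorm_le_one (hN : ∀ v, ‖v‖ ^ 2 ≤ L * N v ^ 2) (hL : 0 ≤ L) {v : Vec m}
    (hv : N v ≤ 1) (u : Vec m) : inner ℝ v u ≤ √L * ‖u‖ :=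
  (real_inner_le_norm v u).trans
    (mul_le_mul_of_nonneg_right (norm_le_sqrt_of_seminorm_le_one hN hL hv) (norm_nonneg u))

lemma dualNorm_le (hN : ∀ v, ‖v‖ ^ 2 ≤ L * N v ^ 2) (hL : 0 ≤ L) (u : Vec m) :
    dualNorm N u ≤ √L * ‖u‖ := by
  refine csSup_le ⟨_, 0, by simp, rfl⟩ ?_
  rintro _ ⟨v, hv, rfl⟩
  exact inner_le_of_seminorm_le_one hN hL hv u

lemma le_dualNorm (hN : ∀ v, μ * N v ^ 2 ≤ ‖v‖ ^ 2) (hμ : 0 < μ)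
    (hN' : ∀ v, ‖v‖ ^ 2 ≤ L * N v ^ 2) (hL : 0 ≤ L) (u : Vec m) :
    √μ * ‖u‖ ≤ dualNorm N u := by
  have hbdd : BddAbove ((fun v => inner ℝ v u) '' {v | N v ≤ 1}) := by
    refine ⟨√L * ‖u‖, ?_⟩
    rintro _ ⟨v, hv, rfl⟩
    exact inner_le_of_seminorm_le_one hN' hL hv u
  rcases eq_or_ne u 0 with rfl | hu
  · exact le_csSup hbdd ⟨0, by simp, by simp⟩
  have hu' : ‖u‖ ≠ 0 := norm_ne_zero_iff.2 hu
  refine le_csSup hbdd ⟨(√μ / ‖u‖) • u, seminorm_le_one_of_norm_le_sqrt hN hμ ?_, ?_⟩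
  · rw [norm_smul, Real.norm_of_nonneg (by positivity), div_mul_cancel₀ _ hu']
  · simp only [real_inner_smul_left, real_inner_self_eq_norm_sq]
    field_simp

lemma le_adjointOpNorm (hN : ∀ v, μ * N v ^ 2 ≤ ‖v‖ ^ 2) (hμ : 0 < μ)
    (hN' : ∀ v, ‖v‖ ^ 2 ≤ L * N v ^ 2) (hL : 0 ≤ L) (A : Vec d →L[ℝ] Vec m) :
    √μ * ‖A‖ ≤ adjointOpNorm N A := by
  have hbdd : BddAbove ((fun v => ‖A.adjoint v‖) '' {v | N v ≤ 1}) := by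
    refine ⟨‖A.adjoint‖ * √L, ?_⟩
    rintro _ ⟨v, hv, rfl⟩
    exact A.adjoint.le_opNorm_of_le (norm_le_sqrt_of_seminorm_le_one hN' hL hv)
  have hpos : 0 ≤ adjointOpNorm N A := le_csSup hbdd ⟨0, by simp, by simp⟩
  have hsqrt : 0 < √μ := Real.sqrt_pos.2 hμ
  rw [mul_comm, ← le_div_iff₀ hsqrt, ← LinearIsometryEquiv.norm_map ContinuousLinearMap.adjoint]
  refine ContinuousLinearMap.opNorm_le_of_unit_norm (by positivity) fun v hv => ?_
  have hle : ‖A.adjoint (√μ • v)‖ ≤ adjointOpNorm N A :=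
    le_csSup hbdd ⟨√μ • v, seminorm_le_one_of_norm_le_sqrt hN hμ
      (by rw [norm_smul, hv, mul_one, Real.norm_of_nonneg hsqrt.le]), rfl⟩
  rwa [map_smul, norm_smul, Real.norm_of_nonneg hsqrt.le, mul_comm, ← le_div_iff₀ hsqrt] at hle

end Norms

section Conjugate

variable {m : ℕ} {f : Vec m → ℝ} {v : Vec m}

/-- The effective domain of the convex conjugate. -/
def conjDom (f : Vec m → ℝ) : Set (Vec m) := {v | conj f v ≠ ⊤}

/-- The convex conjugate as a real function, to be used on the effective domain only (elsewhere
its value is `0`). -/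
noncomputable def conjReal (f : Vec m → ℝ) (v : Vec m) : ℝ := (conj f v).toReal

lemma conj_ne_bot (f : Vec m → ℝ) (v : Vec m) : conj f v ≠ ⊥ :=
  ne_bot_of_le_ne_bot (EReal.coe_ne_bot _)
    (le_iSup (fun u : Vec m => ((inner ℝ v u - f u : ℝ) : EReal)) 0)

lemma coe_conjReal (hv : v ∈ conjDom f) : (conjReal f v : EReal) = conj f v :=
  EReal.coe_toReal hv (conj_ne_bot f v)

lemma inner_sub_le_conjReal (hv : v ∈ conjDom f) (u : Vec m) :
    inner ℝ v u - f u ≤ conjReal f v := by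
  rw [← EReal.coe_le_coe_iff, coe_conjReal hv]
  exact le_iSup (fun u : Vec m => ((inner ℝ v u - f u : ℝ) : EReal)) u

lemma mem_conjDom_of_forall_le {c : ℝ} (h : ∀ u, inner ℝ v u - f u ≤ c) : v ∈ conjDom f :=
  ((iSup_le fun u => EReal.coe_le_coe_iff.2 (h u)).trans_lt (EReal.coe_lt_top c)).ne

lemma conjReal_le {c : ℝ} (h : ∀ u, inner ℝ v u - f u ≤ c) : conjReal f v ≤ c := by
  rw [← EReal.coe_le_coe_iff, coe_conjReal (mem_conjDom_of_forall_le h)]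
  exact iSup_le fun u => EReal.coe_le_coe_iff.2 (h u)

lemma convexOn_conjReal (f : Vec m → ℝ) : ConvexOn ℝ (conjDom f) (conjReal f) := by
  have key : ∀ v ∈ conjDom f, ∀ w ∈ conjDom f, ∀ a b : ℝ, 0 ≤ a → 0 ≤ b → a + b = 1 →
      ∀ u, inner ℝ (a • v + b • w) u - f u ≤ a * conjReal f v + b * conjReal f w := by
    intro v hv w hw a b ha hb hab u
    calc inner ℝ (a • v + b • w) u - f u
        = a * (inner ℝ v u - f u) + b * (inner ℝ w u - f u) := by
          rw [inner_add_left, real_inner_smul_left, real_inner_smul_left]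
          linear_combination (f u) * hab
      _ ≤ a * conjReal f v + b * conjReal f w := by
          gcongr
          exacts [inner_sub_le_conjReal hv u, inner_sub_le_conjReal hw u]
  exact ⟨fun v hv w hw a b ha hb hab => mem_conjDom_of_forall_le (key v hv w hw a b ha hb hab),
    fun v hv w hw a b ha hb hab => conjReal_le (key v hv w hw a b ha hb hab)⟩

lemma le_of_forall_mul_le_mul_add {a b c : ℝ} (h : ∀ s : ℝ, 0 ≤ s → s * a ≤ s * b + c) :
    a ≤ b := by
  by_contra! hab
  have hpos : 0 < a - b := sub_pos.2 hab
  have hs := h ((|c| + 1) / (a - b)) (by positivity)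
  have hcancel : (|c| + 1) / (a - b) * (a - b) = |c| + 1 := div_mul_cancel₀ _ hpos.ne'
  linarith [le_abs_self c]

lemma norm_le_of_mem_conjDom {C : ℝ≥0} (hf : LipschitzWith C f) (hv : v ∈ conjDom f) :
    ‖v‖ ≤ C := by
  rcases eq_or_ne v 0 with rfl | hv0
  · simp
  refine le_of_forall_mul_le_mul_add (c := (conjReal f v + f 0) / ‖v‖) fun s hs => ?_
  have hv' : 0 < ‖v‖ := norm_pos_iff.2 hv0
  have hconj := inner_sub_le_conjReal hv (s • v)
  have hlip := (le_abs_self _).trans (hf.norm_sub_le (s • v) 0)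
  rw [sub_zero, norm_smul, Real.norm_of_nonneg hs] at hlip
  rw [real_inner_smul_right, real_inner_self_eq_norm_sq] at hconj
  rw [← sub_le_iff_le_add', le_div_iff₀ hv']
  linarith

lemma nonneg_of_mem_conjDom (hf : ∀ u w : Vec m, (∀ j, u j ≤ w j) → f u ≤ f w)
    (hv : v ∈ conjDom f) (j : Fin m) : 0 ≤ v j := by
  suffices -v j ≤ 0 by linarith
  refine le_of_forall_mul_le_mul_add (c := conjReal f v + f 0) fun s hs => ?_
  have hconj := inner_sub_le_conjReal hv (EuclideanSpace.single j (-s))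
  have hmono : f (EuclideanSpace.single j (-s)) ≤ f 0 := by
    refine hf _ _ fun k => ?_
    rcases eq_or_ne k j with rfl | hk
    · simpa using hs
    · simp [hk]
  have hinner : inner ℝ v (EuclideanSpace.single j (-s)) = s * -v j := by
    simp [EuclideanSpace.inner_single_right]
  linarith

lemma exists_linear_support {E : Type*} [NormedAddCommGroup E] [NormedSpace ℝ E] {f : E → ℝ}
    (hf : ConvexOn ℝ Set.univ f) (hc : Continuous f) (u : E) :
    ∃ φ : StrongDual ℝ E, ∀ z, f u + φ (z - u) ≤ f z := by
  have hopen : IsOpen {q : E × ℝ | f q.1 < q.2} :=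
    isOpen_lt (hc.comp continuous_fst) continuous_snd
  have hconv : Convex ℝ {q : E × ℝ | f q.1 < q.2} := by
    simpa using hf.convex_strict_epigraph
  obtain ⟨ℓ, hℓ⟩ := geometric_hahn_banach_open_point hconv hopen (x := (u, f u)) (by simp)
  have hsplit : ∀ z : E, ∀ s : ℝ, ℓ (z, s) = ℓ (z, 0) + s * ℓ (0, 1) := by
    intro z s
    rw [← smul_eq_mul, ← map_smul, ← map_add]
    simp
  have hvert : ℓ (0, 1) < 0 := by
    have := hℓ (u, f u + 1) (by simp)
    rw [hsplit u (f u + 1), hsplit u (f u)] at this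
    linarith
  have hclosure : ∀ z, ℓ (z, 0) + f z * ℓ (0, 1) ≤ ℓ (u, 0) + f u * ℓ (0, 1) := by
    refine fun z => le_of_forall_pos_le_add fun e he => ?_
    have := hℓ (z, f z + e / (-ℓ (0, 1))) (by simpa using div_pos he (by linarith))
    rw [hsplit z, hsplit u (f u), add_mul, div_mul_eq_mul_div, div_neg,
      mul_div_cancel_right₀ _ hvert.ne] at this
    linarith
  refine ⟨(-ℓ (0, 1))⁻¹ • ℓ.comp (ContinuousLinearMap.inl ℝ E ℝ), fun z => ?_⟩
  have hsub : ℓ (z - u, 0) = ℓ (z, 0) - ℓ (u, 0) := by rw [← map_sub]; simp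
  have hval : ((-ℓ (0, 1))⁻¹ • ℓ.comp (ContinuousLinearMap.inl ℝ E ℝ)) (z - u)
      = (ℓ (z, 0) - ℓ (u, 0)) / -ℓ (0, 1) := by
    simp [hsub, div_eq_inv_mul]
  rw [hval, ← le_sub_iff_add_le', div_le_iff₀ (by linarith)]
  linarith [hclosure z]

lemma exists_conjReal_le_inner_sub (hf : ConvexOn ℝ Set.univ f) (hc : Continuous f) (u : Vec m) :
    ∃ v ∈ conjDom f, conjReal f v ≤ inner ℝ v u - f u := by
  obtain ⟨φ, hφ⟩ := exists_linear_support hf hc u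
  have hle : ∀ z, inner ℝ ((InnerProductSpace.toDual ℝ (Vec m)).symm φ) z - f z
      ≤ inner ℝ ((InnerProductSpace.toDual ℝ (Vec m)).symm φ) u - f u := by
    intro z
    have := hφ z
    rw [map_sub] at this
    simp only [InnerProductSpace.toDual_symm_apply]
    linarith
  exact ⟨_, mem_conjDom_of_forall_le hle, conjReal_le hle⟩

lemma conjDom_nonempty (hf : ConvexOn ℝ Set.univ f) (hc : Continuous f) :
    (conjDom f).Nonempty :=
  let ⟨v, hv, _⟩ := exists_conjReal_le_inner_sub hf hc 0
  ⟨v, hv⟩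

lemma mem_conjDom_and_isMinOn_of_isArgmax {ℓ : Vec m → ℝ} (hne : (conjDom f).Nonempty)
    (h : IsArgmax (fun v => (ℓ v : EReal) - conj f v) (dualDomain f) v) :
    v ∈ conjDom f ∧ IsMinOn (fun v => conjReal f v - ℓ v) (conjDom f) v := by
  have hle : ∀ w ∈ conjDom f, (ℓ w : EReal) - conjReal f w ≤ (ℓ v : EReal) - conj f v := by
    intro w hw
    rw [coe_conjReal hw]
    exact h.2 (subset_closure hw : w ∈ dualDomain f)
  have hv : v ∈ conjDom f := by
    intro htop
    obtain ⟨w, hw⟩ := hne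
    have := hle w hw
    rw [htop, EReal.sub_top, le_bot_iff, ← EReal.coe_sub] at this
    exact EReal.coe_ne_bot _ this
  refine ⟨hv, fun w hw => ?_⟩
  have := hle w hw
  rw [← coe_conjReal hv, ← EReal.coe_sub, ← EReal.coe_sub, EReal.coe_le_coe_iff] at this
  change conjReal f v - ℓ v ≤ conjReal f w - ℓ w
  linarith

lemma norm_le_of_mem_dualDomain {C : ℝ≥0} (hf : LipschitzWith C f) (hv : v ∈ dualDomain f) :
    ‖v‖ ≤ C := by
  have hsub : dualDomain f ⊆ Metric.closedBall 0 C :=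
    closure_minimal (fun w hw => by simpa using norm_le_of_mem_conjDom hf hw)
      Metric.isClosed_closedBall
  simpa using hsub hv

lemma exists_isMinOn_conjReal_add {C : ℝ≥0} (hf : LipschitzWith C f) (hne : (conjDom f).Nonempty)
    {ℓ : Vec m → ℝ} (hℓ : Continuous ℓ) :
    ∃ a ∈ conjDom f, IsMinOn (fun v => conjReal f v + ℓ v) (conjDom f) a := by
  have hcompact : IsCompact (dualDomain f) :=
    (isCompact_closedBall (0 : Vec m) C).of_isClosed_subset isClosed_closure
      fun v hv => by simpa using norm_le_of_mem_dualDomain hf hv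
  have hlsc : LowerSemicontinuous fun v =>
      ⨆ u : Vec m, ((inner ℝ v u - f u + ℓ v : ℝ) : EReal) :=
    lowerSemicontinuous_iSup fun u => Continuous.lowerSemicontinuous
      (continuous_coe_real_ereal.comp (by fun_prop))
  obtain ⟨a, -, hmin⟩ := LowerSemicontinuousOn.exists_isMinOn
    (s := dualDomain f) (hne.mono subset_closure) hcompact (hlsc.lowerSemicontinuousOn _)
  have hle : ∀ v ∈ conjDom f, ∀ u, inner ℝ a u - f u ≤ conjReal f v + ℓ v - ℓ a := by
    intro v hv u
    rw [le_sub_iff_add_le, ← EReal.coe_le_coe_iff]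
    calc ((inner ℝ a u - f u + ℓ a : ℝ) : EReal)
        ≤ ⨆ u : Vec m, ((inner ℝ a u - f u + ℓ a : ℝ) : EReal) :=
          le_iSup (fun u : Vec m => ((inner ℝ a u - f u + ℓ a : ℝ) : EReal)) u
      _ ≤ ⨆ u : Vec m, ((inner ℝ v u - f u + ℓ v : ℝ) : EReal) :=
          hmin (subset_closure hv : v ∈ dualDomain f)
      _ ≤ (conjReal f v + ℓ v : ℝ) := iSup_le fun u => EReal.coe_le_coe_iff.2
          (add_le_add_left (inner_sub_le_conjReal hv u) _)
  obtain ⟨v₀, hv₀⟩ := hne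
  refine ⟨a, mem_conjDom_of_forall_le (hle v₀ hv₀), fun v hv => ?_⟩
  change conjReal f a + ℓ a ≤ conjReal f v + ℓ v
  linarith [conjReal_le (hle v hv)]

end Conjugate

/-! ### Proximal maps -/

section Prox

variable {E : Type*} [NormedAddCommGroup E] [InnerProductSpace ℝ E] {C : Set E} {φ : E → ℝ}
  {c : ℝ} {a a' q q' z : E}

lemma add_norm_sq_le_of_isMinOn {f : E → ℝ} (hf : StrongConvexOn C c f) (ha : a ∈ C)
    (hmin : IsMinOn f C a) (hz : z ∈ C) : f a + c / 2 * ‖z - a‖ ^ 2 ≤ f z := by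
  rw [← le_sub_iff_add_le']
  refine le_of_forall_mul_le_mul_add (c := f z - f a) fun s hs => ?_
  have hpos : 0 < s + 1 := by positivity
  have hsum : s / (s + 1) + 1 / (s + 1) = 1 := by rw [← add_div, div_self hpos.ne']
  have hle : f a ≤ f ((s / (s + 1)) • a + (1 / (s + 1)) • z) :=
    hmin (hf.1 ha hz (by positivity) (by positivity) hsum)
  have hsc := hle.trans (hf.2 ha hz (by positivity) (by positivity) hsum)
  rw [norm_sub_rev, smul_eq_mul, smul_eq_mul] at hsc
  field_simp at hsc
  linarith

/-- `a` is a proximal point of `q` for `φ` on `C`: it minimizes `φ + c/2 ‖· - q‖²` over `C`. -/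
def IsProx (C : Set E) (φ : E → ℝ) (c : ℝ) (q a : E) : Prop :=
  a ∈ C ∧ IsMinOn (fun z => φ z + c / 2 * ‖z - q‖ ^ 2) C a

lemma isProx_add_inner_iff (hc : c ≠ 0) (l : E) :
    IsProx C (fun z => φ z + inner ℝ l z) c q a ↔ IsProx C φ c (q - c⁻¹ • l) a := by
  have hexpand : (fun z => φ z + c / 2 * ‖z - (q - c⁻¹ • l)‖ ^ 2) = fun z =>
      (φ z + inner ℝ l z + c / 2 * ‖z - q‖ ^ 2) + (c / 2 * ‖c⁻¹ • l‖ ^ 2 - inner ℝ l q) := by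
    funext z
    rw [sub_sub_eq_add_sub, add_sub_right_comm, norm_add_sq_real, real_inner_smul_right,
      real_inner_comm, inner_sub_right]
    field_simp
    ring
  simp only [IsProx, hexpand, isMinOn_iff, add_le_add_iff_right]

namespace IsProx

lemma three_point (h : IsProx C φ c q a) (hφ : ConvexOn ℝ C φ) (hz : z ∈ C) :
    φ a + c / 2 * ‖a - q‖ ^ 2 + c / 2 * ‖z - a‖ ^ 2 ≤ φ z + c / 2 * ‖z - q‖ ^ 2 := by
  refine add_norm_sq_le_of_isMinOn (strongConvexOn_iff_convex.2 ?_) h.1 h.2 hz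
  have hexpand : (fun z => φ z + c / 2 * ‖z - q‖ ^ 2 - c / 2 * ‖z‖ ^ 2) = fun z =>
      φ z + inner ℝ (-c • q) z + c / 2 * ‖q‖ ^ 2 := by
    funext z
    rw [norm_sub_sq_real, real_inner_smul_left, real_inner_comm]
    ring
  rw [hexpand]
  exact (hφ.add ((innerₛₗ ℝ (-c • q)).convexOn hφ.1)).add_const _

lemma dist_le (h : IsProx C φ c q a) (h' : IsProx C φ c q' a') (hφ : ConvexOn ℝ C φ)
    (hc : 0 < c) : dist a a' ≤ dist q q' := by
  have hsum := add_le_add (h.three_point hφ h'.1) (h'.three_point hφ h.1)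
  have hexpand : ‖a' - q‖ ^ 2 + ‖a - q'‖ ^ 2 - ‖a - q‖ ^ 2 - ‖a' - q'‖ ^ 2
      = 2 * inner ℝ (a - a') (q - q') := by
    simp only [norm_sub_sq_real, inner_sub_left, inner_sub_right]
    ring
  have hmul : c * ‖a - a'‖ ^ 2 ≤ c * inner ℝ (a - a') (q - q') := by
    rw [norm_sub_rev a' a] at hsum
    linear_combination hsum + c / 2 * hexpand
  have hsq : ‖a - a'‖ * ‖a - a'‖ ≤ ‖a - a'‖ * ‖q - q'‖ := by
    rw [← sq]
    exact (le_of_mul_le_mul_left hmul hc).trans (real_inner_le_norm _ _)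
  rw [dist_eq_norm, dist_eq_norm]
  rcases (norm_nonneg (a - a')).eq_or_lt with h0 | hpos
  · rw [← h0]
    positivity
  · exact le_of_mul_le_mul_left hsq hpos

lemma eq (h : IsProx C φ c q a) (h' : IsProx C φ c q a') (hφ : ConvexOn ℝ C φ)
    (hc : 0 < c) : a = a' :=
  dist_le_zero.1 ((h.dist_le h' hφ hc).trans_eq (dist_self q))

end IsProx

/-- The proximal map; its value is arbitrary at points without a proximal point. -/
noncomputable def prox (C : Set E) (φ : E → ℝ) (c : ℝ) (q : E) : E :=
  Classical.epsilon (IsProx C φ c q)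

end Prox

section ConjugateProx

variable {m : ℕ} {f : Vec m → ℝ} {L : ℝ≥0} {τ : ℝ}

lemma isProx_prox_conjReal (hf : ConvexOn ℝ Set.univ f) (hL : LipschitzWith L f) (τ : ℝ)
    (q : Vec m) :
    IsProx (conjDom f) (conjReal f) τ q (prox (conjDom f) (conjReal f) τ q) :=
  Classical.epsilon_spec (exists_isMinOn_conjReal_add hL (conjDom_nonempty hf hL.continuous)
    (ℓ := fun v => τ / 2 * ‖v - q‖ ^ 2) (by fun_prop))

lemma continuous_prox_conjReal (hf : ConvexOn ℝ Set.univ f) (hL : LipschitzWith L f)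
    (hτ : 0 < τ) : Continuous (prox (conjDom f) (conjReal f) τ) :=
  (LipschitzWith.mk_one fun q q' => (isProx_prox_conjReal hf hL τ q).dist_le
    (isProx_prox_conjReal hf hL τ q') (convexOn_conjReal f) hτ).continuous

end ConjugateProx

lemma measurable_of_dist_le {Ω E F : Type*} [MeasurableSpace Ω] [PseudoMetricSpace E]
    [MeasurableSpace E] [OpensMeasurableSpace E] [MetricSpace F] [MeasurableSpace F] [BorelSpace F]
    {a : Ω → F} {q : Ω → E} (hq : Measurable q)
    (h : ∀ ω ω', dist (a ω) (a ω') ≤ dist (q ω) (q ω')) : Measurable a := by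
  let preimage : Set.range q → Ω := fun z => z.2.choose
  have hpreimage : ∀ z : Set.range q, q (preimage z) = z := fun z => z.2.choose_spec
  have hcont : Continuous (a ∘ preimage) := by
    refine (LipschitzWith.mk_one fun z z' => (h _ _).trans_eq ?_).continuous
    rw [hpreimage, hpreimage, Subtype.dist_eq]
  have hfactor : a = (a ∘ preimage) ∘ Set.rangeFactorization q := by
    funext ω
    refine dist_le_zero.1 ((h _ _).trans_eq ?_)
    rw [hpreimage, Set.rangeFactorization_coe, dist_self]
  rw [hfactor]
  exact hcont.measurable.comp hq.subtype_mk

/-! ### Independence and orthogonality -/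

section Independence

variable {Ω α γ : Type*} [MeasurableSpace Ω] [MeasurableSpace α] [MeasurableSpace γ]
  {Pr : Measure Ω} [IsFiniteMeasure Pr] {U : Ω → α} {V : Ω → γ}

lemma integral_eq_zero_of_indepFun {E : Type*} [NormedAddCommGroup E] [NormedSpace ℝ E]
    (h : IndepFun U V Pr) (hU : Measurable U) (hV : Measurable V) {φ : α → γ → E}
    (hφ : StronglyMeasurable (Function.uncurry φ)) (h0 : ∀ ω, ∫ v, φ (U ω) v ∂(Pr.map V) = 0) :
    ∫ ω, φ (U ω) (V ω) ∂Pr = 0 := by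
  by_cases hint : Integrable (fun ω => φ (U ω) (V ω)) Pr
  · have hmap := (indepFun_iff_map_prod_eq_prod_map_map hU.aemeasurable hV.aemeasurable).1 h
    have hUV := (hU.prodMk hV).aemeasurable (μ := Pr)
    have hint' : Integrable (Function.uncurry φ) ((Pr.map U).prod (Pr.map V)) := by
      rw [← hmap]
      exact (integrable_map_measure hφ.aestronglyMeasurable hUV).2 hint
    calc ∫ ω, φ (U ω) (V ω) ∂Pr
        = ∫ q, Function.uncurry φ q ∂((Pr.map U).prod (Pr.map V)) := by
          rw [← hmap, integral_map hUV hφ.aestronglyMeasurable]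
          rfl
      _ = ∫ ω, ∫ v, φ (U ω) v ∂(Pr.map V) ∂Pr := by
          rw [integral_prod _ hint', integral_map hU.aemeasurable
            hφ.integral_prod_right'.aestronglyMeasurable]
          rfl
      _ = 0 := by simp only [h0, integral_zero]
  · exact integral_undef hint

lemma lintegral_comp_of_indepFun (h : IndepFun U V Pr) (hU : Measurable U) (hV : Measurable V)
    {φ : α → γ → ENNReal} (hφ : Measurable (Function.uncurry φ)) :
    ∫⁻ ω, φ (U ω) (V ω) ∂Pr = ∫⁻ ω, ∫⁻ v, φ (U ω) v ∂(Pr.map V) ∂Pr := by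
  have hmap := (indepFun_iff_map_prod_eq_prod_map_map hU.aemeasurable hV.aemeasurable).1 h
  calc ∫⁻ ω, φ (U ω) (V ω) ∂Pr
      = ∫⁻ q, Function.uncurry φ q ∂((Pr.map U).prod (Pr.map V)) := by
        rw [← hmap, lintegral_map hφ (hU.prodMk hV)]
        rfl
    _ = ∫⁻ ω, ∫⁻ v, φ (U ω) v ∂(Pr.map V) ∂Pr := by
        rw [lintegral_prod _ hφ.aemeasurable, lintegral_map hφ.lintegral_prod_right' hU]
        rfl

lemma integrable_and_integral_le_of_indepFun [IsProbabilityMeasure Pr] (h : IndepFun U V Pr)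
    (hU : Measurable U) (hV : Measurable V) {φ : α → γ → ℝ}
    (hφ : Measurable (Function.uncurry φ)) (h0 : ∀ u v, 0 ≤ φ u v) {c : ℝ}
    (hint : ∀ ω, Integrable (φ (U ω)) (Pr.map V)) (hle : ∀ ω, ∫ v, φ (U ω) v ∂(Pr.map V) ≤ c) :
    Integrable (fun ω => φ (U ω) (V ω)) Pr ∧ ∫ ω, φ (U ω) (V ω) ∂Pr ≤ c := by
  have hlintegral : ∫⁻ ω, ENNReal.ofReal (φ (U ω) (V ω)) ∂Pr ≤ ENNReal.ofReal c := calc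
    _ = ∫⁻ ω, ∫⁻ v, ENNReal.ofReal (φ (U ω) v) ∂(Pr.map V) ∂Pr :=
      lintegral_comp_of_indepFun h hU hV (φ := fun u v => ENNReal.ofReal (φ u v))
        hφ.ennreal_ofReal
    _ ≤ ∫⁻ _, ENNReal.ofReal c ∂Pr := by
      refine lintegral_mono fun ω => ?_
      rw [← ofReal_integral_eq_lintegral_ofReal (hint ω) (ae_of_all _ (h0 _))]
      exact ENNReal.ofReal_le_ofReal (hle ω)
    _ = ENNReal.ofReal c := by simp
  have hφ0 : 0 ≤ᵐ[Pr] fun ω => φ (U ω) (V ω) := ae_of_all _ fun ω => h0 _ _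
  have hint' : Integrable (fun ω => φ (U ω) (V ω)) Pr := by
    refine ⟨(hφ.comp (hU.prodMk hV)).aestronglyMeasurable, ?_⟩
    rw [hasFiniteIntegral_iff_ofReal hφ0]
    exact hlintegral.trans_lt ENNReal.ofReal_lt_top
  obtain ⟨ω⟩ := nonempty_of_isProbabilityMeasure Pr
  have hc : 0 ≤ c := (integral_nonneg (h0 (U ω))).trans (hle ω)
  rw [← ofReal_integral_eq_lintegral_ofReal hint' hφ0, ENNReal.ofReal_le_ofReal_iff hc]
    at hlintegral
  exact ⟨hint', hlintegral⟩

end Independence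

section Past

variable {Ω γ : Type*} [MeasurableSpace γ] {ξ : ℕ → Ω → γ} {t : ℕ}

/-- The σ-algebra generated by `ξ s` for `s < t`, with respect to which the iterates at time `t`
are measurable. -/
@[reducible] def past (ξ : ℕ → Ω → γ) (t : ℕ) : MeasurableSpace Ω :=
  ⨆ s ∈ Set.Iio t, MeasurableSpace.comap (ξ s) inferInstance

lemma past_mono {s : ℕ} (h : s ≤ t) : past ξ s ≤ past ξ t :=
  biSup_mono fun _ hr => lt_of_lt_of_le hr h

lemma measurable_past (ξ : ℕ → Ω → γ) {s : ℕ} (h : s < t) : Measurable[past ξ t] (ξ s) :=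
  measurable_iff_comap_le.2
    (le_iSup₂ (f := fun s (_ : s ∈ Set.Iio t) => MeasurableSpace.comap (ξ s) inferInstance) s h)

variable [mΩ : MeasurableSpace Ω]

lemma past_le (hξ : ∀ t, Measurable (ξ t)) (t : ℕ) : past ξ t ≤ mΩ :=
  iSup₂_le fun s _ => (hξ s).comap_le

lemma indepFun_of_measurable_past {α : Type*} [MeasurableSpace α] {Pr : Measure Ω}
    (hξ : ∀ t, Measurable (ξ t)) (hindep : iIndepFun ξ Pr) {U : Ω → α}
    (hU : Measurable[past ξ t] U) : IndepFun U (ξ t) Pr := by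
  rw [IndepFun_iff_Indep]
  have h := indep_iSup_of_disjoint (fun s => (hξ s).comap_le) hindep.iIndep
    (S := Set.Iio t) (T := {t}) (by simp)
  rw [iSup_singleton] at h
  exact indep_of_indep_of_le_left h hU.comap_le

end Past

section Orthogonality

variable {Ω E ι : Type*} [MeasurableSpace Ω] {μ : Measure Ω} [NormedAddCommGroup E]
  [InnerProductSpace ℝ E]

lemma integrable_inner_of_memLp {f g : Ω → E} (hf : MemLp f 2 μ) (hg : MemLp g 2 μ) :
    Integrable (fun ω => inner ℝ (f ω) (g ω)) μ :=
  (hf.norm.integrable_mul hg.norm).mono (hf.aestronglyMeasurable.inner hg.aestronglyMeasurable)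
    (ae_of_all _ fun ω => by simpa using norm_inner_le_norm (𝕜 := ℝ) (f ω) (g ω))

lemma integral_norm_sum_sq (s : Finset ι) {u : ι → Ω → E} (hu : ∀ i ∈ s, MemLp (u i) 2 μ)
    (horth : ∀ i ∈ s, ∀ j ∈ s, i ≠ j → ∫ ω, inner ℝ (u i ω) (u j ω) ∂μ = 0) :
    ∫ ω, ‖∑ i ∈ s, u i ω‖ ^ 2 ∂μ = ∑ i ∈ s, ∫ ω, ‖u i ω‖ ^ 2 ∂μ := by
  simp_rw [← real_inner_self_eq_norm_sq, sum_inner, inner_sum]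
  rw [integral_finsetSum _ fun i hi => integrable_finsetSum _ fun j hj =>
    integrable_inner_of_memLp (hu i hi) (hu j hj)]
  refine Finset.sum_congr rfl fun i hi => ?_
  rw [integral_finsetSum _ fun j hj => integrable_inner_of_memLp (hu i hi) (hu j hj)]
  exact Finset.sum_eq_single_of_mem i hi fun j hj hji => horth i hi j hj hji.symm

end Orthogonality

/-! ### Block sampling and mini-batches -/

section BlockBatch

variable {n S : ℕ}

/-- The law of the block batch. -/
noncomputable def blockLaw (n S : ℕ) : Measure (Finset (Fin n)) :=
  uniformOn {A : Finset (Fin n) | A.card = S}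

/-- The centred inverse-propensity weight of block `i`: as `i` is drawn with probability `S / n`,
its mean is zero. -/
noncomputable def weight (S : ℕ) (i : Fin n) (A : Finset (Fin n)) : ℝ :=
  1 - if i ∈ A then (n : ℝ) / S else 0

lemma card_filter_mem_powersetCard (i : Fin n) (hS : 1 ≤ S) :
    n * ((Finset.powersetCard S Finset.univ).filter (i ∈ ·)).card =
      S * (Finset.powersetCard S (Finset.univ : Finset (Fin n))).card := by
  have h := Finset.card_filter_powersetCard_subset {i} (Finset.univ : Finset (Fin n)) S
    (Finset.subset_univ _) (by simpa using hS)
  simp only [Finset.singleton_subset_iff, Finset.card_univ, Fintype.card_fin,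
    Finset.card_singleton] at h
  rw [h, Finset.card_powersetCard, Finset.card_univ, Fintype.card_fin]
  obtain ⟨n', rfl⟩ := Nat.exists_eq_add_of_le' (Nat.one_le_of_lt i.pos)
  obtain ⟨S', rfl⟩ := Nat.exists_eq_add_of_le' hS
  simpa [mul_comm] using Nat.add_one_mul_choose_eq n' S'

lemma isProbabilityMeasure_blockLaw (hSn : S ≤ n) : IsProbabilityMeasure (blockLaw n S) := by
  refine isProbabilityMeasure_uniformOn (Set.toFinite _) ?_
  obtain ⟨A, -, hA⟩ := Finset.exists_subset_card_eq
    (s := (Finset.univ : Finset (Fin n))) (n := S) (by simpa using hSn)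
  exact ⟨A, hA⟩

lemma ae_card_blockLaw : ∀ᵐ A ∂(blockLaw n S), A.card = S :=
  ae_cond_mem (μ := Measure.count) (s := {A : Finset (Fin n) | A.card = S})
    (Set.toFinite _).measurableSet

lemma blockLaw_real_mem (i : Fin n) (hS : 1 ≤ S) (hSn : S ≤ n) :
    (blockLaw n S).real {A | i ∈ A} = S / n := by
  have hsupport : {A : Finset (Fin n) | A.card = S}
      = ↑(Finset.powersetCard S (Finset.univ : Finset (Fin n))) := by
    ext A
    simp
  have hinter : {A : Finset (Fin n) | A.card = S} ∩ {A | i ∈ A}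
      = ↑((Finset.powersetCard S (Finset.univ : Finset (Fin n))).filter (i ∈ ·)) := by
    ext A
    simp
  have hcard : 0 < (Finset.powersetCard S (Finset.univ : Finset (Fin n))).card := by
    rw [Finset.card_powersetCard]
    exact Nat.choose_pos (by simpa using hSn)
  rw [Measure.real, blockLaw, uniformOn, cond_apply (Set.toFinite _).measurableSet, hinter,
    hsupport, Measure.count_apply_finset, Measure.count_apply_finset, ENNReal.toReal_mul,
    ENNReal.toReal_inv, ENNReal.toReal_natCast, ENNReal.toReal_natCast]
  have hcount := card_filter_mem_powersetCard i hS
  have hn := i.pos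
  rify at hcount hcard hn
  field_simp
  linarith

lemma integral_weight (i : Fin n) (hS : 1 ≤ S) (hSn : S ≤ n) :
    ∫ A, weight S i A ∂(blockLaw n S) = 0 := by
  have := isProbabilityMeasure_blockLaw hSn
  have hindicator : (fun A => if i ∈ A then (n : ℝ) / S else 0)
      = Set.indicator {A : Finset (Fin n) | i ∈ A} fun _ => (n : ℝ) / S := by
    ext A
    simp [Set.indicator_apply]
  have hn : (n : ℝ) ≠ 0 := Nat.cast_ne_zero.2 i.pos.ne'
  have hS0 : (S : ℝ) ≠ 0 := Nat.cast_ne_zero.2 (by omega)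
  simp only [weight]
  rw [integral_sub (integrable_const _) Integrable.of_finite, hindicator,
    integral_indicator_const _ (Set.toFinite _).measurableSet, blockLaw_real_mem i hS hSn]
  simp [hn, hS0]

lemma weight_sq (i : Fin n) (A : Finset (Fin n)) :
    weight S i A ^ 2 = n / S - 1 + (2 - n / S) * weight S i A := by
  unfold weight
  split_ifs <;> ring

lemma abs_weight_le (i : Fin n) (A : Finset (Fin n)) : |weight S i A| ≤ 1 + n / S := by
  have hpos : 0 ≤ (n : ℝ) / S := by positivity
  unfold weight
  rw [abs_le]
  split_ifs <;> constructor <;> linarith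

lemma smul_sum_mem_eq_smul_sum_weight {E : Type*} [AddCommGroup E] [Module ℝ E]
    (A : Finset (Fin n)) (a : Fin n → E) :
    (1 / (S : ℝ)) • ∑ i ∈ A, a i = (1 / (n : ℝ)) • ∑ i, (1 - weight S i A) • a i := by
  rw [Finset.smul_sum, Finset.smul_sum, ← Finset.sum_subset (Finset.subset_univ A)]
  · refine Finset.sum_congr rfl fun i hi => ?_
    have hn : (n : ℝ) ≠ 0 := Nat.cast_ne_zero.2 i.pos.ne'
    rw [weight, if_pos hi, sub_sub_cancel, smul_smul, one_div_mul_eq_div,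
      div_div_cancel_left' hn, one_div]
  · intro i _ hi
    rw [weight, if_neg hi, sub_zero, sub_self, zero_smul, smul_zero]

end BlockBatch

section MiniBatch

variable {Z E : Type*} [MeasurableSpace Z] {P : Measure Z} [IsProbabilityMeasure P]
  [NormedAddCommGroup E] {B : ℕ} {u : Z → E}

lemma memLp_comp_eval (hu : MemLp u 2 P) (k : Fin B) :
    MemLp (fun b : Fin B → Z => u (b k)) 2 (Measure.pi fun _ => P) :=
  hu.comp_measurePreserving (measurePreserving_eval (fun _ : Fin B => P) k)

lemma integrable_batch [NormedSpace ℝ E] (hu : Integrable u P) :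
    Integrable (fun b : Fin B → Z => (1 / (B : ℝ)) • ∑ k, u (b k)) (Measure.pi fun _ => P) :=
  (integrable_finsetSum _ fun _ _ => integrable_comp_eval hu).smul _

lemma memLp_batch [NormedSpace ℝ E] (hu : MemLp u 2 P) :
    MemLp (fun b : Fin B → Z => (1 / (B : ℝ)) • ∑ k, u (b k)) 2 (Measure.pi fun _ => P) :=
  (memLp_finsetSum _ fun k _ => memLp_comp_eval hu k).const_smul _

lemma integral_batch [NormedSpace ℝ E] (hB : 1 ≤ B) (hu : Integrable u P) :
    ∫ b : Fin B → Z, (1 / (B : ℝ)) • ∑ k, u (b k) ∂(Measure.pi fun _ => P) = ∫ z, u z ∂P := by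
  have hB0 : (B : ℝ) ≠ 0 := Nat.cast_ne_zero.2 (by omega)
  rw [integral_smul, integral_finsetSum _ fun _ _ => integrable_comp_eval hu]
  simp_rw [integral_comp_eval (μ := fun _ : Fin B => P) hu.aestronglyMeasurable]
  rw [Finset.sum_const, Finset.card_univ, Fintype.card_fin, ← Nat.cast_smul_eq_nsmul ℝ, smul_smul,
    one_div_mul_cancel hB0, one_smul]

lemma integral_inner_comp_eval_eq_zero [InnerProductSpace ℝ E] [CompleteSpace E]
    [MeasurableSpace E] [BorelSpace E] [SecondCountableTopology E] (hm : Measurable u)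
    (hu : Integrable u P) (h0 : ∫ z, u z ∂P = 0) {k l : Fin B} (hkl : k ≠ l) :
    ∫ b : Fin B → Z, inner ℝ (u (b k)) (u (b l)) ∂(Measure.pi fun _ => P) = 0 := by
  have hmeas : ∀ k, Measurable fun b : Fin B → Z => u (b k) := fun k =>
    hm.comp (measurable_pi_apply k)
  have hindep := (iIndepFun_pi (μ := fun _ : Fin B => P) (X := fun _ => u)
    fun _ => hm.aemeasurable).indepFun hkl
  refine integral_eq_zero_of_indepFun hindep (hmeas k) (hmeas l)
    (φ := fun a b => inner ℝ a b) (continuous_inner).stronglyMeasurable fun b => ?_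
  have hcont : Continuous fun v : E => inner ℝ (u (b k)) v := by fun_prop
  rw [integral_map (hmeas l).aemeasurable hcont.aestronglyMeasurable,
    integral_inner (integrable_comp_eval (μ := fun _ : Fin B => P) hu),
    integral_comp_eval (μ := fun _ : Fin B => P) hm.aestronglyMeasurable, h0, inner_zero_right]

lemma integral_norm_sq_batch [InnerProductSpace ℝ E] [CompleteSpace E] [MeasurableSpace E]
    [BorelSpace E] [SecondCountableTopology E] (hm : Measurable u) (hu : MemLp u 2 P)
    (h0 : ∫ z, u z ∂P = 0) :
    ∫ b : Fin B → Z, ‖(1 / (B : ℝ)) • ∑ k, u (b k)‖ ^ 2 ∂(Measure.pi fun _ => P)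
      = (∫ z, ‖u z‖ ^ 2 ∂P) / B := by
  simp_rw [norm_smul, mul_pow]
  rw [integral_const_mul, integral_norm_sum_sq _ (fun k _ => memLp_comp_eval hu k)
    fun _ _ _ _ => integral_inner_comp_eval_eq_zero hm (hu.integrable one_le_two) h0]
  simp_rw [integral_comp_eval (μ := fun _ : Fin B => P) (f := fun z => ‖u z‖ ^ 2)
    hu.norm.integrable_sq.aestronglyMeasurable]
  rw [Finset.sum_const, Finset.card_univ, Fintype.card_fin, nsmul_eq_mul, Real.norm_eq_abs, sq_abs]
  field_simp

lemma norm_sq_average_le [NormedSpace ℝ E] {ι : Type*} (s : Finset ι) (a : ι → E) :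
    ‖(1 / (s.card : ℝ)) • ∑ k ∈ s, a k‖ ^ 2 ≤ 1 / (s.card : ℝ) * ∑ k ∈ s, ‖a k‖ ^ 2 := calc
  _ = ‖∑ k ∈ s, a k‖ ^ 2 / (s.card : ℝ) ^ 2 := by
    rw [norm_smul, Real.norm_of_nonneg (by positivity)]
    ring
  _ ≤ (∑ k ∈ s, ‖a k‖) ^ 2 / (s.card : ℝ) ^ 2 := by
    gcongr
    exact norm_sum_le _ _
  _ = ((∑ k ∈ s, ‖a k‖) / s.card) ^ 2 := (div_pow _ _ _).symm
  _ ≤ (∑ k ∈ s, ‖a k‖ ^ 2) / s.card := sum_div_card_sq_le_sum_sq_div_card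
  _ = 1 / (s.card : ℝ) * ∑ k ∈ s, ‖a k‖ ^ 2 := by ring

lemma integral_norm_sq_batch_le [NormedSpace ℝ E] (hB : 1 ≤ B)
    (hsq : Integrable (fun z => ‖u z‖ ^ 2) P) :
    ∫ b : Fin B → Z, ‖(1 / (B : ℝ)) • ∑ k, u (b k)‖ ^ 2 ∂(Measure.pi fun _ => P)
      ≤ ∫ z, ‖u z‖ ^ 2 ∂P := by
  refine (integral_mono_of_nonneg (ae_of_all _ fun b => by positivity) (integrable_batch hsq)
    (ae_of_all _ fun b => ?_)).trans_eq (integral_batch hB hsq)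
  simpa using norm_sq_average_le Finset.univ fun k => u (b k)

end MiniBatch

section Quadratic

variable {m : ℕ}

lemma gradient_quad (v : Vec m) : gradient quad v = v := by
  apply HasGradientAt.gradient
  rw [hasGradientAt_iff_hasFDerivAt]
  have hderiv : InnerProductSpace.toDual ℝ (Vec m) v = (1 / 2 : ℝ) • (2 : ℕ) • innerSL ℝ v := by
    ext w
    simp [InnerProductSpace.toDual_apply_apply]
  rw [hderiv]
  exact (hasStrictFDerivAt_norm_sq v).hasFDerivAt.const_mul (1 / 2 : ℝ)

lemma bregman_quad (u v : Vec m) : bregman quad u v = 1 / 2 * ‖u - v‖ ^ 2 := by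
  rw [bregman, gradient_quad, quad, quad, norm_sub_sq_real, inner_sub_right,
    real_inner_self_eq_norm_sq, real_inner_comm]
  ring

end Quadratic

/-! ### The problem in Euclidean norms -/

lemma norm_adjoint_apply_le {d m : ℕ} (A : Vec d →L[ℝ] Vec m) (v : Vec m) :
    ‖adjoint A v‖ ≤ ‖A‖ * ‖v‖ := by
  simpa using (adjoint A).le_opNorm v

namespace Problem

variable {d m n : ℕ} {Z : Type*} [MeasurableSpace Z]

/-- The consequences of the standing assumptions that the analysis uses, in terms of Euclidean
norms only: the outer functions are `L`-Lipschitz, the mean Jacobians are bounded by `G`, and the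
oracles for the inner functions and their Jacobians have variances at most `s₀` and `s₁`. -/
structure Regular (p : Problem d m n Z) (L G s₀ s₁ : ℝ≥0) : Prop where
  prob : ∀ i, IsProbabilityMeasure (p.P i)
  r_ne_bot : ∀ x ∈ p.X, p.r x ≠ ⊥
  r_proper : ∃ x ∈ p.X, p.r x ≠ ⊤
  r_lsc : LowerSemicontinuousOn p.r p.X
  r_convex : Convex ℝ {q : Vec d × ℝ | q.1 ∈ p.X ∧ p.r q.1 ≤ (q.2 : EReal)}
  gs_meas : ∀ i, StronglyMeasurable (Function.uncurry (p.gs i))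
  J_meas : ∀ i, StronglyMeasurable (Function.uncurry (p.J i))
  gs_int : ∀ i, ∀ x ∈ p.X, Integrable (p.gs i x) (p.P i)
  J_int : ∀ i, ∀ x ∈ p.X, Integrable (p.J i x) (p.P i)
  J_subgradient : ∀ i ζ, ∀ x ∈ p.X, ∀ z ∈ p.X, ∀ j,
    p.gs i x ζ j + p.J i x ζ (z - x) j ≤ p.gs i z ζ j
  norm_meanJ_le : ∀ i, ∀ x ∈ p.X, ‖p.meanJ i x‖ ≤ G
  f_convex : ∀ i, ConvexOn ℝ Set.univ (p.f i)
  f_lip : ∀ i, LipschitzWith L (p.f i)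
  f_mono : ∀ i,
    (∀ u w : Vec m, (∀ j, u j ≤ w j) → p.f i u ≤ p.f i w) ∨
    (∀ x ∈ p.X, ∀ z ∈ p.X, p.g i z = p.g i x + p.meanJ i x (z - x))
  gs_var_int : ∀ i, ∀ x ∈ p.X, Integrable (fun ζ => ‖p.g i x - p.gs i x ζ‖ ^ 2) (p.P i)
  gs_var : ∀ i, ∀ x ∈ p.X, ∫ ζ, ‖p.g i x - p.gs i x ζ‖ ^ 2 ∂(p.P i) ≤ s₀
  J_var_int : ∀ i, ∀ x ∈ p.X, Integrable (fun ζ => ‖p.meanJ i x - p.J i x ζ‖ ^ 2) (p.P i)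
  J_var : ∀ i, ∀ x ∈ p.X, ∫ ζ, ‖p.meanJ i x - p.J i x ζ‖ ^ 2 ∂(p.P i) ≤ s₁

lemma integral_sq_le_of_sqrt_mul_le {α : Type*} [MeasurableSpace α] {ν : Measure α} {a b : α → ℝ}
    {μ V : ℝ} (hμ : 0 < μ) (ha : ∀ ω, 0 ≤ a ω) (hab : ∀ ω, √μ * a ω ≤ b ω)
    (hmeas : AEStronglyMeasurable a ν) (hint : Integrable (fun ω => b ω ^ 2) ν)
    (hV : ∫ ω, b ω ^ 2 ∂ν ≤ V) :
    Integrable (fun ω => a ω ^ 2) ν ∧ ∫ ω, a ω ^ 2 ∂ν ≤ (V / μ).toNNReal := by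
  have hle : ∀ ω, a ω ^ 2 ≤ b ω ^ 2 / μ := fun ω => by
    rw [le_div_iff₀ hμ]
    calc a ω ^ 2 * μ = (√μ * a ω) ^ 2 := by rw [mul_pow, Real.sq_sqrt hμ.le, mul_comm]
      _ ≤ b ω ^ 2 := pow_le_pow_left₀ (mul_nonneg (Real.sqrt_nonneg μ) (ha ω)) (hab ω) 2
  have hint' : Integrable (fun ω => a ω ^ 2) ν :=
    (hint.div_const μ).mono' (hmeas.pow 2) (ae_of_all _ fun ω => by simpa using hle ω)
  refine ⟨hint', (integral_mono hint' (hint.div_const μ) hle).trans ?_⟩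
  rw [integral_div]
  exact (div_le_div_of_nonneg_right hV hμ.le).trans (Real.le_coe_toNNReal _)

lemma Assumptions.regular {p : Problem d m n Z} {Cf Cg σ₀ σ₁ δ μψ Lψ : ℝ}
    (h : p.Assumptions Cf Cg σ₀ σ₁ δ μψ Lψ) (hCf : 0 ≤ Cf) (hμ : 0 < μψ) (hL : 0 ≤ Lψ) :
    p.Regular (Cf * √Lψ).toNNReal (Cg / √μψ).toNNReal (σ₀ ^ 2 / μψ).toNNReal
      (σ₁ ^ 2 / μψ).toNNReal := by
  have hgs : ∀ i, ∀ x ∈ p.X, _ := fun i x hx => integral_sq_le_of_sqrt_mul_le hμ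
    (fun ζ => norm_nonneg (p.g i x - p.gs i x ζ))
    (fun ζ => le_dualNorm (h.norm_lower i) hμ (h.norm_upper i) hL _)
    (stronglyMeasurable_const.sub
      ((h.gs_meas i).comp_measurable measurable_prodMk_left)).norm.aestronglyMeasurable
    (h.var₀_int i x hx) (h.var₀ i x hx)
  have hJ : ∀ i, ∀ x ∈ p.X, _ := fun i x hx => integral_sq_le_of_sqrt_mul_le hμ
    (fun ζ => norm_nonneg (p.meanJ i x - p.J i x ζ))
    (fun ζ => le_adjointOpNorm (h.norm_lower i) hμ (h.norm_upper i) hL _)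
    (stronglyMeasurable_const.sub
      ((h.J_meas i).comp_measurable measurable_prodMk_left)).norm.aestronglyMeasurable
    (h.var₁_int i x hx) (h.var₁ i x hx)
  exact
    { h with
      norm_meanJ_le := fun i x hx => by
        refine (?_ : _ ≤ Cg / √μψ).trans (Real.le_coe_toNNReal _)
        rw [le_div_iff₀' (Real.sqrt_pos.2 hμ)]
        exact (le_adjointOpNorm (h.norm_lower i) hμ (h.norm_upper i) hL _).trans
          (h.meanJ_bound i x hx)
      f_lip := fun i => LipschitzWith.of_dist_le' fun u w => by
        rw [mul_assoc]
        exact (h.f_lip i u w).trans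
          (mul_le_mul_of_nonneg_left (dualNorm_le (h.norm_upper i) hL _) hCf)
      gs_var_int := fun i x hx => (hgs i x hx).1
      gs_var := fun i x hx => (hgs i x hx).2
      J_var_int := fun i x hx => (hJ i x hx).1
      J_var := fun i x hx => (hJ i x hx).2 }

namespace Regular

variable {p : Problem d m n Z} {L G s₀ s₁ : ℝ≥0} {i : Fin n} {x z : Vec d}

lemma conjDom_nonempty (h : p.Regular L G s₀ s₁) (i : Fin n) : (conjDom (p.f i)).Nonempty :=
  FCCO.conjDom_nonempty (h.f_convex i) (h.f_lip i).continuous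

lemma norm_le_of_mem_Y (h : p.Regular L G s₀ s₁) {v : Vec m} (hv : v ∈ p.Y i) : ‖v‖ ≤ L :=
  norm_le_of_mem_dualDomain (h.f_lip i) hv

lemma stronglyMeasurable_g (h : p.Regular L G s₀ s₁) (i : Fin n) : StronglyMeasurable (p.g i) :=
  have := h.prob i
  (h.gs_meas i).integral_prod_right

lemma stronglyMeasurable_meanJ (h : p.Regular L G s₀ s₁) (i : Fin n) :
    StronglyMeasurable (p.meanJ i) :=
  have := h.prob i
  (h.J_meas i).integral_prod_right

lemma stronglyMeasurable_gs (h : p.Regular L G s₀ s₁) (i : Fin n) (x : Vec d) :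
    StronglyMeasurable (p.gs i x) :=
  (h.gs_meas i).comp_measurable measurable_prodMk_left

lemma stronglyMeasurable_J (h : p.Regular L G s₀ s₁) (i : Fin n) (x : Vec d) :
    StronglyMeasurable (p.J i x) :=
  (h.J_meas i).comp_measurable measurable_prodMk_left

lemma memLp_J (h : p.Regular L G s₀ s₁) (i : Fin n) (hx : x ∈ p.X) :
    MemLp (p.J i x) 2 (p.P i) := by
  have := h.prob i
  have hvar : MemLp (fun ζ => p.meanJ i x - p.J i x ζ) 2 (p.P i) :=
    (memLp_two_iff_integrable_sq_norm (stronglyMeasurable_const.sub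
      (h.stronglyMeasurable_J i x)).aestronglyMeasurable).2 (h.J_var_int i x hx)
  refine ((memLp_const (p.meanJ i x)).sub hvar).congr_norm
    (h.stronglyMeasurable_J i x).aestronglyMeasurable (ae_of_all _ fun ζ => ?_)
  simp

lemma integral_norm_J_sq_le (h : p.Regular L G s₀ s₁) (i : Fin n) (hx : x ∈ p.X) :
    ∫ ζ, ‖p.J i x ζ‖ ^ 2 ∂(p.P i) ≤ 2 * (G ^ 2 + s₁) := by
  have := h.prob i
  have hle : ∀ ζ, ‖p.J i x ζ‖ ^ 2 ≤ 2 * ((G : ℝ) ^ 2 + ‖p.meanJ i x - p.J i x ζ‖ ^ 2) := by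
    intro ζ
    have htriangle : ‖p.J i x ζ‖ ≤ G + ‖p.meanJ i x - p.J i x ζ‖ :=
      (norm_le_norm_add_norm_sub (p.meanJ i x) (p.J i x ζ)).trans
        (by gcongr; exact h.norm_meanJ_le i x hx)
    exact (pow_le_pow_left₀ (norm_nonneg _) htriangle 2).trans (add_sq_le)
  have hint := h.J_var_int i x hx
  refine (integral_mono (h.memLp_J i hx).norm.integrable_sq
    (((integrable_const _).add hint).const_mul 2) hle).trans ?_
  simp only [Pi.add_apply]
  rw [integral_const_mul, integral_add (integrable_const _) hint]
  simpa using h.J_var i x hx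

lemma g_subgradient (h : p.Regular L G s₀ s₁) (i : Fin n) (hx : x ∈ p.X) (hz : z ∈ p.X)
    (j : Fin m) : p.g i x j + p.meanJ i x (z - x) j ≤ p.g i z j := by
  have hg : ∀ w ∈ p.X, p.g i w j = ∫ ζ, p.gs i w ζ j ∂(p.P i) := fun w hw =>
    ((EuclideanSpace.proj (𝕜 := ℝ) j).integral_comp_comm (h.gs_int i w hw)).symm
  have hg_int : ∀ w ∈ p.X, Integrable (fun ζ => p.gs i w ζ j) (p.P i) := fun w hw =>
    (EuclideanSpace.proj (𝕜 := ℝ) j).integrable_comp (h.gs_int i w hw)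
  have hJ := (h.J_int i x hx).apply_continuousLinearMap (z - x)
  have hJ_int : Integrable (fun ζ => p.J i x ζ (z - x) j) (p.P i) :=
    (EuclideanSpace.proj (𝕜 := ℝ) j).integrable_comp hJ
  have hmeanJ : p.meanJ i x (z - x) j = ∫ ζ, p.J i x ζ (z - x) j ∂(p.P i) := by
    rw [meanJ, ContinuousLinearMap.integral_apply (h.J_int i x hx)]
    exact ((EuclideanSpace.proj (𝕜 := ℝ) j).integral_comp_comm hJ).symm
  rw [hg x hx, hg z hz, hmeanJ, ← integral_add (hg_int x hx) hJ_int]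
  exact integral_mono ((hg_int x hx).add hJ_int) (hg_int z hz) fun ζ =>
    h.J_subgradient i ζ x hx z hz j

lemma inner_g_subgradient (h : p.Regular L G s₀ s₁) (hx : x ∈ p.X) (hz : z ∈ p.X) {v : Vec m}
    (hv : v ∈ conjDom (p.f i)) :
    inner ℝ v (p.g i x) + inner ℝ (adjoint (p.meanJ i x) v) (z - x) ≤ inner ℝ v (p.g i z) := by
  rw [ContinuousLinearMap.adjoint_inner_left, ← inner_add_right]
  rcases h.f_mono i with hmono | haffine
  · rw [← sub_nonneg, ← inner_sub_right, PiLp.inner_apply]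
    refine Finset.sum_nonneg fun j _ => ?_
    simpa using mul_nonneg (sub_nonneg.2 (h.g_subgradient i hx hz j))
      (nonneg_of_mem_conjDom hmono hv j)
  · rw [haffine x hx z hz]

lemma norm_adjoint_meanJ_le (h : p.Regular L G s₀ s₁) (hx : x ∈ p.X) {v : Vec m}
    (hv : v ∈ conjDom (p.f i)) : ‖adjoint (p.meanJ i x) v‖ ≤ L * G := by
  refine (norm_adjoint_apply_le _ v).trans ?_
  rw [mul_comm]
  gcongr
  · exact norm_le_of_mem_conjDom (h.f_lip i) hv
  · exact h.norm_meanJ_le i x hx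

lemma inner_g_sub_le (h : p.Regular L G s₀ s₁) (hx : x ∈ p.X) (hz : z ∈ p.X) {v : Vec m}
    (hv : v ∈ conjDom (p.f i)) : inner ℝ v (p.g i z - p.g i x) ≤ L * G * ‖z - x‖ := by
  have hsub := h.inner_g_subgradient hz hx hv
  have hle := (real_inner_le_norm (adjoint (p.meanJ i z) v) (z - x)).trans
    (mul_le_mul_of_nonneg_right (h.norm_adjoint_meanJ_le hz hv) (norm_nonneg _))
  rw [← neg_sub, inner_neg_right] at hsub
  rw [inner_sub_right]
  linarith

lemma inner_g_average_le (h : p.Regular L G s₀ s₁) {T : ℕ} (hT : 1 ≤ T) {x : ℕ → Vec d}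
    (hx : ∀ t, x t ∈ p.X) (hxb : (1 / (T : ℝ)) • ∑ t ∈ Finset.range T, x t ∈ p.X)
    {v : Vec m} (hv : v ∈ conjDom (p.f i)) :
    T * inner ℝ v (p.g i ((1 / (T : ℝ)) • ∑ t ∈ Finset.range T, x t))
      ≤ ∑ t ∈ Finset.range T, inner ℝ v (p.g i (x t)) := by
  have hT0 : (T : ℝ) ≠ 0 := Nat.cast_ne_zero.2 (by omega)
  set xb := (1 / (T : ℝ)) • ∑ t ∈ Finset.range T, x t with hxb_def
  have hsum := Finset.sum_le_sum fun t (_ : t ∈ Finset.range T) =>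
    h.inner_g_subgradient hxb (hx t) hv
  have hcentred : ∑ t ∈ Finset.range T, inner ℝ (adjoint (p.meanJ i xb) v) (x t - xb) = 0 := by
    rw [← inner_sum, Finset.sum_sub_distrib, Finset.sum_const, Finset.card_range,
      ← Nat.cast_smul_eq_nsmul ℝ, hxb_def, smul_smul, mul_one_div_cancel hT0, one_smul, sub_self,
      inner_zero_right]
  rw [Finset.sum_add_distrib, hcentred, add_zero] at hsum
  simpa using hsum

end Regular

end Problem

/-! ### One draw from a fixed state -/

lemma integral_comp_of_measurePreserving {α β E : Type*} [MeasurableSpace α] [MeasurableSpace β]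
    [NormedAddCommGroup E] [NormedSpace ℝ E] {μ : Measure α} {ν : Measure β} {f : α → β}
    {φ : β → E} (hf : MeasurePreserving f μ ν) (hφ : AEStronglyMeasurable φ ν) :
    ∫ a, φ (f a) ∂μ = ∫ b, φ b ∂ν := by
  rw [← hf.map_eq] at hφ ⊢
  exact (integral_map hf.aemeasurable hφ).symm

section Adjoint

variable {d m : ℕ} {α : Type*} [MeasurableSpace α] {A : α → Vec d →L[ℝ] Vec m}

lemma continuous_adjoint : Continuous fun A : Vec d →L[ℝ] Vec m => adjoint A :=
  LinearIsometryEquiv.continuous _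

lemma stronglyMeasurable_adjoint_apply {v : α → Vec m} (hA : StronglyMeasurable A)
    (hv : StronglyMeasurable v) : StronglyMeasurable fun a => adjoint (A a) (v a) :=
  isBoundedBilinearMap_apply.continuous.comp_stronglyMeasurable
    ((continuous_adjoint.comp_stronglyMeasurable hA).prodMk hv)

lemma integral_adjoint_apply {μ : Measure α} (hA : Integrable A μ) (v : Vec m) :
    ∫ a, adjoint (A a) v ∂μ = adjoint (∫ a, A a ∂μ) v := by
  have hint : Integrable (fun a => adjoint (A a) v) μ :=
    (hA.norm.mul_const ‖v‖).mono'
      (isBoundedBilinearMap_apply.continuous.comp_aestronglyMeasurable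
        ((continuous_adjoint.comp_aestronglyMeasurable hA.1).prodMk aestronglyMeasurable_const))
      (ae_of_all _ fun a => norm_adjoint_apply_le (A a) v)
  refine ext_inner_left ℝ fun z => ?_
  rw [← integral_inner hint, ContinuousLinearMap.adjoint_inner_right,
    ContinuousLinearMap.integral_apply hA, real_inner_comm,
    ← integral_inner (hA.apply_continuousLinearMap z)]
  simp_rw [ContinuousLinearMap.adjoint_inner_right, real_inner_comm]

end Adjoint

/-- The primal and dual iterates of ALEXR at a given time. -/
abbrev State (d m n : ℕ) : Type := Vec d × (Fin n → Vec m)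

namespace Problem

variable {d m n : ℕ} {Z : Type*} [MeasurableSpace Z]

section Defs

variable (p : Problem d m n Z) {B : ℕ}

/-- The law of the mini-batches of all blocks. -/
noncomputable def sampleLaw (B : ℕ) : Measure (Fin n → Fin B → Z) :=
  Measure.pi fun i => Measure.pi fun _ : Fin B => p.P i

/-- The error of the mini-batch estimator of the `i`-th inner function. -/
noncomputable def innerError (i : Fin n) (x : Vec d) (b : Fin B → Z) : Vec m :=
  p.g i x - p.gBatch i x b

/-- The dual update that block `i` would undergo from the state `u` if it were drawn. -/
noncomputable def fullDual (τ : ℝ) (i : Fin n) (u : State d m n) (b : Fin B → Z) : Vec m :=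
  prox (conjDom (p.f i)) (conjReal (p.f i)) τ (u.2 i + τ⁻¹ • p.gBatch i u.1 b)

/-- The displacement of the dual block `i` under its full update. -/
noncomputable def dualStep (τ : ℝ) (i : Fin n) (u : State d m n) (b : Fin B → Z) : Vec m :=
  p.fullDual τ i u b - u.2 i

/-- The centred noise of the dual block `i`: the oracle error together with the fluctuation of
the proximal term `τ • dualStep` due to the block sampling. -/
noncomputable def dualNoise (S : ℕ) (τ : ℝ) (i : Fin n) (u : State d m n) (q : Draw n B Z) :
    Vec m :=
  p.innerError i u.1 (q.2.1 i) + (τ * weight S i q.1) • p.dualStep τ i u (q.2.1 i)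

/-- The gradient in `x` of the coupling term at the full dual update. -/
noncomputable def fullGrad (τ : ℝ) (u : State d m n) (q : Draw n B Z) : Vec d :=
  (1 / (n : ℝ)) • ∑ i, adjoint (p.meanJ i u.1) (p.fullDual τ i u (q.2.1 i))

/-- The contribution of block `i`, when it is drawn, to the gradient estimator. -/
noncomputable def blockGrad (τ : ℝ) (i : Fin n) (u : State d m n) (q : Draw n B Z) : Vec d :=
  adjoint (p.JBatch i u.1 (q.2.2 i)) (p.fullDual τ i u (q.2.1 i))

/-- The gradient estimator of ALEXR, as a function of the state and the draw. -/
noncomputable def stochGrad (S : ℕ) (τ : ℝ) (u : State d m n) (q : Draw n B Z) : Vec d :=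
  (1 / (S : ℝ)) • ∑ i ∈ q.1, p.blockGrad τ i u q

lemma drawLaw_eq (S : ℕ) :
    p.drawLaw S B = (blockLaw n S).prod ((p.sampleLaw B).prod (p.sampleLaw B)) := rfl

lemma innerError_eq (hB : 1 ≤ B) (i : Fin n) (x : Vec d) (b : Fin B → Z) :
    p.innerError i x b = (1 / (B : ℝ)) • ∑ k, (p.g i x - p.gs i x (b k)) := by
  have hB0 : (B : ℝ) ≠ 0 := Nat.cast_ne_zero.2 (by omega)
  rw [Finset.sum_sub_distrib, Finset.sum_const, Finset.card_univ, Fintype.card_fin,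
    ← Nat.cast_smul_eq_nsmul ℝ, smul_sub, smul_smul, one_div_mul_cancel hB0, one_smul, innerError,
    gBatch]

lemma stochGrad_eq (S : ℕ) (τ : ℝ) (u : State d m n) (q : Draw n B Z) :
    p.stochGrad S τ u q = (1 / (n : ℝ)) • ∑ i, (1 - weight S i q.1) • p.blockGrad τ i u q :=
  smul_sum_mem_eq_smul_sum_weight _ _

end Defs

namespace Regular

variable {p : Problem d m n Z} {L G s₀ s₁ : ℝ≥0} {S B : ℕ} {τ : ℝ} {x : Vec d} {u : State d m n}

section Laws

lemma isProbabilityMeasure_sampleLaw (h : p.Regular L G s₀ s₁) :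
    IsProbabilityMeasure (p.sampleLaw B) := by
  have := h.prob
  unfold sampleLaw
  infer_instance

lemma isProbabilityMeasure_drawLaw (h : p.Regular L G s₀ s₁) (hSn : S ≤ n) :
    IsProbabilityMeasure (p.drawLaw S B) := by
  have := isProbabilityMeasure_blockLaw hSn
  have := h.isProbabilityMeasure_sampleLaw (B := B)
  rw [drawLaw_eq]
  infer_instance

lemma measurePreserving_dualBatch (h : p.Regular L G s₀ s₁) (hSn : S ≤ n) (i : Fin n) :
    MeasurePreserving (fun q : Draw n B Z => q.2.1 i) (p.drawLaw S B)
      (Measure.pi fun _ => p.P i) := by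
  have := isProbabilityMeasure_blockLaw hSn
  have := h.isProbabilityMeasure_sampleLaw (B := B)
  have := h.prob
  exact (measurePreserving_eval (fun i => Measure.pi fun _ : Fin B => p.P i) i).comp
    ((measurePreserving_fst (μ := p.sampleLaw B) (ν := p.sampleLaw B)).comp
      (measurePreserving_snd (μ := blockLaw n S)))

lemma measurePreserving_primalBatch (h : p.Regular L G s₀ s₁) (hSn : S ≤ n) (i : Fin n) :
    MeasurePreserving (fun q : Draw n B Z => q.2.2 i) (p.drawLaw S B)
      (Measure.pi fun _ => p.P i) := by
  have := isProbabilityMeasure_blockLaw hSn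
  have := h.isProbabilityMeasure_sampleLaw (B := B)
  have := h.prob
  exact (measurePreserving_eval (fun i => Measure.pi fun _ : Fin B => p.P i) i).comp
    ((measurePreserving_snd (μ := p.sampleLaw B) (ν := p.sampleLaw B)).comp
      (measurePreserving_snd (μ := blockLaw n S)))

end Laws

section Weight

variable {E : Type*} [NormedAddCommGroup E] [NormedSpace ℝ E]

lemma integral_weight_smul (h : p.Regular L G s₀ s₁) (hS : 1 ≤ S) (hSn : S ≤ n) (i : Fin n)
    (H : (Fin n → Fin B → Z) × (Fin n → Fin B → Z) → E) :
    ∫ q, weight S i q.1 • H q.2 ∂(p.drawLaw S B) = 0 := by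
  have := isProbabilityMeasure_blockLaw hSn
  have := h.isProbabilityMeasure_sampleLaw (B := B)
  rw [drawLaw_eq, integral_prod_smul, integral_weight i hS hSn, zero_smul]

lemma integrable_weight_smul {α : Type*} [MeasurableSpace α] {μ : Measure α}
    {A : α → Finset (Fin n)} (hA : Measurable A) (i : Fin n) {H : α → E} (hH : Integrable H μ) :
    Integrable (fun a => weight S i (A a) • H a) μ :=
  hH.bdd_smul (1 + (n : ℝ) / S)
    ((Measurable.of_discrete (f := weight S i)).comp hA).aestronglyMeasurable
    (ae_of_all _ fun a => abs_weight_le i (A a))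

lemma integrable_one_sub_weight_smul {α : Type*} [MeasurableSpace α] {μ : Measure α}
    {A : α → Finset (Fin n)} (hA : Measurable A) (i : Fin n) {H : α → E} (hH : Integrable H μ) :
    Integrable (fun a => (1 - weight S i (A a)) • H a) μ := by
  simp only [sub_smul, one_smul]
  exact hH.sub (integrable_weight_smul hA i hH)

lemma integral_one_sub_weight_smul (h : p.Regular L G s₀ s₁) (hS : 1 ≤ S) (hSn : S ≤ n)
    (i : Fin n) {H : (Fin n → Fin B → Z) × (Fin n → Fin B → Z) → E}
    (hH : Integrable (fun q : Draw n B Z => H q.2) (p.drawLaw S B)) :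
    ∫ q, (1 - weight S i q.1) • H q.2 ∂(p.drawLaw S B) = ∫ q, H q.2 ∂(p.drawLaw S B) := by
  simp only [sub_smul, one_smul]
  rw [integral_sub hH (integrable_weight_smul measurable_fst i hH),
    h.integral_weight_smul hS hSn i H, sub_zero]

end Weight

section Measurability

lemma stronglyMeasurable_gBatch (h : p.Regular L G s₀ s₁) (i : Fin n) :
    StronglyMeasurable fun w : State d m n × Draw n B Z => p.gBatch i w.1.1 (w.2.2.1 i) := by
  refine (Finset.stronglyMeasurable_fun_sum _ fun k _ => ?_).fun_const_smul _
  have hpair : Measurable fun w : State d m n × Draw n B Z => (w.1.1, w.2.2.1 i k) := by fun_prop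
  exact (h.gs_meas i).comp_measurable hpair

lemma stronglyMeasurable_JBatch (h : p.Regular L G s₀ s₁) (i : Fin n) :
    StronglyMeasurable fun w : State d m n × Draw n B Z => p.JBatch i w.1.1 (w.2.2.2 i) := by
  refine (Finset.stronglyMeasurable_fun_sum _ fun k _ => ?_).fun_const_smul _
  have hpair : Measurable fun w : State d m n × Draw n B Z => (w.1.1, w.2.2.2 i k) := by fun_prop
  exact (h.J_meas i).comp_measurable hpair

lemma stronglyMeasurable_innerError (h : p.Regular L G s₀ s₁) (i : Fin n) :
    StronglyMeasurable fun w : State d m n × Draw n B Z => p.innerError i w.1.1 (w.2.2.1 i) :=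
  ((h.stronglyMeasurable_g i).comp_measurable (measurable_fst.comp measurable_fst)).sub
    (h.stronglyMeasurable_gBatch i)

lemma stronglyMeasurable_fullDual (h : p.Regular L G s₀ s₁) (hτ : 0 < τ) (i : Fin n) :
    StronglyMeasurable fun w : State d m n × Draw n B Z => p.fullDual τ i w.1 (w.2.2.1 i) := by
  have hdual : Measurable fun w : State d m n × Draw n B Z => w.1.2 i := by fun_prop
  exact (continuous_prox_conjReal (h.f_convex i) (h.f_lip i) hτ).comp_stronglyMeasurable
    (hdual.stronglyMeasurable.add ((h.stronglyMeasurable_gBatch i).fun_const_smul _))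

lemma stronglyMeasurable_dualStep (h : p.Regular L G s₀ s₁) (hτ : 0 < τ) (i : Fin n) :
    StronglyMeasurable fun w : State d m n × Draw n B Z => p.dualStep τ i w.1 (w.2.2.1 i) := by
  have hdual : Measurable fun w : State d m n × Draw n B Z => w.1.2 i := by fun_prop
  exact (h.stronglyMeasurable_fullDual hτ i).sub hdual.stronglyMeasurable

lemma stronglyMeasurable_weight (i : Fin n) :
    StronglyMeasurable fun w : State d m n × Draw n B Z => weight S i w.2.1 :=
  ((Measurable.of_discrete (f := weight S i)).comp
    (measurable_fst.comp measurable_snd)).stronglyMeasurable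

lemma stronglyMeasurable_dualNoise (h : p.Regular L G s₀ s₁) (hτ : 0 < τ) (i : Fin n) :
    StronglyMeasurable fun w : State d m n × Draw n B Z => p.dualNoise S τ i w.1 w.2 :=
  (h.stronglyMeasurable_innerError i).add
    (((stronglyMeasurable_weight i).const_mul τ).smul (h.stronglyMeasurable_dualStep hτ i))

lemma stronglyMeasurable_fullGrad (h : p.Regular L G s₀ s₁) (hτ : 0 < τ) :
    StronglyMeasurable fun w : State d m n × Draw n B Z => p.fullGrad τ w.1 w.2 :=
  (Finset.stronglyMeasurable_fun_sum _ fun i _ => stronglyMeasurable_adjoint_apply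
    ((h.stronglyMeasurable_meanJ i).comp_measurable (measurable_fst.comp measurable_fst))
    (h.stronglyMeasurable_fullDual hτ i)).fun_const_smul _

lemma stronglyMeasurable_blockGrad (h : p.Regular L G s₀ s₁) (hτ : 0 < τ) (i : Fin n) :
    StronglyMeasurable fun w : State d m n × Draw n B Z => p.blockGrad τ i w.1 w.2 :=
  stronglyMeasurable_adjoint_apply (h.stronglyMeasurable_JBatch i)
    (h.stronglyMeasurable_fullDual hτ i)

lemma stronglyMeasurable_stochGrad (h : p.Regular L G s₀ s₁) (hτ : 0 < τ) :
    StronglyMeasurable fun w : State d m n × Draw n B Z => p.stochGrad S τ w.1 w.2 := by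
  simp only [stochGrad_eq]
  exact (Finset.stronglyMeasurable_fun_sum _ fun i _ =>
    (stronglyMeasurable_const.sub (stronglyMeasurable_weight i)).smul
      (h.stronglyMeasurable_blockGrad hτ i)).fun_const_smul _

end Measurability

end Regular

end Problem

namespace Problem

variable {d m n : ℕ} {Z : Type*} [MeasurableSpace Z]

namespace Regular

variable {p : Problem d m n Z} {L G s₀ s₁ : ℝ≥0} {S B : ℕ} {τ : ℝ} {x : Vec d} {u : State d m n}

section DualNoise

lemma fullDual_mem (h : p.Regular L G s₀ s₁) (i : Fin n) (u : State d m n) (b : Fin B → Z) :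
    p.fullDual τ i u b ∈ conjDom (p.f i) :=
  (isProx_prox_conjReal (h.f_convex i) (h.f_lip i) τ _).1

lemma norm_fullDual_le (h : p.Regular L G s₀ s₁) (i : Fin n) (u : State d m n) (b : Fin B → Z) :
    ‖p.fullDual τ i u b‖ ≤ L :=
  norm_le_of_mem_conjDom (h.f_lip i) (h.fullDual_mem i u b)

lemma norm_dualStep_le (h : p.Regular L G s₀ s₁) (i : Fin n) (u : State d m n) (b : Fin B → Z) :
    ‖p.dualStep τ i u b‖ ≤ L + ‖u.2 i‖ :=
  (norm_sub_le _ _).trans (by gcongr; exact h.norm_fullDual_le i u b)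

lemma memLp_g_sub_gs (h : p.Regular L G s₀ s₁) (i : Fin n) (hx : x ∈ p.X) :
    MemLp (fun ζ => p.g i x - p.gs i x ζ) 2 (p.P i) :=
  (memLp_two_iff_integrable_sq_norm
    (stronglyMeasurable_const.sub (h.stronglyMeasurable_gs i x)).aestronglyMeasurable).2
    (h.gs_var_int i x hx)

lemma integral_g_sub_gs (h : p.Regular L G s₀ s₁) (i : Fin n) (hx : x ∈ p.X) :
    ∫ ζ, (p.g i x - p.gs i x ζ) ∂(p.P i) = 0 := by
  have := h.prob i
  rw [integral_sub (integrable_const _) (h.gs_int i x hx)]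
  simp [g]

lemma memLp_innerError (h : p.Regular L G s₀ s₁) (hB : 1 ≤ B) (i : Fin n) (hx : x ∈ p.X) :
    MemLp (p.innerError (B := B) i x) 2 (Measure.pi fun _ => p.P i) := by
  have := h.prob i
  have heq : p.innerError i x =
      fun b : Fin B → Z => (1 / (B : ℝ)) • ∑ k, (p.g i x - p.gs i x (b k)) :=
    funext (p.innerError_eq hB i x)
  rw [heq]
  exact memLp_batch (u := fun ζ => p.g i x - p.gs i x ζ) (h.memLp_g_sub_gs i hx)

lemma integral_innerError (h : p.Regular L G s₀ s₁) (hB : 1 ≤ B) (i : Fin n) (hx : x ∈ p.X) :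
    ∫ b : Fin B → Z, p.innerError i x b ∂(Measure.pi fun _ => p.P i) = 0 := by
  have := h.prob i
  simp only [innerError_eq p hB]
  rw [integral_batch hB ((h.memLp_g_sub_gs i hx).integrable one_le_two), h.integral_g_sub_gs i hx]

lemma integral_norm_innerError_sq_le (h : p.Regular L G s₀ s₁) (hB : 1 ≤ B) (i : Fin n)
    (hx : x ∈ p.X) :
    ∫ b : Fin B → Z, ‖p.innerError i x b‖ ^ 2 ∂(Measure.pi fun _ => p.P i) ≤ s₀ / B := by
  have := h.prob i
  simp only [innerError_eq p hB]
  rw [integral_norm_sq_batch (u := fun ζ => p.g i x - p.gs i x ζ)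
    (stronglyMeasurable_const.sub (h.stronglyMeasurable_gs i x)).measurable
    (h.memLp_g_sub_gs i hx) (h.integral_g_sub_gs i hx)]
  gcongr
  exact h.gs_var i x hx

lemma integrable_weight_smul_dualStep (h : p.Regular L G s₀ s₁) (hτ : 0 < τ) (hSn : S ≤ n)
    (i : Fin n) (u : State d m n) :
    Integrable (fun q : Draw n B Z => weight S i q.1 • p.dualStep τ i u (q.2.1 i))
      (p.drawLaw S B) := by
  have := h.isProbabilityMeasure_drawLaw (B := B) hSn
  exact integrable_weight_smul measurable_fst i (Integrable.of_bound
    ((h.stronglyMeasurable_dualStep hτ i).comp_measurable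
      measurable_prodMk_left).aestronglyMeasurable (L + ‖u.2 i‖)
    (ae_of_all _ fun q => h.norm_dualStep_le i u (q.2.1 i)))

lemma integrable_dualNoise_terms (h : p.Regular L G s₀ s₁) (hτ : 0 < τ) (hSn : S ≤ n) (hB : 1 ≤ B)
    (i : Fin n) (hx : u.1 ∈ p.X) :
    Integrable (fun q : Draw n B Z => p.innerError i u.1 (q.2.1 i)) (p.drawLaw S B) ∧
      Integrable (fun q : Draw n B Z => τ • weight S i q.1 • p.dualStep τ i u (q.2.1 i))
        (p.drawLaw S B) := by
  have := h.prob i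
  exact ⟨(h.measurePreserving_dualBatch hSn i).integrable_comp_of_integrable
    ((h.memLp_innerError hB i hx).integrable one_le_two),
    (h.integrable_weight_smul_dualStep hτ hSn i u).smul τ⟩

lemma integrable_dualNoise (h : p.Regular L G s₀ s₁) (hτ : 0 < τ) (hSn : S ≤ n) (hB : 1 ≤ B)
    (i : Fin n) (hx : u.1 ∈ p.X) :
    Integrable (p.dualNoise (B := B) S τ i u) (p.drawLaw S B) := by
  obtain ⟨herror, hstep⟩ := h.integrable_dualNoise_terms hτ hSn hB i hx
  refine (herror.add hstep).congr (ae_of_all _ fun q => ?_)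
  simp only [dualNoise, mul_smul, Pi.add_apply]

lemma integral_dualNoise (h : p.Regular L G s₀ s₁) (hτ : 0 < τ) (hS : 1 ≤ S) (hSn : S ≤ n)
    (hB : 1 ≤ B) (i : Fin n) (hx : u.1 ∈ p.X) :
    ∫ q, p.dualNoise (B := B) S τ i u q ∂(p.drawLaw S B) = 0 := by
  obtain ⟨herror, hstep⟩ := h.integrable_dualNoise_terms hτ hSn hB i hx
  simp only [dualNoise, mul_smul]
  rw [integral_add herror hstep,
    integral_comp_of_measurePreserving (h.measurePreserving_dualBatch hSn i)
      (h.memLp_innerError hB i hx).1, h.integral_innerError hB i hx,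
    integral_smul, h.integral_weight_smul hS hSn i fun b => p.dualStep τ i u (b.1 i), smul_zero,
    add_zero]

end DualNoise

section Gradient

lemma memLp_JBatch (h : p.Regular L G s₀ s₁) (hSn : S ≤ n) (i : Fin n) (hx : x ∈ p.X) :
    MemLp (fun q : Draw n B Z => p.JBatch i x (q.2.2 i)) 2 (p.drawLaw S B) :=
  have := h.prob i
  (memLp_batch (h.memLp_J i hx)).comp_measurePreserving (h.measurePreserving_primalBatch hSn i)

lemma integral_norm_JBatch_sq_le (h : p.Regular L G s₀ s₁) (hSn : S ≤ n) (hB : 1 ≤ B) (i : Fin n)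
    (hx : x ∈ p.X) :
    ∫ q : Draw n B Z, ‖p.JBatch i x (q.2.2 i)‖ ^ 2 ∂(p.drawLaw S B) ≤ 2 * (G ^ 2 + s₁) := by
  have := h.prob i
  have hJ := h.memLp_J i hx
  rw [integral_comp_of_measurePreserving (φ := fun b => ‖p.JBatch i x b‖ ^ 2)
    (h.measurePreserving_primalBatch hSn i) (memLp_batch hJ).norm.integrable_sq.1]
  exact (integral_norm_sq_batch_le hB hJ.norm.integrable_sq).trans (h.integral_norm_J_sq_le i hx)

lemma norm_blockGrad_le (h : p.Regular L G s₀ s₁) (i : Fin n) (u : State d m n)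
    (q : Draw n B Z) : ‖p.blockGrad τ i u q‖ ≤ L * ‖p.JBatch i u.1 (q.2.2 i)‖ := by
  refine (norm_adjoint_apply_le _ _).trans ?_
  rw [mul_comm]
  gcongr
  exact h.norm_fullDual_le i u _

lemma memLp_blockGrad (h : p.Regular L G s₀ s₁) (hτ : 0 < τ) (hSn : S ≤ n) (i : Fin n)
    (hx : u.1 ∈ p.X) : MemLp (p.blockGrad (B := B) τ i u) 2 (p.drawLaw S B) :=
  (h.memLp_JBatch hSn i hx).of_le_mul ((h.stronglyMeasurable_blockGrad hτ i).comp_measurable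
    measurable_prodMk_left).aestronglyMeasurable (ae_of_all _ fun q => h.norm_blockGrad_le i u q)

lemma integral_norm_blockGrad_sq_le (h : p.Regular L G s₀ s₁) (hτ : 0 < τ) (hSn : S ≤ n)
    (hB : 1 ≤ B) (i : Fin n) (hx : u.1 ∈ p.X) :
    ∫ q : Draw n B Z, ‖p.blockGrad τ i u q‖ ^ 2 ∂(p.drawLaw S B)
      ≤ L ^ 2 * (2 * (G ^ 2 + s₁)) := calc
  _ ≤ ∫ q : Draw n B Z, (L : ℝ) ^ 2 * ‖p.JBatch i u.1 (q.2.2 i)‖ ^ 2 ∂(p.drawLaw S B) := by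
    refine integral_mono (h.memLp_blockGrad hτ hSn i hx).norm.integrable_sq
      ((h.memLp_JBatch hSn i hx).norm.integrable_sq.const_mul _) fun q => ?_
    rw [← mul_pow]
    exact pow_le_pow_left₀ (norm_nonneg _) (h.norm_blockGrad_le i u q) 2
  _ ≤ L ^ 2 * (2 * (G ^ 2 + s₁)) := by
    rw [integral_const_mul]
    gcongr
    exact h.integral_norm_JBatch_sq_le hSn hB i hx

lemma norm_stochGrad_sq_le (u : State d m n) {q : Draw n B Z} (hq : q.1.card = S) :
    ‖p.stochGrad S τ u q‖ ^ 2
      ≤ 1 / (n : ℝ) * ∑ i, (1 - weight S i q.1) * ‖p.blockGrad τ i u q‖ ^ 2 := by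
  have haverage := norm_sq_average_le q.1 fun i => p.blockGrad τ i u q
  rw [hq] at haverage
  exact haverage.trans_eq
    (smul_sum_mem_eq_smul_sum_weight q.1 fun i => ‖p.blockGrad τ i u q‖ ^ 2)

lemma ae_card_drawLaw (h : p.Regular L G s₀ s₁) (hSn : S ≤ n) :
    ∀ᵐ q ∂(p.drawLaw S B), q.1.card = S := by
  have := isProbabilityMeasure_blockLaw hSn
  have := h.isProbabilityMeasure_sampleLaw (B := B)
  exact Measure.quasiMeasurePreserving_fst.ae ae_card_blockLaw

lemma memLp_stochGrad (h : p.Regular L G s₀ s₁) (hτ : 0 < τ) (hSn : S ≤ n) (hx : u.1 ∈ p.X) :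
    MemLp (p.stochGrad (B := B) S τ u) 2 (p.drawLaw S B) := by
  have hterm (i : Fin n) : MemLp (fun q : Draw n B Z => (1 - weight S i q.1) • p.blockGrad τ i u q)
      2 (p.drawLaw S B) := by
    refine (h.memLp_blockGrad hτ hSn i hx).of_le_mul (c := 2 + (n : ℝ) / S)
      (((measurable_const.sub ((Measurable.of_discrete (f := weight S i)).comp
        measurable_fst)).aestronglyMeasurable).smul (h.memLp_blockGrad hτ hSn i hx).1)
      (ae_of_all _ fun q => ?_)
    rw [norm_smul]
    gcongr
    have hweight := abs_weight_le (S := S) i q.1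
    exact (norm_sub_le _ _).trans (by rw [norm_one, Real.norm_eq_abs]; linarith)
  rw [show p.stochGrad (B := B) S τ u = _ from funext (p.stochGrad_eq S τ u)]
  exact (memLp_finsetSum _ fun i _ => hterm i).const_smul (1 / (n : ℝ))

lemma integral_norm_stochGrad_sq_le (h : p.Regular L G s₀ s₁) (hτ : 0 < τ) (hS : 1 ≤ S)
    (hSn : S ≤ n) (hB : 1 ≤ B) (hx : u.1 ∈ p.X) :
    ∫ q : Draw n B Z, ‖p.stochGrad S τ u q‖ ^ 2 ∂(p.drawLaw S B)
      ≤ L ^ 2 * (2 * (G ^ 2 + s₁)) := by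
  have hsq (i : Fin n) := (h.memLp_blockGrad (B := B) hτ hSn i hx).norm.integrable_sq
  have hweighted (i : Fin n) := integrable_one_sub_weight_smul (S := S) measurable_fst i (hsq i)
  have hn : (n : ℝ) ≠ 0 := Nat.cast_ne_zero.2 (by omega)
  calc ∫ q : Draw n B Z, ‖p.stochGrad S τ u q‖ ^ 2 ∂(p.drawLaw S B)
      ≤ ∫ q : Draw n B Z, 1 / (n : ℝ) * ∑ i, (1 - weight S i q.1) * ‖p.blockGrad τ i u q‖ ^ 2
          ∂(p.drawLaw S B) :=
        integral_mono_ae (h.memLp_stochGrad hτ hSn hx).norm.integrable_sq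
          ((integrable_finsetSum _ fun i _ => hweighted i).const_mul _)
          ((h.ae_card_drawLaw hSn).mono fun q hq => norm_stochGrad_sq_le u hq)
    _ = 1 / (n : ℝ) * ∑ i, ∫ q : Draw n B Z, ‖p.blockGrad τ i u q‖ ^ 2 ∂(p.drawLaw S B) := by
        simp only [smul_eq_mul] at hweighted
        rw [integral_const_mul, integral_finsetSum _ fun i _ => hweighted i]
        congr! 2 with i
        exact h.integral_one_sub_weight_smul hS hSn i (H := fun b =>
          ‖adjoint (p.JBatch i u.1 (b.2 i)) (p.fullDual τ i u (b.1 i))‖ ^ 2) (hsq i)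
    _ ≤ 1 / (n : ℝ) * ∑ _i : Fin n, (L : ℝ) ^ 2 * (2 * ((G : ℝ) ^ 2 + s₁)) := by
        gcongr with i
        exact h.integral_norm_blockGrad_sq_le hτ hSn hB i hx
    _ = L ^ 2 * (2 * (G ^ 2 + s₁)) := by
        rw [Finset.sum_const, Finset.card_univ, Fintype.card_fin, nsmul_eq_mul]
        field_simp

lemma integral_JBatch (h : p.Regular L G s₀ s₁) (hB : 1 ≤ B) (i : Fin n) (hx : x ∈ p.X) :
    ∫ c : Fin n → Fin B → Z, p.JBatch i x (c i) ∂(p.sampleLaw B) = p.meanJ i x := by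
  have := h.prob
  exact (integral_comp_of_measurePreserving (φ := p.JBatch i x)
    (measurePreserving_eval (fun i => Measure.pi fun _ : Fin B => p.P i) i)
    (memLp_batch (h.memLp_J i hx)).1).trans (integral_batch hB (h.J_int i x hx))

lemma integrable_JBatch (h : p.Regular L G s₀ s₁) (i : Fin n) (hx : x ∈ p.X) :
    Integrable (fun c : Fin n → Fin B → Z => p.JBatch i x (c i)) (p.sampleLaw B) := by
  have := h.prob
  exact (measurePreserving_eval (fun i => Measure.pi fun _ : Fin B => p.P i)
    i).integrable_comp_of_integrable (integrable_batch (h.J_int i x hx))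

lemma integral_blockGrad (h : p.Regular L G s₀ s₁) (hτ : 0 < τ) (hSn : S ≤ n) (hB : 1 ≤ B)
    (i : Fin n) (hx : u.1 ∈ p.X) :
    ∫ q : Draw n B Z, p.blockGrad τ i u q ∂(p.drawLaw S B)
      = ∫ q : Draw n B Z, adjoint (p.meanJ i u.1) (p.fullDual τ i u (q.2.1 i))
          ∂(p.drawLaw S B) := by
  have := isProbabilityMeasure_blockLaw hSn
  have := h.isProbabilityMeasure_sampleLaw (B := B)
  have := h.isProbabilityMeasure_drawLaw (B := B) hSn
  let Φ (b : (Fin n → Fin B → Z) × (Fin n → Fin B → Z)) : Vec d :=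
    adjoint (p.JBatch i u.1 (b.2 i)) (p.fullDual τ i u (b.1 i))
  have hΦ : Integrable Φ ((p.sampleLaw B).prod (p.sampleLaw B)) :=
    Integrable.of_comp_snd (μ := blockLaw n S)
      ((h.memLp_blockGrad hτ hSn i hx).integrable one_le_two) (NeZero.ne _)
  calc ∫ q : Draw n B Z, p.blockGrad τ i u q ∂(p.drawLaw S B)
      = ∫ b, Φ b ∂((p.sampleLaw B).prod (p.sampleLaw B)) :=
        integral_comp_of_measurePreserving
          (measurePreserving_snd (μ := blockLaw n S)) hΦ.1
    _ = ∫ b, ∫ c, Φ (b, c) ∂(p.sampleLaw B) ∂(p.sampleLaw B) := integral_prod _ hΦ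
    _ = ∫ b, adjoint (p.meanJ i u.1) (p.fullDual τ i u (b i)) ∂(p.sampleLaw B) := by
        simp only [Φ, integral_adjoint_apply (h.integrable_JBatch i hx), h.integral_JBatch hB i hx]
    _ = ∫ b, adjoint (p.meanJ i u.1) (p.fullDual τ i u (b.1 i))
          ∂((p.sampleLaw B).prod (p.sampleLaw B)) := by
        rw [integral_fun_fst fun b : Fin n → Fin B → Z =>
          adjoint (p.meanJ i u.1) (p.fullDual τ i u (b i)), probReal_univ, one_smul]
    _ = ∫ q : Draw n B Z, adjoint (p.meanJ i u.1) (p.fullDual τ i u (q.2.1 i))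
          ∂(p.drawLaw S B) := by
        rw [drawLaw_eq, integral_fun_snd (μ := blockLaw n S)
          fun b : (Fin n → Fin B → Z) × (Fin n → Fin B → Z) =>
            adjoint (p.meanJ i u.1) (p.fullDual τ i u (b.1 i)), probReal_univ, one_smul]

lemma norm_fullGrad_le (h : p.Regular L G s₀ s₁) (hx : u.1 ∈ p.X) (q : Draw n B Z) :
    ‖p.fullGrad τ u q‖ ≤ L * G := by
  have hblock (i : Fin n) : ‖adjoint (p.meanJ i u.1) (p.fullDual τ i u (q.2.1 i))‖ ≤ L * G :=
    h.norm_adjoint_meanJ_le hx (h.fullDual_mem i u _)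
  calc ‖p.fullGrad τ u q‖ ≤ 1 / (n : ℝ) * ∑ _i : Fin n, (L * G : ℝ) := by
        rw [fullGrad, norm_smul, Real.norm_of_nonneg (by positivity)]
        gcongr
        exact norm_sum_le_of_le _ fun i _ => hblock i
    _ = L * G * (n / n : ℝ) := by
        rw [Finset.sum_const, Finset.card_univ, Fintype.card_fin, nsmul_eq_mul]
        ring
    _ ≤ L * G := mul_le_of_le_one_right (by positivity) (div_self_le_one _)

lemma integral_stochGrad (h : p.Regular L G s₀ s₁) (hτ : 0 < τ) (hS : 1 ≤ S) (hSn : S ≤ n)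
    (hB : 1 ≤ B) (hx : u.1 ∈ p.X) :
    ∫ q : Draw n B Z, p.stochGrad S τ u q ∂(p.drawLaw S B)
      = ∫ q : Draw n B Z, p.fullGrad τ u q ∂(p.drawLaw S B) := by
  have := h.isProbabilityMeasure_drawLaw (B := B) hSn
  have hblock (i : Fin n) := (h.memLp_blockGrad (B := B) hτ hSn i hx).integrable one_le_two
  have hfull (i : Fin n) : Integrable (fun q : Draw n B Z =>
      adjoint (p.meanJ i u.1) (p.fullDual τ i u (q.2.1 i))) (p.drawLaw S B) := by
    refine Integrable.of_bound
      ((adjoint (p.meanJ i u.1)).continuous.comp_stronglyMeasurable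
        ((h.stronglyMeasurable_fullDual hτ i).comp_measurable
          measurable_prodMk_left)).aestronglyMeasurable (L * G)
      (ae_of_all _ fun q => h.norm_adjoint_meanJ_le hx (h.fullDual_mem i u _))
  simp only [stochGrad_eq, fullGrad]
  rw [integral_smul, integral_smul, integral_finsetSum _ fun i _ => hfull i,
    integral_finsetSum _ fun i _ => integrable_one_sub_weight_smul measurable_fst i (hblock i)]
  congr! 2 with i
  rw [← h.integral_blockGrad hτ hSn hB i hx]
  exact h.integral_one_sub_weight_smul hS hSn i (H := fun b =>
    adjoint (p.JBatch i u.1 (b.2 i)) (p.fullDual τ i u (b.1 i))) (hblock i)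

end Gradient

end Regular

end Problem

/-! ### Iterates -/

namespace Problem

variable {d m n : ℕ} {Z : Type*} [MeasurableSpace Z] {p : Problem d m n Z} {L G s₀ s₁ : ℝ≥0}

/-- The part of the domain on which the regularizer is finite. -/
def finiteDom (p : Problem d m n Z) : Set (Vec d) := {z | z ∈ p.X ∧ p.r z ≠ ⊤}

namespace Regular

lemma coe_toReal_r (h : p.Regular L G s₀ s₁) {z : Vec d} (hz : z ∈ p.finiteDom) :
    ((p.r z).toReal : EReal) = p.r z :=
  EReal.coe_toReal hz.2 (h.r_ne_bot z hz.1)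

lemma convexOn_toReal_r (h : p.Regular L G s₀ s₁) :
    ConvexOn ℝ p.finiteDom fun z => (p.r z).toReal := by
  have hepi : ∀ z ∈ p.finiteDom, ∀ w ∈ p.finiteDom, ∀ a b : ℝ, 0 ≤ a → 0 ≤ b → a + b = 1 →
      a • z + b • w ∈ p.X ∧
        p.r (a • z + b • w) ≤ ((a * (p.r z).toReal + b * (p.r w).toReal : ℝ) : EReal) :=
    fun z hz w hw a b ha hb hab =>
      h.r_convex (x := (z, (p.r z).toReal)) ⟨hz.1, (h.coe_toReal_r hz).ge⟩
        (y := (w, (p.r w).toReal)) ⟨hw.1, (h.coe_toReal_r hw).ge⟩ ha hb hab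
  have hconv : Convex ℝ p.finiteDom := fun z hz w hw a b ha hb hab =>
    ⟨(hepi z hz w hw a b ha hb hab).1,
      ((hepi z hz w hw a b ha hb hab).2.trans_lt (EReal.coe_lt_top _)).ne⟩
  refine ⟨hconv, fun z hz w hw a b ha hb hab => EReal.coe_le_coe_iff.1 ?_⟩
  rw [h.coe_toReal_r (hconv hz hw ha hb hab)]
  exact (hepi z hz w hw a b ha hb hab).2

lemma mem_finiteDom_and_le_of_isArgmin (h : p.Regular L G s₀ s₁) {ℓ : Vec d → ℝ} {a : Vec d}
    (ha : IsArgmin (fun z => (ℓ z : EReal) + p.r z) p.X a) :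
    a ∈ p.finiteDom ∧ ∀ z ∈ p.finiteDom, ℓ a + (p.r a).toReal ≤ ℓ z + (p.r z).toReal := by
  have hmin : ∀ z ∈ p.X, (ℓ a : EReal) + p.r a ≤ (ℓ z : EReal) + p.r z := fun z hz => ha.2 hz
  have haf : a ∈ p.finiteDom := by
    refine ⟨ha.1, fun htop => ?_⟩
    obtain ⟨z, hz, hzt⟩ := h.r_proper
    have hle := hmin z hz
    rw [htop, EReal.coe_add_top, top_le_iff, ← h.coe_toReal_r ⟨hz, hzt⟩, ← EReal.coe_add] at hle
    exact EReal.coe_ne_top _ hle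
  refine ⟨haf, fun z hz => ?_⟩
  have hle := hmin z hz.1
  rwa [← h.coe_toReal_r haf, ← h.coe_toReal_r hz, ← EReal.coe_add, ← EReal.coe_add,
    EReal.coe_le_coe_iff] at hle

end Regular

/-- A run of ALEXR with quadratic distance-generating functions and no extrapolation, started at
`u₀`, whose iterates are gathered in the state process `u`. -/
structure Run (p : Problem d m n Z) (L G s₀ s₁ : ℝ≥0) (S B : ℕ) (η τ : ℝ) (u₀ : State d m n)
    {Ω : Type*} [MeasurableSpace Ω] (Pr : Measure Ω) (ξ : ℕ → Ω → Draw n B Z)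
    (u : ℕ → Ω → State d m n) : Prop where
  regular : p.Regular L G s₀ s₁
  S_pos : 1 ≤ S
  S_le : S ≤ n
  B_pos : 1 ≤ B
  η_pos : 0 < η
  τ_pos : 0 < τ
  x₀_mem : u₀.1 ∈ p.X
  y₀_mem : ∀ i, u₀.2 i ∈ p.Y i
  sampling : p.IsSampling S B Pr ξ
  alexr : p.IsALEXR S B (fun _ => quad) 0 η τ u₀.1 u₀.2 ξ (fun t ω => (u t ω).1)
    fun t ω => (u t ω).2

namespace Run

variable {S B : ℕ} {η τ : ℝ} {u₀ : State d m n} {Ω : Type*} [MeasurableSpace Ω]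
  {Pr : Measure Ω} {ξ : ℕ → Ω → Draw n B Z} {u : ℕ → Ω → State d m n}

section Steps

lemma state_zero (R : Run p L G s₀ s₁ S B η τ u₀ Pr ξ u) (ω : Ω) : u 0 ω = u₀ :=
  Prod.ext (R.alexr.x_zero ω) (R.alexr.y_zero ω)

lemma x_mem (R : Run p L G s₀ s₁ S B η τ u₀ Pr ξ u) (t : ℕ) (ω : Ω) : (u t ω).1 ∈ p.X := by
  cases t with
  | zero => rw [R.state_zero]; exact R.x₀_mem
  | succ t => exact (R.alexr.primal_step t ω).1

lemma y_mem (R : Run p L G s₀ s₁ S B η τ u₀ Pr ξ u) (t : ℕ) (ω : Ω) (i : Fin n) :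
    (u t ω).2 i ∈ p.Y i := by
  induction t with
  | zero => rw [R.state_zero]; exact R.y₀_mem i
  | succ t ih =>
    by_cases hi : i ∈ (ξ t ω).1
    · exact (R.alexr.dual_step t ω i hi).1
    · rwa [R.alexr.dual_stay t ω i hi]

lemma norm_y_le (R : Run p L G s₀ s₁ S B η τ u₀ Pr ξ u) (t : ℕ) (ω : Ω) (i : Fin n) :
    ‖(u t ω).2 i‖ ≤ L :=
  R.regular.norm_le_of_mem_Y (R.y_mem t ω i)

lemma norm_dualStep_le (R : Run p L G s₀ s₁ S B η τ u₀ Pr ξ u) (t : ℕ) (ω : Ω) (i : Fin n) :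
    ‖p.dualStep τ i (u t ω) ((ξ t ω).2.1 i)‖ ≤ 2 * L := by
  linarith [R.regular.norm_dualStep_le (τ := τ) i (u t ω) ((ξ t ω).2.1 i), R.norm_y_le t ω i]

lemma y_succ_of_mem (R : Run p L G s₀ s₁ S B η τ u₀ Pr ξ u) {t : ℕ} {ω : Ω} {i : Fin n}
    (hi : i ∈ (ξ t ω).1) :
    (u (t + 1) ω).2 i = p.fullDual τ i (u t ω) ((ξ t ω).2.1 i) := by
  obtain ⟨hmem, hmin⟩ := mem_conjDom_and_isMinOn_of_isArgmax (R.regular.conjDom_nonempty i)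
    (R.alexr.dual_step t ω i hi)
  have hprox : IsProx (conjDom (p.f i)) (fun v => conjReal (p.f i) v
      + inner ℝ (-p.gBatch i (u t ω).1 ((ξ t ω).2.1 i)) v) τ ((u t ω).2 i)
      ((u (t + 1) ω).2 i) := by
    refine ⟨hmem, fun v hv => ?_⟩
    have hv' := isMinOn_iff.1 hmin v hv
    simp only [extrap, zero_smul, add_zero, bregman_quad] at hv'
    simp only [Set.mem_ofPred_eq, inner_neg_left, real_inner_comm _ (p.gBatch i _ _)]
    linarith
  rw [isProx_add_inner_iff R.τ_pos.ne', smul_neg, sub_neg_eq_add] at hprox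
  exact hprox.eq (isProx_prox_conjReal (R.regular.f_convex i) (R.regular.f_lip i) τ _)
    (convexOn_conjReal _) R.τ_pos

lemma y_succ (R : Run p L G s₀ s₁ S B η τ u₀ Pr ξ u) (t : ℕ) (ω : Ω) (i : Fin n) :
    (u (t + 1) ω).2 i = if i ∈ (ξ t ω).1 then p.fullDual τ i (u t ω) ((ξ t ω).2.1 i)
      else (u t ω).2 i := by
  split_ifs with hi
  exacts [R.y_succ_of_mem hi, R.alexr.dual_stay t ω i hi]

lemma gradEst_eq_stochGrad (R : Run p L G s₀ s₁ S B η τ u₀ Pr ξ u) (t : ℕ) (ω : Ω) :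
    p.gradEst S (ξ t ω).1 (u t ω).1 (ξ t ω).2.2 (u (t + 1) ω).2 =
      p.stochGrad S τ (u t ω) (ξ t ω) := by
  unfold gradEst stochGrad
  exact congrArg _ (Finset.sum_congr rfl fun i hi => by rw [R.y_succ_of_mem hi, blockGrad])

lemma isProx_x_succ (R : Run p L G s₀ s₁ S B η τ u₀ Pr ξ u) (t : ℕ) (ω : Ω) :
    IsProx p.finiteDom (fun z => (p.r z).toReal + inner ℝ (p.stochGrad S τ (u t ω) (ξ t ω)) z) η
      (u t ω).1 (u (t + 1) ω).1 := by
  have hstep := R.alexr.primal_step t ω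
  rw [R.gradEst_eq_stochGrad] at hstep
  obtain ⟨hmem, hmin⟩ := R.regular.mem_finiteDom_and_le_of_isArgmin hstep
  exact ⟨hmem, fun z hz => by simp only [Set.mem_ofPred_eq]; linarith [hmin z hz]⟩

lemma primal_three_point (R : Run p L G s₀ s₁ S B η τ u₀ Pr ξ u) (t : ℕ) (ω : Ω) {z : Vec d}
    (hz : z ∈ p.finiteDom) :
    (p.r (u (t + 1) ω).1).toReal
        + inner ℝ (p.stochGrad S τ (u t ω) (ξ t ω)) (u (t + 1) ω).1
        + η / 2 * ‖(u (t + 1) ω).1 - (u t ω).1‖ ^ 2 + η / 2 * ‖z - (u (t + 1) ω).1‖ ^ 2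
      ≤ (p.r z).toReal + inner ℝ (p.stochGrad S τ (u t ω) (ξ t ω)) z
        + η / 2 * ‖z - (u t ω).1‖ ^ 2 :=
  (R.isProx_x_succ t ω).three_point (R.regular.convexOn_toReal_r.add
    ((innerₛₗ ℝ (p.stochGrad S τ (u t ω) (ξ t ω))).convexOn R.regular.convexOn_toReal_r.1)) hz

lemma dist_x_succ_le (R : Run p L G s₀ s₁ S B η τ u₀ Pr ξ u) (t : ℕ) (ω ω' : Ω) :
    dist (u (t + 1) ω).1 (u (t + 1) ω').1 ≤
      dist ((u t ω).1 - η⁻¹ • p.stochGrad S τ (u t ω) (ξ t ω))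
        ((u t ω').1 - η⁻¹ • p.stochGrad S τ (u t ω') (ξ t ω')) :=
  ((isProx_add_inner_iff R.η_pos.ne' _).1 (R.isProx_x_succ t ω)).dist_le
    ((isProx_add_inner_iff R.η_pos.ne' _).1 (R.isProx_x_succ t ω'))
    R.regular.convexOn_toReal_r R.η_pos

end Steps

section Measurability

lemma measurable_x_succ (R : Run p L G s₀ s₁ S B η τ u₀ Pr ξ u) {t : ℕ}
    (hp : Measurable[past ξ (t + 1)] fun ω => (u t ω, ξ t ω)) :
    Measurable[past ξ (t + 1)] fun ω => (u (t + 1) ω).1 := by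
  have hq : Measurable fun w : State d m n × Draw n B Z =>
      w.1.1 - η⁻¹ • p.stochGrad S τ w.1 w.2 :=
    (measurable_fst.comp measurable_fst).sub
      ((R.regular.stronglyMeasurable_stochGrad R.τ_pos).measurable.fun_const_smul _)
  exact @measurable_of_dist_le _ _ _ (past ξ (t + 1)) _ _ _ _ _ _ _ _ (hq.comp hp)
    (R.dist_x_succ_le t)

lemma measurable_y_succ (R : Run p L G s₀ s₁ S B η τ u₀ Pr ξ u) {t : ℕ}
    (hp : Measurable[past ξ (t + 1)] fun ω => (u t ω, ξ t ω)) :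
    Measurable[past ξ (t + 1)] fun ω => (u (t + 1) ω).2 := by
  refine (@measurable_pi_iff _ _ _ (past ξ (t + 1)) _ _).2 fun i => ?_
  have hstep : Measurable fun w : State d m n × Draw n B Z =>
      if i ∈ w.2.1 then p.fullDual τ i w.1 (w.2.2.1 i) else w.1.2 i :=
    Measurable.ite
      ((measurable_fst.comp measurable_snd) (MeasurableSet.of_discrete (s := {A | i ∈ A})))
      (R.regular.stronglyMeasurable_fullDual R.τ_pos i).measurable
      ((measurable_pi_apply i).comp (measurable_snd.comp measurable_fst))
  simp_rw [R.y_succ]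
  exact hstep.comp hp

lemma measurable_state (R : Run p L G s₀ s₁ S B η τ u₀ Pr ξ u) (t : ℕ) :
    Measurable[past ξ t] (u t) := by
  induction t with
  | zero => rw [show u 0 = fun _ => u₀ from funext R.state_zero]; exact measurable_const
  | succ t ih =>
    have hp : Measurable[past ξ (t + 1)] fun ω => (u t ω, ξ t ω) :=
      (ih.mono (past_mono t.le_succ) le_rfl).prodMk (measurable_past ξ t.lt_succ_self)
    exact (R.measurable_x_succ hp).prodMk (R.measurable_y_succ hp)

lemma measurable_state_draw (R : Run p L G s₀ s₁ S B η τ u₀ Pr ξ u) (t : ℕ) :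
    Measurable fun ω => (u t ω, ξ t ω) :=
  ((R.measurable_state t).mono (past_le R.sampling.meas t) le_rfl).prodMk (R.sampling.meas t)

lemma measurable_blockBatch (R : Run p L G s₀ s₁ S B η τ u₀ Pr ξ u) (t : ℕ) :
    Measurable fun ω => (ξ t ω).1 :=
  measurable_fst.comp (R.sampling.meas t)

lemma measurable_x (R : Run p L G s₀ s₁ S B η τ u₀ Pr ξ u) (t : ℕ) :
    Measurable fun ω => (u t ω).1 :=
  measurable_fst.comp ((R.measurable_state t).mono (past_le R.sampling.meas t) le_rfl)

lemma measurable_y (R : Run p L G s₀ s₁ S B η τ u₀ Pr ξ u) (t : ℕ) :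
    Measurable fun ω => (u t ω).2 :=
  measurable_snd.comp ((R.measurable_state t).mono (past_le R.sampling.meas t) le_rfl)

lemma integral_draw_eq_zero (R : Run p L G s₀ s₁ S B η τ u₀ Pr ξ u) [IsProbabilityMeasure Pr]
    {α E : Type*} [MeasurableSpace α] [NormedAddCommGroup E] [NormedSpace ℝ E] (t : ℕ)
    {U : Ω → α} (hU : Measurable[past ξ t] U) {φ : α → Draw n B Z → E}
    (hφ : StronglyMeasurable (Function.uncurry φ))
    (h0 : ∀ ω, ∫ q, φ (U ω) q ∂(p.drawLaw S B) = 0) : ∫ ω, φ (U ω) (ξ t ω) ∂Pr = 0 :=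
  integral_eq_zero_of_indepFun (indepFun_of_measurable_past R.sampling.meas R.sampling.indep hU)
    (hU.mono (past_le R.sampling.meas t) le_rfl) (R.sampling.meas t) hφ
    (by rwa [R.sampling.law t])

lemma integrable_draw_and_integral_le (R : Run p L G s₀ s₁ S B η τ u₀ Pr ξ u)
    [IsProbabilityMeasure Pr] (t : ℕ) {φ : State d m n → Draw n B Z → ℝ}
    (hφ : Measurable (Function.uncurry φ)) (h0 : ∀ v q, 0 ≤ φ v q) {c : ℝ}
    (hint : ∀ v : State d m n, v.1 ∈ p.X → Integrable (φ v) (p.drawLaw S B))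
    (hle : ∀ v : State d m n, v.1 ∈ p.X → ∫ q, φ v q ∂(p.drawLaw S B) ≤ c) :
    Integrable (fun ω => φ (u t ω) (ξ t ω)) Pr ∧ ∫ ω, φ (u t ω) (ξ t ω) ∂Pr ≤ c :=
  integrable_and_integral_le_of_indepFun
    (indepFun_of_measurable_past R.sampling.meas R.sampling.indep (R.measurable_state t))
    ((R.measurable_state t).mono (past_le R.sampling.meas t) le_rfl) (R.sampling.meas t) hφ h0
    (by rw [R.sampling.law t]; exact fun ω => hint _ (R.x_mem t ω))
    (by rw [R.sampling.law t]; exact fun ω => hle _ (R.x_mem t ω))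

end Measurability

end Run

end Problem

/-! ### Noise along the iterates -/

namespace Problem

variable {d m n : ℕ} {Z : Type*} [MeasurableSpace Z] {p : Problem d m n Z}

lemma norm_sq_dualNoise_le (S : ℕ) {B : ℕ} (τ : ℝ) (i : Fin n) (v : State d m n)
    (q : Draw n B Z) :
    ‖p.dualNoise S τ i v q‖ ^ 2 ≤ 2 * ‖p.innerError i v.1 (q.2.1 i)‖ ^ 2
      + 2 * τ ^ 2 * (weight S i q.1 ^ 2 * ‖p.dualStep τ i v (q.2.1 i)‖ ^ 2) := by
  set e := (τ * weight S i q.1) • p.dualStep τ i v (q.2.1 i) with he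
  have he_sq : ‖e‖ ^ 2 = τ ^ 2 * (weight S i q.1 ^ 2 * ‖p.dualStep τ i v (q.2.1 i)‖ ^ 2) := by
    rw [he, norm_smul, mul_pow, Real.norm_eq_abs, sq_abs, mul_pow, mul_assoc]
  calc ‖p.dualNoise S τ i v q‖ ^ 2 ≤ (‖p.innerError i v.1 (q.2.1 i)‖ + ‖e‖) ^ 2 := by
        gcongr; exact norm_add_le _ _
    _ ≤ 2 * (‖p.innerError i v.1 (q.2.1 i)‖ ^ 2 + ‖e‖ ^ 2) := add_sq_le
    _ = _ := by rw [he_sq]; ring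

namespace Run

variable {L G s₀ s₁ : ℝ≥0} {S B : ℕ} {η τ : ℝ} {u₀ : State d m n} {Ω : Type*}
  [MeasurableSpace Ω] {Pr : Measure Ω} [IsProbabilityMeasure Pr] {ξ : ℕ → Ω → Draw n B Z}
  {u : ℕ → Ω → State d m n}

section DualNoise

lemma integrable_norm_innerError_sq_and_integral_le (R : Run p L G s₀ s₁ S B η τ u₀ Pr ξ u)
    (t : ℕ) (i : Fin n) :
    Integrable (fun ω => ‖p.innerError i (u t ω).1 ((ξ t ω).2.1 i)‖ ^ 2) Pr ∧
      ∫ ω, ‖p.innerError i (u t ω).1 ((ξ t ω).2.1 i)‖ ^ 2 ∂Pr ≤ s₀ / B := by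
  have hmp := R.regular.measurePreserving_dualBatch (B := B) R.S_le i
  refine R.integrable_draw_and_integral_le t
    (φ := fun v q => ‖p.innerError i v.1 (q.2.1 i)‖ ^ 2)
    ((R.regular.stronglyMeasurable_innerError i).norm.pow 2).measurable
    (fun _ _ => sq_nonneg _) (fun v hv => ?_) fun v hv => ?_
  · exact hmp.integrable_comp_of_integrable
      ((R.regular.memLp_innerError R.B_pos i hv).integrable_norm_pow two_ne_zero)
  · rw [integral_comp_of_measurePreserving hmp (φ := fun b => ‖p.innerError i v.1 b‖ ^ 2)
      ((R.regular.memLp_innerError R.B_pos i hv).1.norm.pow 2)]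
    exact R.regular.integral_norm_innerError_sq_le R.B_pos i hv

lemma integrable_norm_dualStep_sq (R : Run p L G s₀ s₁ S B η τ u₀ Pr ξ u) (t : ℕ) (i : Fin n) :
    Integrable (fun ω => ‖p.dualStep τ i (u t ω) ((ξ t ω).2.1 i)‖ ^ 2) Pr := by
  refine Integrable.of_bound (((R.regular.stronglyMeasurable_dualStep R.τ_pos i).comp_measurable
    (R.measurable_state_draw t)).norm.pow 2).aestronglyMeasurable ((2 * L) ^ 2)
    (ae_of_all _ fun ω => ?_)
  rw [norm_pow, norm_norm]
  exact pow_le_pow_left₀ (norm_nonneg _) (R.norm_dualStep_le t ω i) 2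

lemma integrable_weight_mul_norm_dualStep_sq (R : Run p L G s₀ s₁ S B η τ u₀ Pr ξ u) (t : ℕ)
    (i : Fin n) :
    Integrable (fun ω => weight S i (ξ t ω).1 * ‖p.dualStep τ i (u t ω) ((ξ t ω).2.1 i)‖ ^ 2)
      Pr :=
  Regular.integrable_weight_smul (R.measurable_blockBatch t) i (R.integrable_norm_dualStep_sq t i)

lemma integral_weight_mul_norm_dualStep_sq (R : Run p L G s₀ s₁ S B η τ u₀ Pr ξ u) (t : ℕ)
    (i : Fin n) :
    ∫ ω, weight S i (ξ t ω).1 * ‖p.dualStep τ i (u t ω) ((ξ t ω).2.1 i)‖ ^ 2 ∂Pr = 0 :=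
  R.integral_draw_eq_zero t (R.measurable_state t)
    (φ := fun v q => weight S i q.1 * ‖p.dualStep τ i v (q.2.1 i)‖ ^ 2)
    ((Regular.stronglyMeasurable_weight i).mul
      ((R.regular.stronglyMeasurable_dualStep R.τ_pos i).norm.pow 2))
    fun ω => R.regular.integral_weight_smul R.S_pos R.S_le i fun b =>
      ‖p.dualStep τ i (u t ω) (b.1 i)‖ ^ 2

lemma integrable_weight_sq_mul_norm_dualStep_sq (R : Run p L G s₀ s₁ S B η τ u₀ Pr ξ u) (t : ℕ)
    (i : Fin n) :
    Integrable (fun ω => weight S i (ξ t ω).1 ^ 2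
      * ‖p.dualStep τ i (u t ω) ((ξ t ω).2.1 i)‖ ^ 2) Pr := by
  simpa only [pow_two (weight _ _ _), mul_assoc, smul_eq_mul] using
    Regular.integrable_weight_smul (R.measurable_blockBatch t) i
      (R.integrable_weight_mul_norm_dualStep_sq t i)

lemma integral_weight_sq_mul_norm_dualStep_sq_le (R : Run p L G s₀ s₁ S B η τ u₀ Pr ξ u)
    (t : ℕ) (i : Fin n) :
    ∫ ω, weight S i (ξ t ω).1 ^ 2 * ‖p.dualStep τ i (u t ω) ((ξ t ω).2.1 i)‖ ^ 2 ∂Pr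
      ≤ n / S * ∫ ω, ‖p.dualStep τ i (u t ω) ((ξ t ω).2.1 i)‖ ^ 2 ∂Pr := by
  simp_rw [weight_sq, add_mul, mul_assoc]
  rw [integral_add ((R.integrable_norm_dualStep_sq t i).const_mul _)
      ((R.integrable_weight_mul_norm_dualStep_sq t i).const_mul _), integral_const_mul,
    integral_const_mul, R.integral_weight_mul_norm_dualStep_sq, mul_zero, add_zero]
  gcongr
  exact sub_le_self _ zero_le_one

lemma memLp_dualNoise (R : Run p L G s₀ s₁ S B η τ u₀ Pr ξ u) (t : ℕ) (i : Fin n) :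
    MemLp (fun ω => p.dualNoise S τ i (u t ω) (ξ t ω)) 2 Pr := by
  have hm : StronglyMeasurable fun ω => p.dualNoise S τ i (u t ω) (ξ t ω) :=
    (R.regular.stronglyMeasurable_dualNoise R.τ_pos i).comp_measurable (R.measurable_state_draw t)
  refine (memLp_two_iff_integrable_sq_norm hm.aestronglyMeasurable).2 ?_
  refine (((R.integrable_norm_innerError_sq_and_integral_le t i).1.const_mul 2).add
    ((R.integrable_weight_sq_mul_norm_dualStep_sq t i).const_mul (2 * τ ^ 2))).mono'
    (hm.norm.pow 2).aestronglyMeasurable (ae_of_all _ fun ω => ?_)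
  simpa using norm_sq_dualNoise_le S τ i (u t ω) (ξ t ω)

lemma integral_norm_dualNoise_sq_le (R : Run p L G s₀ s₁ S B η τ u₀ Pr ξ u) (t : ℕ)
    (i : Fin n) :
    ∫ ω, ‖p.dualNoise S τ i (u t ω) (ξ t ω)‖ ^ 2 ∂Pr ≤ 2 * (s₀ / B) + 2 * τ ^ 2
      * (n / S * ∫ ω, ‖p.dualStep τ i (u t ω) ((ξ t ω).2.1 i)‖ ^ 2 ∂Pr) := by
  obtain ⟨herr, herr_le⟩ := R.integrable_norm_innerError_sq_and_integral_le t i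
  have hstep := R.integrable_weight_sq_mul_norm_dualStep_sq t i
  refine (integral_mono ((R.memLp_dualNoise t i).integrable_norm_pow two_ne_zero)
    ((herr.const_mul 2).add (hstep.const_mul (2 * τ ^ 2)))
    fun ω => norm_sq_dualNoise_le S τ i (u t ω) (ξ t ω)).trans ?_
  simp only [Pi.add_apply]
  rw [integral_add (herr.const_mul 2) (hstep.const_mul _), integral_const_mul, integral_const_mul]
  have hw := R.integral_weight_sq_mul_norm_dualStep_sq_le t i
  gcongr

lemma integral_inner_dualNoise_eq_zero (R : Run p L G s₀ s₁ S B η τ u₀ Pr ξ u) (t : ℕ)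
    (i : Fin n) {V : Ω → Vec m} (hV : Measurable[past ξ t] V) :
    ∫ ω, inner ℝ (V ω) (p.dualNoise S τ i (u t ω) (ξ t ω)) ∂Pr = 0 := by
  have hfst : Measurable fun w : (Vec m × State d m n) × Draw n B Z => w.1.1 := by fun_prop
  have hsnd : Measurable fun w : (Vec m × State d m n) × Draw n B Z => (w.1.2, w.2) := by fun_prop
  refine R.integral_draw_eq_zero t (hV.prodMk (R.measurable_state t))
    (φ := fun v q => (inner ℝ v.1 (p.dualNoise S τ i v.2 q) : ℝ))
    (hfst.stronglyMeasurable.inner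
      ((R.regular.stronglyMeasurable_dualNoise R.τ_pos i).comp_measurable hsnd)) fun ω => ?_
  rw [integral_inner (R.regular.integrable_dualNoise R.τ_pos R.S_le R.B_pos i (R.x_mem t ω)),
    R.regular.integral_dualNoise R.τ_pos R.S_pos R.S_le R.B_pos i (R.x_mem t ω),
    inner_zero_right]

lemma integral_inner_dualNoise_dualNoise (R : Run p L G s₀ s₁ S B η τ u₀ Pr ξ u) {s t : ℕ}
    (hst : s ≠ t) (i : Fin n) :
    ∫ ω, inner ℝ (p.dualNoise S τ i (u s ω) (ξ s ω)) (p.dualNoise S τ i (u t ω) (ξ t ω)) ∂Pr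
      = 0 := by
  have hpast {s t : ℕ} (h : s < t) :
      Measurable[past ξ t] fun ω => p.dualNoise S τ i (u s ω) (ξ s ω) :=
    (R.regular.stronglyMeasurable_dualNoise R.τ_pos i).measurable.comp
      (((R.measurable_state s).mono (past_mono h.le) le_rfl).prodMk (measurable_past ξ h))
  rcases hst.lt_or_gt with h | h
  · exact R.integral_inner_dualNoise_eq_zero t i (hpast h)
  · simp_rw [real_inner_comm (p.dualNoise S τ i (u t _) (ξ t _))]
    exact R.integral_inner_dualNoise_eq_zero s i (hpast h)

lemma integral_norm_sum_dualNoise_sq (R : Run p L G s₀ s₁ S B η τ u₀ Pr ξ u) (T : ℕ)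
    (i : Fin n) :
    ∫ ω, ‖∑ t ∈ Finset.range T, p.dualNoise S τ i (u t ω) (ξ t ω)‖ ^ 2 ∂Pr
      = ∑ t ∈ Finset.range T, ∫ ω, ‖p.dualNoise S τ i (u t ω) (ξ t ω)‖ ^ 2 ∂Pr :=
  integral_norm_sum_sq _ (fun t _ => R.memLp_dualNoise t i)
    fun _ _ _ _ hst => R.integral_inner_dualNoise_dualNoise hst i

end DualNoise

section GradientNoise

lemma integrable_norm_stochGrad_sq_and_integral_le (R : Run p L G s₀ s₁ S B η τ u₀ Pr ξ u)
    (t : ℕ) :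
    Integrable (fun ω => ‖p.stochGrad S τ (u t ω) (ξ t ω)‖ ^ 2) Pr ∧
      ∫ ω, ‖p.stochGrad S τ (u t ω) (ξ t ω)‖ ^ 2 ∂Pr ≤ L ^ 2 * (2 * (G ^ 2 + s₁)) :=
  R.integrable_draw_and_integral_le t (φ := fun v q => ‖p.stochGrad S τ v q‖ ^ 2)
    ((R.regular.stronglyMeasurable_stochGrad R.τ_pos).norm.pow 2).measurable
    (fun _ _ => sq_nonneg _)
    (fun _ hv => (R.regular.memLp_stochGrad R.τ_pos R.S_le hv).integrable_norm_pow two_ne_zero)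
    fun _ hv => R.regular.integral_norm_stochGrad_sq_le R.τ_pos R.S_pos R.S_le R.B_pos hv

lemma memLp_stochGrad (R : Run p L G s₀ s₁ S B η τ u₀ Pr ξ u) (t : ℕ) :
    MemLp (fun ω => p.stochGrad S τ (u t ω) (ξ t ω)) 2 Pr :=
  (memLp_two_iff_integrable_sq_norm
    ((R.regular.stronglyMeasurable_stochGrad R.τ_pos).comp_measurable
      (R.measurable_state_draw t)).aestronglyMeasurable).2
    (R.integrable_norm_stochGrad_sq_and_integral_le t).1

lemma memLp_fullGrad (R : Run p L G s₀ s₁ S B η τ u₀ Pr ξ u) (t : ℕ) :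
    MemLp (fun ω => p.fullGrad τ (u t ω) (ξ t ω)) 2 Pr :=
  MemLp.of_bound ((R.regular.stronglyMeasurable_fullGrad R.τ_pos).comp_measurable
      (R.measurable_state_draw t)).aestronglyMeasurable (L * G)
    (ae_of_all _ fun ω => R.regular.norm_fullGrad_le (R.x_mem t ω) (ξ t ω))

lemma memLp_x (R : Run p L G s₀ s₁ S B η τ u₀ Pr ξ u) (t : ℕ) :
    MemLp (fun ω => (u t ω).1) 2 Pr := by
  obtain ⟨ω₀⟩ := Pr.nonempty_of_neZero
  induction t with
  | zero => simpa only [R.state_zero] using memLp_const u₀.1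
  | succ t ih =>
    have hq : MemLp (fun ω => ((u t ω).1 - η⁻¹ • p.stochGrad S τ (u t ω) (ξ t ω))
        - ((u t ω₀).1 - η⁻¹ • p.stochGrad S τ (u t ω₀) (ξ t ω₀))) 2 Pr :=
      (ih.sub ((R.memLp_stochGrad t).const_smul η⁻¹)).sub (memLp_const _)
    have hdiff : MemLp (fun ω => (u (t + 1) ω).1 - (u (t + 1) ω₀).1) 2 Pr :=
      hq.mono ((R.measurable_x (t + 1)).sub_const _).stronglyMeasurable.aestronglyMeasurable
        (ae_of_all _ fun ω => by
          simpa only [dist_eq_norm] using R.dist_x_succ_le t ω ω₀)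
    simpa only [Pi.add_def, sub_add_cancel] using hdiff.add (memLp_const (u (t + 1) ω₀).1)

lemma memLp_y (R : Run p L G s₀ s₁ S B η τ u₀ Pr ξ u) (t : ℕ) (i : Fin n) :
    MemLp (fun ω => (u t ω).2 i) 2 Pr :=
  MemLp.of_bound ((measurable_pi_apply i).comp (R.measurable_y t)).aestronglyMeasurable L
    (ae_of_all _ fun ω => R.norm_y_le t ω i)

lemma integrable_inner_fullGrad_sub_stochGrad (R : Run p L G s₀ s₁ S B η τ u₀ Pr ξ u) (t : ℕ)
    (z : Vec d) :
    Integrable (fun ω => (inner ℝ (p.fullGrad τ (u t ω) (ξ t ω) - p.stochGrad S τ (u t ω) (ξ t ω))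
      ((u t ω).1 - z) : ℝ)) Pr :=
  integrable_inner_of_memLp ((R.memLp_fullGrad t).sub (R.memLp_stochGrad t))
    ((R.memLp_x t).sub (memLp_const z))

lemma integral_inner_fullGrad_sub_stochGrad (R : Run p L G s₀ s₁ S B η τ u₀ Pr ξ u) (t : ℕ)
    (z : Vec d) :
    ∫ ω, inner ℝ (p.fullGrad τ (u t ω) (ξ t ω) - p.stochGrad S τ (u t ω) (ξ t ω))
      ((u t ω).1 - z) ∂Pr = 0 := by
  have hx : Measurable fun w : State d m n × Draw n B Z => w.1.1 - z := by fun_prop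
  refine R.integral_draw_eq_zero t (R.measurable_state t)
    (φ := fun v q => (inner ℝ (p.fullGrad τ v q - p.stochGrad S τ v q) (v.1 - z) : ℝ))
    (((R.regular.stronglyMeasurable_fullGrad R.τ_pos).sub
      (R.regular.stronglyMeasurable_stochGrad R.τ_pos)).inner hx.stronglyMeasurable) fun ω => ?_
  have := R.regular.isProbabilityMeasure_drawLaw (B := B) R.S_le
  have hfull : Integrable (p.fullGrad τ (u t ω)) (p.drawLaw S B) :=
    Integrable.of_bound ((R.regular.stronglyMeasurable_fullGrad R.τ_pos).comp_measurable
      measurable_prodMk_left).aestronglyMeasurable (L * G)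
      (ae_of_all _ (R.regular.norm_fullGrad_le (R.x_mem t ω)))
  have hstoch : Integrable (p.stochGrad S τ (u t ω)) (p.drawLaw S B) :=
    (R.regular.memLp_stochGrad R.τ_pos R.S_le (R.x_mem t ω)).integrable one_le_two
  have hzero : ∫ q, (p.fullGrad τ (u t ω) q - p.stochGrad S τ (u t ω) q) ∂(p.drawLaw S B) = 0 := by
    rw [integral_sub hfull hstoch,
      R.regular.integral_stochGrad R.τ_pos R.S_pos R.S_le R.B_pos (R.x_mem t ω), sub_self]
  simp_rw [real_inner_comm ((u t ω).1 - z)]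
  rw [integral_inner (hfull.sub' hstoch), hzero, inner_zero_right]

end GradientNoise

end Run

end Problem

/-! ### Saddle function -/

section Young

variable {E : Type*} [NormedAddCommGroup E] [InnerProductSpace ℝ E] {c τ : ℝ}

lemma mul_le_sq_div_add_sq (hc : 0 < c) (a s : ℝ) : a * s ≤ a ^ 2 / c + c / 4 * s ^ 2 := by
  have hsq : 0 ≤ (a - c / 2 * s) ^ 2 / c := by positivity
  have hexpand : (a - c / 2 * s) ^ 2 / c = a ^ 2 / c - a * s + c / 4 * s ^ 2 := by
    field_simp
    ring
  linarith

lemma inner_le_norm_sq_div_add_norm_sq (hc : 0 < c) (u v : E) :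
    inner ℝ u v ≤ ‖u‖ ^ 2 / c + c / 4 * ‖v‖ ^ 2 :=
  (real_inner_le_norm u v).trans (mul_le_sq_div_add_sq hc _ _)

lemma norm_sub_sq_sub_norm_sub_sq (v a y : E) :
    ‖v - y‖ ^ 2 - ‖v - a‖ ^ 2 = 2 * inner ℝ (v - y) (a - y) - ‖a - y‖ ^ 2 := by
  rw [← sub_sub_sub_cancel_right v a y, norm_sub_sq_real (v - y)]
  ring

lemma three_point_add_error_le (hτ : 0 < τ) (w : ℝ) (v a y e : E) :
    τ / 2 * (‖v - y‖ ^ 2 - ‖v - a‖ ^ 2 - ‖a - y‖ ^ 2) + inner ℝ (v - a) e ≤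
      τ / 2 * ((1 - w) * (‖v - y‖ ^ 2 - ‖v - a‖ ^ 2))
        + inner ℝ (v - y) (e + (τ * w) • (a - y))
        - τ / 2 * (w * ‖a - y‖ ^ 2) - τ / 4 * ‖a - y‖ ^ 2 + ‖e‖ ^ 2 / τ := by
  have hyoung := inner_le_norm_sq_div_add_norm_sq hτ (-e) (a - y)
  rw [norm_neg, inner_neg_left, real_inner_comm] at hyoung
  rw [norm_sub_sq_sub_norm_sub_sq, inner_add_right, real_inner_smul_right,
    ← sub_sub_sub_cancel_right v a y, inner_sub_left (v - y)]
  linarith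

end Young

lemma bregmanSum_quad {m n : ℕ} (v w : Fin n → Vec m) :
    bregmanSum (fun _ => quad) v w = 1 / 2 * ∑ i, ‖v i - w i‖ ^ 2 := by
  simp only [bregmanSum, bregman_quad, Finset.mul_sum]

namespace Problem

variable {d m n : ℕ} {Z : Type*} [MeasurableSpace Z] {p : Problem d m n Z} {L G s₀ s₁ : ℝ≥0}

section Definitions

/-- The saddle function `(1/n) ∑ᵢ (⟨vᵢ, gᵢ(x)⟩ - fᵢ^*(vᵢ)) + r(x)` of the problem. -/
noncomputable def saddle (p : Problem d m n Z) (x : Vec d) (v : Fin n → Vec m) : ℝ :=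
  (1 / (n : ℝ)) * ∑ i, (inner ℝ (v i) (p.g i x) - conjReal (p.f i) (v i)) + (p.r x).toReal

/-- What the dual block `i` adds to the error of one iteration, apart from terms that telescope
over the iterations and the inner product of the noise with the comparison point. -/
noncomputable def dualResidual (p : Problem d m n Z) {B : ℕ} (S : ℕ) (τ : ℝ) (y₀ : Fin n → Vec m)
    (i : Fin n) (u : State d m n) (q : Draw n B Z) : ℝ :=
  inner ℝ (y₀ i - u.2 i) (p.dualNoise S τ i u q)
    - τ / 2 * (weight S i q.1 * ‖p.dualStep τ i u (q.2.1 i)‖ ^ 2)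
    - τ / 4 * ‖p.dualStep τ i u (q.2.1 i)‖ ^ 2 + ‖p.innerError i u.1 (q.2.1 i)‖ ^ 2 / τ

/-- What the primal update adds to the error of one iteration, apart from terms that telescope
over the iterations, when `z` is the comparison point. -/
noncomputable def primalResidual (p : Problem d m n Z) {B : ℕ} (L G : ℝ≥0) (S : ℕ) (η τ : ℝ)
    (z : Vec d) (u : State d m n) (q : Draw n B Z) : ℝ :=
  inner ℝ (p.fullGrad τ u q - p.stochGrad S τ u q) (u.1 - z)
    + ((L * G) ^ 2 + ‖p.stochGrad S τ u q‖ ^ 2) / η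

end Definitions

namespace Regular

lemma F_eq_coe (h : p.Regular L G s₀ s₁) {z : Vec d} (hz : z ∈ p.finiteDom) :
    p.F z = ((1 / (n : ℝ) * ∑ i, p.f i (p.g i z) + (p.r z).toReal : ℝ) : EReal) := by
  rw [F, ← h.coe_toReal_r hz, ← EReal.coe_add, EReal.toReal_coe]

lemma toReal_F (h : p.Regular L G s₀ s₁) {z : Vec d} (hz : z ∈ p.finiteDom) :
    (p.F z).toReal = 1 / (n : ℝ) * ∑ i, p.f i (p.g i z) + (p.r z).toReal := by
  rw [h.F_eq_coe hz, EReal.toReal_coe]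

lemma mem_finiteDom_and_toReal_F_le (h : p.Regular L G s₀ s₁) {z : Vec d}
    (hz : IsArgmin p.F p.X z) :
    z ∈ p.finiteDom ∧ ∀ x ∈ p.finiteDom, (p.F z).toReal ≤ (p.F x).toReal := by
  obtain ⟨hmem, hle⟩ := h.mem_finiteDom_and_le_of_isArgmin
    (ℓ := fun x => 1 / (n : ℝ) * ∑ i, p.f i (p.g i x)) hz
  exact ⟨hmem, fun x hx => by rw [h.toReal_F hmem, h.toReal_F hx]; exact hle x hx⟩

lemma toReal_F_le_saddle (h : p.Regular L G s₀ s₁) {x : Vec d} (hx : x ∈ p.finiteDom)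
    {v : Fin n → Vec m} (hv : p.IsDualBest x v) :
    (∀ i, v i ∈ conjDom (p.f i)) ∧ (p.F x).toReal ≤ p.saddle x v := by
  have hbest (i : Fin n) := mem_conjDom_and_isMinOn_of_isArgmax (h.conjDom_nonempty i) (hv i)
  refine ⟨fun i => (hbest i).1, ?_⟩
  rw [h.toReal_F hx, saddle]
  gcongr with i
  obtain ⟨w, hw, hle⟩ :=
    exists_conjReal_le_inner_sub (h.f_convex i) (h.f_lip i).continuous (p.g i x)
  linarith [isMinOn_iff.1 (hbest i).2 w hw]

lemma measurable_toReal_F (h : p.Regular L G s₀ s₁) {Ω : Type*} [MeasurableSpace Ω]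
    {x : Ω → Vec d} (hx : Measurable x) (hmem : ∀ ω, x ω ∈ p.finiteDom) :
    Measurable fun ω => (p.F (x ω)).toReal := by
  simp_rw [fun ω => h.toReal_F (hmem ω)]
  refine Measurable.add (Measurable.const_mul (Finset.measurable_fun_sum _ fun i _ => ?_) _) ?_
  · exact (h.f_lip i).continuous.measurable.comp ((h.stronglyMeasurable_g i).measurable.comp hx)
  · have hr : LowerSemicontinuous (p.X.domRestrict p.r) :=
      lowerSemicontinuous_restrict_iff.2 h.r_lsc
    exact (hr.measurable.comp (hx.subtype_mk (h := fun ω => (hmem ω).1))).ereal_toReal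

lemma fullDual_three_point (h : p.Regular L G s₀ s₁) (hτ : 0 < τ) {B : ℕ} (i : Fin n)
    (u : State d m n) (b : Fin B → Z) {v : Vec m} (hv : v ∈ conjDom (p.f i)) :
    inner ℝ (v - p.fullDual τ i u b) (p.gBatch i u.1 b)
        + conjReal (p.f i) (p.fullDual τ i u b) - conjReal (p.f i) v
      ≤ τ / 2 * (‖v - u.2 i‖ ^ 2 - ‖v - p.fullDual τ i u b‖ ^ 2 - ‖p.dualStep τ i u b‖ ^ 2) := by
  have hprox : IsProx (conjDom (p.f i)) (conjReal (p.f i)) τ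
      (u.2 i - τ⁻¹ • -p.gBatch i u.1 b) (p.fullDual τ i u b) := by
    rw [smul_neg, sub_neg_eq_add]
    exact isProx_prox_conjReal (h.f_convex i) (h.f_lip i) τ _
  have hthree := ((isProx_add_inner_iff hτ.ne' _).2 hprox).three_point
    ((convexOn_conjReal (p.f i)).add
      ((innerₛₗ ℝ (-p.gBatch i u.1 b)).convexOn (convexOn_conjReal (p.f i)).1)) hv
  simp only [inner_neg_left, real_inner_comm _ (p.gBatch i u.1 b)] at hthree
  rw [inner_sub_left, dualStep]
  linarith

lemma saddle_block_le (h : p.Regular L G s₀ s₁) (hτ : 0 < τ) {B : ℕ} (i : Fin n)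
    {u : State d m n} (hu : u.1 ∈ p.X) (b : Fin B → Z) {z : Vec d} (hz : z ∈ p.X) {v : Vec m}
    (hv : v ∈ conjDom (p.f i)) :
    inner ℝ v (p.g i u.1) - conjReal (p.f i) v - p.f i (p.g i z) ≤
      τ / 2 * (‖v - u.2 i‖ ^ 2 - ‖v - p.fullDual τ i u b‖ ^ 2 - ‖p.dualStep τ i u b‖ ^ 2)
        + inner ℝ (v - p.fullDual τ i u b) (p.innerError i u.1 b)
        + inner ℝ (adjoint (p.meanJ i u.1) (p.fullDual τ i u b)) (u.1 - z) := by
  have hprox := h.fullDual_three_point hτ i u b hv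
  have hconj := inner_sub_le_conjReal (h.fullDual_mem (τ := τ) i u b) (p.g i z)
  have hsub := h.inner_g_subgradient hu hz (h.fullDual_mem (τ := τ) i u b)
  rw [← neg_sub u.1 z, inner_neg_right] at hsub
  simp only [innerError, inner_sub_left, inner_sub_right] at hprox ⊢ hsub
  linarith

end Regular

end Problem

/-! ### Pathwise bounds -/

namespace Problem

variable {d m n : ℕ} {Z : Type*} [MeasurableSpace Z] {p : Problem d m n Z} {L G s₀ s₁ : ℝ≥0}

namespace Run

variable {S B : ℕ} {η τ : ℝ} {u₀ : State d m n} {Ω : Type*} [MeasurableSpace Ω]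
  {Pr : Measure Ω} {ξ : ℕ → Ω → Draw n B Z} {u : ℕ → Ω → State d m n}

section OneStep

lemma dual_progress_eq (R : Run p L G s₀ s₁ S B η τ u₀ Pr ξ u) (t : ℕ) (ω : Ω) (i : Fin n)
    (v : Vec m) :
    (n : ℝ) / S * (‖v - (u t ω).2 i‖ ^ 2 - ‖v - (u (t + 1) ω).2 i‖ ^ 2) =
      (1 - weight S i (ξ t ω).1)
        * (‖v - (u t ω).2 i‖ ^ 2 - ‖v - p.fullDual τ i (u t ω) ((ξ t ω).2.1 i)‖ ^ 2) := by
  rw [R.y_succ, weight]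
  split_ifs <;> ring

lemma dual_block_le (R : Run p L G s₀ s₁ S B η τ u₀ Pr ξ u) (t : ℕ) (ω : Ω) (i : Fin n)
    {z : Vec d} (hz : z ∈ p.X) {v : Vec m} (hv : v ∈ conjDom (p.f i)) :
    inner ℝ v (p.g i (u (t + 1) ω).1) - conjReal (p.f i) v - p.f i (p.g i z) ≤
      (τ / 2 * ((n : ℝ) / S * (‖v - (u t ω).2 i‖ ^ 2 - ‖v - (u (t + 1) ω).2 i‖ ^ 2))
          + inner ℝ (v - u₀.2 i) (p.dualNoise S τ i (u t ω) (ξ t ω)))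
        + p.dualResidual S τ u₀.2 i (u t ω) (ξ t ω)
        + L * G * ‖(u (t + 1) ω).1 - (u t ω).1‖
        + inner ℝ (adjoint (p.meanJ i (u t ω).1) (p.fullDual τ i (u t ω) ((ξ t ω).2.1 i)))
          ((u t ω).1 - z) := by
  have hmove := R.regular.inner_g_sub_le (R.x_mem t ω) (R.x_mem (t + 1) ω) hv
  have hblock := R.regular.saddle_block_le R.τ_pos i (R.x_mem t ω) ((ξ t ω).2.1 i) hz hv
  have hthree := three_point_add_error_le R.τ_pos (weight S i (ξ t ω).1) v
    (p.fullDual τ i (u t ω) ((ξ t ω).2.1 i)) ((u t ω).2 i)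
    (p.innerError i (u t ω).1 ((ξ t ω).2.1 i))
  rw [← R.dual_progress_eq, ← sub_add_sub_cancel v (u₀.2 i) ((u t ω).2 i), inner_add_left]
    at hthree
  rw [inner_sub_right] at hmove
  rw [dualResidual]
  simp only [dualNoise, dualStep, sub_add_sub_cancel] at hthree hblock ⊢
  linarith

lemma primal_step_le (R : Run p L G s₀ s₁ S B η τ u₀ Pr ξ u) (t : ℕ) (ω : Ω) {z : Vec d}
    (hz : z ∈ p.finiteDom) :
    (p.r (u (t + 1) ω).1).toReal - (p.r z).toReal + L * G * ‖(u (t + 1) ω).1 - (u t ω).1‖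
        + inner ℝ (p.fullGrad τ (u t ω) (ξ t ω)) ((u t ω).1 - z) ≤
      η / 2 * (‖z - (u t ω).1‖ ^ 2 - ‖z - (u (t + 1) ω).1‖ ^ 2)
        + p.primalResidual L G S η τ z (u t ω) (ξ t ω) := by
  have hthree := R.primal_three_point t ω hz
  have hmove := mul_le_sq_div_add_sq R.η_pos (L * G) ‖(u (t + 1) ω).1 - (u t ω).1‖
  have hgrad := inner_le_norm_sq_div_add_norm_sq R.η_pos (-p.stochGrad S τ (u t ω) (ξ t ω))
    ((u (t + 1) ω).1 - (u t ω).1)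
  rw [norm_neg] at hgrad
  simp only [primalResidual, inner_sub_left, inner_sub_right, inner_neg_left, add_div]
    at hgrad ⊢
  linarith

lemma saddle_sub_le (R : Run p L G s₀ s₁ S B η τ u₀ Pr ξ u) (t : ℕ) (ω : Ω) {z : Vec d}
    (hz : z ∈ p.finiteDom) {v : Fin n → Vec m} (hv : ∀ i, v i ∈ conjDom (p.f i)) :
    p.saddle (u (t + 1) ω).1 v - (p.F z).toReal ≤
      η / 2 * (‖z - (u t ω).1‖ ^ 2 - ‖z - (u (t + 1) ω).1‖ ^ 2)
        + 1 / n * ∑ i,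
          (τ / 2 * ((n : ℝ) / S * (‖v i - (u t ω).2 i‖ ^ 2 - ‖v i - (u (t + 1) ω).2 i‖ ^ 2))
            + inner ℝ (v i - u₀.2 i) (p.dualNoise S τ i (u t ω) (ξ t ω)))
        + (1 / n * ∑ i, p.dualResidual S τ u₀.2 i (u t ω) (ξ t ω)
          + p.primalResidual L G S η τ z (u t ω) (ξ t ω)) := by
  have hn : (n : ℝ) ≠ 0 := Nat.cast_ne_zero.2 (by have := R.S_pos; have := R.S_le; omega)
  have hprimal := R.primal_step_le t ω hz
  have hdual := mul_le_mul_of_nonneg_left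
    (Finset.sum_le_sum fun i (_ : i ∈ Finset.univ) => R.dual_block_le t ω i hz.1 (hv i))
    (show (0 : ℝ) ≤ 1 / n by positivity)
  have hmove : 1 / (n : ℝ) * ∑ _i : Fin n, L * G * ‖(u (t + 1) ω).1 - (u t ω).1‖
      = L * G * ‖(u (t + 1) ω).1 - (u t ω).1‖ := by
    rw [Finset.sum_const, Finset.card_univ, Fintype.card_fin, nsmul_eq_mul]
    field_simp
  have hgrad : 1 / (n : ℝ) * ∑ i, inner ℝ (adjoint (p.meanJ i (u t ω).1)
      (p.fullDual τ i (u t ω) ((ξ t ω).2.1 i))) ((u t ω).1 - z)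
      = inner ℝ (p.fullGrad τ (u t ω) (ξ t ω)) ((u t ω).1 - z) := by
    rw [fullGrad, real_inner_smul_left, sum_inner]
  rw [Finset.sum_add_distrib (g := fun i => inner ℝ (adjoint _ (p.fullDual τ i _ _)) _),
    Finset.sum_add_distrib (g := fun _ => L * G * ‖(u (t + 1) ω).1 - (u t ω).1‖),
    Finset.sum_add_distrib (g := fun i => p.dualResidual S τ u₀.2 i _ _), mul_add, mul_add,
    mul_add, hmove, hgrad, Finset.sum_sub_distrib, mul_sub] at hdual
  rw [R.regular.toReal_F hz, saddle]
  linarith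

end OneStep

section Average

lemma avgIterate_mem (R : Run p L G s₀ s₁ S B η τ u₀ Pr ξ u) {T : ℕ} (hT : 1 ≤ T) (ω : Ω) :
    avgIterate (fun t ω => (u t ω).1) T ω ∈ p.finiteDom := by
  have hT0 : (T : ℝ) ≠ 0 := Nat.cast_ne_zero.2 (by omega)
  rw [avgIterate, Finset.smul_sum]
  exact R.regular.convexOn_toReal_r.1.sum_mem (fun _ _ => by positivity)
    (by simp [hT0]) fun t _ => (R.isProx_x_succ t ω).1

lemma measurable_avgIterate (R : Run p L G s₀ s₁ S B η τ u₀ Pr ξ u) (T : ℕ) :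
    Measurable (avgIterate (fun t ω => (u t ω).1) T) :=
  (Finset.measurable_fun_sum _ fun t _ => R.measurable_x (t + 1)).fun_const_smul _

lemma mul_saddle_avgIterate_le (R : Run p L G s₀ s₁ S B η τ u₀ Pr ξ u) {T : ℕ} (hT : 1 ≤ T)
    (ω : Ω) {v : Fin n → Vec m} (hv : ∀ i, v i ∈ conjDom (p.f i)) :
    T * p.saddle (avgIterate (fun t ω => (u t ω).1) T ω) v ≤
      ∑ t ∈ Finset.range T, p.saddle (u (t + 1) ω).1 v := by
  have hT0 : (T : ℝ) ≠ 0 := Nat.cast_ne_zero.2 (by omega)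
  have hr : T * (p.r (avgIterate (fun t ω => (u t ω).1) T ω)).toReal ≤
      ∑ t ∈ Finset.range T, (p.r (u (t + 1) ω).1).toReal := by
    have hjensen := R.regular.convexOn_toReal_r.map_sum_le (t := Finset.range T)
      (w := fun _ => 1 / (T : ℝ)) (p := fun t => (u (t + 1) ω).1) (fun _ _ => by positivity)
      (by simp [hT0]) fun t _ => (R.isProx_x_succ t ω).1
    rw [← Finset.smul_sum, ← Finset.smul_sum, smul_eq_mul] at hjensen
    calc _ ≤ T * (1 / (T : ℝ) * ∑ t ∈ Finset.range T, (p.r (u (t + 1) ω).1).toReal) := by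
          gcongr; exact hjensen
      _ = _ := by field_simp
  have hg (i : Fin n) := R.regular.inner_g_average_le hT (fun t => R.x_mem (t + 1) ω)
    (R.avgIterate_mem hT ω).1 (hv i)
  have hblocks : T * ∑ i, (inner ℝ (v i) (p.g i (avgIterate (fun t ω => (u t ω).1) T ω))
      - conjReal (p.f i) (v i)) ≤ ∑ t ∈ Finset.range T, ∑ i,
        (inner ℝ (v i) (p.g i (u (t + 1) ω).1) - conjReal (p.f i) (v i)) := by
    rw [Finset.sum_comm, Finset.mul_sum]
    refine Finset.sum_le_sum fun i _ => ?_
    rw [Finset.sum_sub_distrib, Finset.sum_const, Finset.card_range, nsmul_eq_mul, mul_sub]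
    exact sub_le_sub_right (hg i) _
  simp only [saddle, Finset.sum_add_distrib, ← Finset.mul_sum, mul_add, mul_left_comm (T : ℝ)]
  gcongr

lemma sum_dual_progress_le (R : Run p L G s₀ s₁ S B η τ u₀ Pr ξ u) (T : ℕ) (ω : Ω) (i : Fin n)
    (v : Vec m) :
    ∑ t ∈ Finset.range T,
        (τ / 2 * ((n : ℝ) / S * (‖v - (u t ω).2 i‖ ^ 2 - ‖v - (u (t + 1) ω).2 i‖ ^ 2))
          + inner ℝ (v - u₀.2 i) (p.dualNoise S τ i (u t ω) (ξ t ω))) ≤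
      5 * τ * n / (2 * S) * ‖v - u₀.2 i‖ ^ 2 + S / (8 * τ * n)
        * ‖∑ t ∈ Finset.range T, p.dualNoise S τ i (u t ω) (ξ t ω)‖ ^ 2 := by
  have hn : 0 < (n : ℝ) := Nat.cast_pos.2 (R.S_pos.trans R.S_le)
  have hS : 0 < (S : ℝ) := Nat.cast_pos.2 R.S_pos
  have hτ := R.τ_pos
  have hyoung := inner_le_norm_sq_div_add_norm_sq (show 0 < 8 * τ * n / S by positivity)
    (∑ t ∈ Finset.range T, p.dualNoise S τ i (u t ω) (ξ t ω)) (v - u₀.2 i)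
  rw [Finset.sum_add_distrib, ← Finset.mul_sum, ← Finset.mul_sum,
    Finset.sum_range_sub' fun t => ‖v - (u t ω).2 i‖ ^ 2, ← inner_sum, R.state_zero,
    real_inner_comm]
  have hdrop : τ / 2 * ((n : ℝ) / S * (‖v - u₀.2 i‖ ^ 2 - ‖v - (u T ω).2 i‖ ^ 2)) ≤
      τ / 2 * ((n : ℝ) / S * ‖v - u₀.2 i‖ ^ 2) := by
    gcongr
    exact sub_le_self _ (sq_nonneg _)
  refine (add_le_add hdrop hyoung).trans_eq ?_
  field_simp
  ring

lemma mul_gap_le (R : Run p L G s₀ s₁ S B η τ u₀ Pr ξ u) {T : ℕ} (hT : 1 ≤ T) (ω : Ω)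
    {z : Vec d} (hz : z ∈ p.finiteDom) {v : Fin n → Vec m}
    (hv : p.IsDualBest (avgIterate (fun t ω => (u t ω).1) T ω) v) :
    T * ((p.F (avgIterate (fun t ω => (u t ω).1) T ω)).toReal - (p.F z).toReal) ≤
      η / 2 * ‖z - u₀.1‖ ^ 2 + 5 * τ / S * bregmanSum (fun _ => quad) v u₀.2
        + S / (8 * τ * n ^ 2)
          * ∑ i, ‖∑ t ∈ Finset.range T, p.dualNoise S τ i (u t ω) (ξ t ω)‖ ^ 2
        + ∑ t ∈ Finset.range T, (1 / n * ∑ i, p.dualResidual S τ u₀.2 i (u t ω) (ξ t ω)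
          + p.primalResidual L G S η τ z (u t ω) (ξ t ω)) := by
  have hn : 0 < (n : ℝ) := Nat.cast_pos.2 (R.S_pos.trans R.S_le)
  have hS : 0 < (S : ℝ) := Nat.cast_pos.2 R.S_pos
  have hτ := R.τ_pos
  obtain ⟨hdom, hF⟩ := R.regular.toReal_F_le_saddle (R.avgIterate_mem hT ω) hv
  have hsteps := Finset.sum_le_sum fun t (_ : t ∈ Finset.range T) => R.saddle_sub_le t ω hz hdom
  rw [Finset.sum_add_distrib, Finset.sum_add_distrib, ← Finset.mul_sum, ← Finset.mul_sum,
    Finset.sum_comm, Finset.sum_range_sub' fun t => ‖z - (u t ω).1‖ ^ 2, R.state_zero,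
    Finset.sum_sub_distrib, Finset.sum_const, Finset.card_range, nsmul_eq_mul] at hsteps
  have hprimal : η / 2 * (‖z - u₀.1‖ ^ 2 - ‖z - (u T ω).1‖ ^ 2) ≤ η / 2 * ‖z - u₀.1‖ ^ 2 := by
    have := R.η_pos
    gcongr
    exact sub_le_self _ (sq_nonneg _)
  have hdual := mul_le_mul_of_nonneg_left (Finset.sum_le_sum fun i (_ : i ∈ Finset.univ) =>
    R.sum_dual_progress_le T ω i (v i)) (show (0 : ℝ) ≤ 1 / n by positivity)
  have hconst : 1 / (n : ℝ) * ∑ i, (5 * τ * n / (2 * S) * ‖v i - u₀.2 i‖ ^ 2 + S / (8 * τ * n)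
        * ‖∑ t ∈ Finset.range T, p.dualNoise S τ i (u t ω) (ξ t ω)‖ ^ 2) =
      5 * τ / S * bregmanSum (fun _ => quad) v u₀.2 + S / (8 * τ * n ^ 2)
        * ∑ i, ‖∑ t ∈ Finset.range T, p.dualNoise S τ i (u t ω) (ξ t ω)‖ ^ 2 := by
    rw [bregmanSum_quad, Finset.sum_add_distrib, ← Finset.mul_sum, ← Finset.mul_sum]
    field_simp
  have hT' := mul_le_mul_of_nonneg_left hF (Nat.cast_nonneg (α := ℝ) T)
  linarith [R.mul_saddle_avgIterate_le hT ω hdom]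

end Average

end Run

end Problem

/-! ### Expected gap -/

namespace Problem

variable {d m n : ℕ} {Z : Type*} [MeasurableSpace Z] {p : Problem d m n Z} {L G s₀ s₁ : ℝ≥0}

namespace Run

variable {S B : ℕ} {η τ : ℝ} {u₀ : State d m n} {Ω : Type*} [MeasurableSpace Ω]
  {Pr : Measure Ω} [IsProbabilityMeasure Pr] {ξ : ℕ → Ω → Draw n B Z} {u : ℕ → Ω → State d m n}

section Residuals

lemma integrable_dualResidual_and_integral_le (R : Run p L G s₀ s₁ S B η τ u₀ Pr ξ u) (t : ℕ)
    (i : Fin n) :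
    Integrable (fun ω => p.dualResidual S τ u₀.2 i (u t ω) (ξ t ω)) Pr ∧
      ∫ ω, p.dualResidual S τ u₀.2 i (u t ω) (ξ t ω) ∂Pr ≤
        s₀ / B / τ - τ / 4 * ∫ ω, ‖p.dualStep τ i (u t ω) ((ξ t ω).2.1 i)‖ ^ 2 ∂Pr := by
  have hτ := R.τ_pos
  have hy : Measurable[past ξ t] fun ω => u₀.2 i - (u t ω).2 i :=
    (((measurable_pi_apply i).comp measurable_snd).comp (R.measurable_state t)).const_sub _
  have hinner : Integrable (fun ω => (inner ℝ (u₀.2 i - (u t ω).2 i)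
      (p.dualNoise S τ i (u t ω) (ξ t ω)) : ℝ)) Pr :=
    integrable_inner_of_memLp ((memLp_const _).sub (R.memLp_y t i)) (R.memLp_dualNoise t i)
  have hweight := (R.integrable_weight_mul_norm_dualStep_sq t i).const_mul (τ / 2)
  have hstep := (R.integrable_norm_dualStep_sq t i).const_mul (τ / 4)
  obtain ⟨herr, herr_le⟩ := R.integrable_norm_innerError_sq_and_integral_le t i
  refine ⟨((hinner.sub' hweight).sub' hstep).add (herr.div_const τ), ?_⟩
  simp only [dualResidual]
  rw [integral_add ((hinner.sub' hweight).sub' hstep) (herr.div_const τ),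
    integral_sub (hinner.sub' hweight) hstep, integral_sub hinner hweight, integral_const_mul,
    integral_const_mul, integral_div, R.integral_inner_dualNoise_eq_zero t i hy,
    R.integral_weight_mul_norm_dualStep_sq]
  linarith [div_le_div_of_nonneg_right herr_le hτ.le]

lemma integrable_primalResidual_and_integral_le (R : Run p L G s₀ s₁ S B η τ u₀ Pr ξ u) (t : ℕ)
    (z : Vec d) :
    Integrable (fun ω => p.primalResidual L G S η τ z (u t ω) (ξ t ω)) Pr ∧
      ∫ ω, p.primalResidual L G S η τ z (u t ω) (ξ t ω) ∂Pr ≤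
        L ^ 2 * (3 * G ^ 2 + 2 * s₁) / η := by
  have hinner := R.integrable_inner_fullGrad_sub_stochGrad t z
  obtain ⟨hgrad, hgrad_le⟩ := R.integrable_norm_stochGrad_sq_and_integral_le t
  have hsq : Integrable (fun ω => (L * G : ℝ) ^ 2 + ‖p.stochGrad S τ (u t ω) (ξ t ω)‖ ^ 2) Pr :=
    (integrable_const _).add hgrad
  refine ⟨hinner.add (hsq.div_const η), ?_⟩
  simp only [primalResidual]
  rw [integral_add hinner (hsq.div_const η), R.integral_inner_fullGrad_sub_stochGrad, zero_add,
    integral_div, integral_add (integrable_const _) hgrad, integral_const, probReal_univ, one_smul]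
  exact div_le_div_of_nonneg_right (by linarith) R.η_pos.le

lemma integrable_residual_and_integral_le (R : Run p L G s₀ s₁ S B η τ u₀ Pr ξ u) (t : ℕ)
    (z : Vec d) :
    Integrable (fun ω => 1 / (n : ℝ) * ∑ i, p.dualResidual S τ u₀.2 i (u t ω) (ξ t ω)
        + p.primalResidual L G S η τ z (u t ω) (ξ t ω)) Pr ∧
      ∫ ω, (1 / (n : ℝ) * ∑ i, p.dualResidual S τ u₀.2 i (u t ω) (ξ t ω)
        + p.primalResidual L G S η τ z (u t ω) (ξ t ω)) ∂Pr ≤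
      1 / n * ∑ i, (s₀ / B / τ
          - τ / 4 * ∫ ω, ‖p.dualStep τ i (u t ω) ((ξ t ω).2.1 i)‖ ^ 2 ∂Pr)
        + L ^ 2 * (3 * G ^ 2 + 2 * s₁) / η := by
  have hdual (i : Fin n) := R.integrable_dualResidual_and_integral_le t i
  obtain ⟨hprimal, hprimal_le⟩ := R.integrable_primalResidual_and_integral_le t z
  have hsum := (integrable_finsetSum Finset.univ fun i _ => (hdual i).1).const_mul (1 / (n : ℝ))
  refine ⟨hsum.add hprimal, ?_⟩
  rw [integral_add hsum hprimal, integral_const_mul, integral_finsetSum _ fun i _ => (hdual i).1]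
  gcongr with i
  exact (hdual i).2

lemma integrable_noise_and_integral_le (R : Run p L G s₀ s₁ S B η τ u₀ Pr ξ u) (T : ℕ) :
    Integrable (fun ω => S / (8 * τ * n ^ 2)
        * ∑ i, ‖∑ t ∈ Finset.range T, p.dualNoise S τ i (u t ω) (ξ t ω)‖ ^ 2) Pr ∧
      ∫ ω, S / (8 * τ * n ^ 2)
        * ∑ i, ‖∑ t ∈ Finset.range T, p.dualNoise S τ i (u t ω) (ξ t ω)‖ ^ 2 ∂Pr ≤
      ∑ t ∈ Finset.range T, 1 / (n : ℝ) * ∑ i, (s₀ / B / τ / 4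
          + τ / 4 * ∫ ω, ‖p.dualStep τ i (u t ω) ((ξ t ω).2.1 i)‖ ^ 2 ∂Pr) := by
  have hτ := R.τ_pos
  have hS : 0 < (S : ℝ) := Nat.cast_pos.2 R.S_pos
  have hn : 0 < (n : ℝ) := Nat.cast_pos.2 (R.S_pos.trans R.S_le)
  have hSn : (S : ℝ) / n ≤ 1 := div_le_one_of_le₀ (Nat.cast_le.2 R.S_le) hn.le
  have hsq (i : Fin n) : Integrable
      (fun ω => ‖∑ t ∈ Finset.range T, p.dualNoise S τ i (u t ω) (ξ t ω)‖ ^ 2) Pr :=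
    (memLp_finsetSum _ fun t _ => R.memLp_dualNoise t i).integrable_norm_pow two_ne_zero
  refine ⟨(integrable_finsetSum _ fun i _ => hsq i).const_mul _, ?_⟩
  rw [integral_const_mul, integral_finsetSum _ fun i _ => hsq i]
  simp_rw [R.integral_norm_sum_dualNoise_sq T]
  rw [Finset.sum_comm, Finset.mul_sum]
  simp_rw [Finset.mul_sum]
  refine Finset.sum_le_sum fun t _ => Finset.sum_le_sum fun i _ => ?_
  set I := ∫ ω, ‖p.dualStep τ i (u t ω) ((ξ t ω).2.1 i)‖ ^ 2 ∂Pr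
  calc S / (8 * τ * n ^ 2) * ∫ ω, ‖p.dualNoise S τ i (u t ω) (ξ t ω)‖ ^ 2 ∂Pr
      ≤ S / (8 * τ * n ^ 2) * (2 * (s₀ / B) + 2 * τ ^ 2 * (n / S * I)) := by
        gcongr
        exact R.integral_norm_dualNoise_sq_le t i
    _ = 1 / n * (S / n * (s₀ / B / τ / 4) + τ / 4 * I) := by field_simp; ring
    _ ≤ 1 / n * (s₀ / B / τ / 4 + τ / 4 * I) := by
        gcongr
        exact mul_le_of_le_one_left (by positivity) hSn

/- The negative multiples of the squared dual steps left over by the three-point inequality pay for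
the variance of the block sampling. -/
lemma integrable_error_and_integral_le (R : Run p L G s₀ s₁ S B η τ u₀ Pr ξ u) (T : ℕ)
    (z : Vec d) :
    Integrable (fun ω => S / (8 * τ * n ^ 2)
          * ∑ i, ‖∑ t ∈ Finset.range T, p.dualNoise S τ i (u t ω) (ξ t ω)‖ ^ 2
        + ∑ t ∈ Finset.range T, (1 / n * ∑ i, p.dualResidual S τ u₀.2 i (u t ω) (ξ t ω)
          + p.primalResidual L G S η τ z (u t ω) (ξ t ω))) Pr ∧
      ∫ ω, (S / (8 * τ * n ^ 2)
          * ∑ i, ‖∑ t ∈ Finset.range T, p.dualNoise S τ i (u t ω) (ξ t ω)‖ ^ 2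
        + ∑ t ∈ Finset.range T, (1 / n * ∑ i, p.dualResidual S τ u₀.2 i (u t ω) (ξ t ω)
          + p.primalResidual L G S η τ z (u t ω) (ξ t ω))) ∂Pr ≤
      T * (5 / 4 * (s₀ / B / τ) + L ^ 2 * (3 * G ^ 2 + 2 * s₁) / η) := by
  have hn : 0 < (n : ℝ) := Nat.cast_pos.2 (R.S_pos.trans R.S_le)
  obtain ⟨hnoise, hnoise_le⟩ := R.integrable_noise_and_integral_le T
  have hres (t : ℕ) := R.integrable_residual_and_integral_le t z
  have hsum := integrable_finsetSum (Finset.range T) fun t _ => (hres t).1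
  refine ⟨hnoise.add hsum, ?_⟩
  rw [integral_add hnoise hsum, integral_finsetSum _ fun t _ => (hres t).1]
  refine (add_le_add hnoise_le (Finset.sum_le_sum fun t _ => (hres t).2)).trans_eq ?_
  simp only [Finset.sum_add_distrib, Finset.sum_sub_distrib, Finset.sum_const, Finset.card_univ,
    Finset.card_range, Fintype.card_fin, nsmul_eq_mul, ← Finset.mul_sum]
  field_simp
  ring

end Residuals

section Gap

variable {T : ℕ} {yt : Ω → Fin n → Vec m}

lemma integrable_bregmanSum_and_integral_le (R : Run p L G s₀ s₁ S B η τ u₀ Pr ξ u)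
    (hyt : Measurable yt) (hmem : ∀ ω i, yt ω i ∈ p.Y i) :
    Integrable (fun ω => bregmanSum (fun _ => quad) (yt ω) u₀.2) Pr ∧
      ∫ ω, bregmanSum (fun _ => quad) (yt ω) u₀.2 ∂Pr ≤ 2 * L ^ 2 * n := by
  simp_rw [bregmanSum_quad]
  have hle (ω : Ω) : 1 / 2 * ∑ i, ‖yt ω i - u₀.2 i‖ ^ 2 ≤ 2 * L ^ 2 * n := by
    have hblock (i : Fin n) : ‖yt ω i - u₀.2 i‖ ≤ 2 * L := by
      linarith [norm_sub_le (yt ω i) (u₀.2 i), R.regular.norm_le_of_mem_Y (hmem ω i),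
        R.regular.norm_le_of_mem_Y (R.y₀_mem i)]
    calc 1 / 2 * ∑ i, ‖yt ω i - u₀.2 i‖ ^ 2 ≤ 1 / 2 * ∑ _i : Fin n, (2 * L : ℝ) ^ 2 := by
          gcongr with i
          exact hblock i
      _ = 2 * L ^ 2 * n := by
          rw [Finset.sum_const, Finset.card_univ, Fintype.card_fin, nsmul_eq_mul]
          ring
  have hint : Integrable (fun ω => 1 / 2 * ∑ i, ‖yt ω i - u₀.2 i‖ ^ 2) Pr := by
    refine Integrable.of_bound (Measurable.aestronglyMeasurable (by fun_prop)) (2 * L ^ 2 * n)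
      (ae_of_all _ fun ω => ?_)
    rw [Real.norm_of_nonneg (by positivity)]
    exact hle ω
  refine ⟨hint, (integral_mono hint (integrable_const _) hle).trans ?_⟩
  simp

lemma integrable_gap_and_mul_integral_le (R : Run p L G s₀ s₁ S B η τ u₀ Pr ξ u) (hT : 1 ≤ T)
    {z : Vec d} (hz : IsArgmin p.F p.X z) (hyt : Measurable yt)
    (hbest : ∀ ω, p.IsDualBest (avgIterate (fun t ω => (u t ω).1) T ω) (yt ω)) :
    Integrable (fun ω =>
        (p.F (avgIterate (fun t ω => (u t ω).1) T ω)).toReal - (p.F z).toReal) Pr ∧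
      T * ∫ ω, ((p.F (avgIterate (fun t ω => (u t ω).1) T ω)).toReal - (p.F z).toReal) ∂Pr ≤
        η / 2 * ‖z - u₀.1‖ ^ 2 + 5 * τ / S * ∫ ω, bregmanSum (fun _ => quad) (yt ω) u₀.2 ∂Pr
          + T * (5 / 4 * (s₀ / B / τ) + L ^ 2 * (3 * G ^ 2 + 2 * s₁) / η) := by
  obtain ⟨hzdom, hzle⟩ := R.regular.mem_finiteDom_and_toReal_F_le hz
  have hbreg := (R.integrable_bregmanSum_and_integral_le hyt fun ω i => (hbest ω i).1).1
  obtain ⟨herr, herr_le⟩ := R.integrable_error_and_integral_le T z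
  have hconst : Integrable (fun ω => η / 2 * ‖z - u₀.1‖ ^ 2
      + 5 * τ / S * bregmanSum (fun _ => quad) (yt ω) u₀.2) Pr :=
    (integrable_const _).add (hbreg.const_mul _)
  have hmain := hconst.add herr
  have hle (ω : Ω) := (R.mul_gap_le hT ω hzdom (hbest ω)).trans_eq (add_assoc _ _ _)
  have hnonneg (ω : Ω) := sub_nonneg.2 (hzle _ (R.avgIterate_mem hT ω))
  have hmeas := (R.regular.measurable_toReal_F (R.measurable_avgIterate T)
    (R.avgIterate_mem hT)).sub_const (p.F z).toReal
  have hgap := hmain.mono' (hmeas.const_mul (T : ℝ)).aestronglyMeasurable (ae_of_all _ fun ω => by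
    rw [Real.norm_of_nonneg (mul_nonneg T.cast_nonneg (hnonneg ω))]
    exact hle ω)
  refine ⟨(integrable_const_mul_iff (by simp; omega) _).1 hgap, ?_⟩
  rw [← integral_const_mul]
  refine (integral_mono hgap hmain hle).trans ?_
  simp only [Pi.add_apply]
  rw [integral_add hconst herr, integral_add (integrable_const _) (hbreg.const_mul _),
    integral_const_mul (5 * τ / S), integral_const, probReal_univ, one_smul]
  gcongr

end Gap

end Run

end Problem

section StepSizes

lemma div_four_mul_add_one_div_le {q ε : ℝ} (hq : 0 ≤ q) (hε : 0 ≤ ε) :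
    q / ((4 * q + 1) / ε) ≤ ε / 4 := by
  calc q / ((4 * q + 1) / ε) = 4 * q / (4 * q + 1) * (ε / 4) := by field_simp
    _ ≤ ε / 4 :=
      mul_le_of_le_one_left (by positivity) (div_le_one_of_le₀ (by linarith) (by positivity))

lemma div_le_mul_div_four {a b ε T : ℝ} (hε : 0 < ε) (hab : 4 * a ≤ b) (hT : b / ε ^ 2 ≤ T) :
    a / ε ≤ T * (ε / 4) := by
  rw [div_le_iff₀ (by positivity)] at hT
  rw [div_le_iff₀ hε]
  linarith

lemma total_error_le_mul {Q s D K Ω₀ ρ ε : ℝ} {S B T : ℕ} (hQ : 0 ≤ Q) (hs : 0 ≤ s) (hε : 0 < ε)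
    (hB : 1 ≤ B) (hρ : 0 ≤ ρ) (hρD : ρ ≤ D)
    (hK : 2 * (4 * Q + 1) * D ^ 2 + 20 * (5 * s + 1) ≤ K)
    (hT : K * max 1 (Ω₀ / (B * S)) / ε ^ 2 ≤ T) :
    (4 * Q + 1) / ε / 2 * ρ ^ 2 + 5 * ((5 * s + 1) / (B * ε)) / S * Ω₀
      + T * (5 / 4 * (s / B / ((5 * s + 1) / (B * ε))) + Q / ((4 * Q + 1) / ε)) ≤ T * ε := by
  have : 0 < (B : ℝ) := Nat.cast_pos.2 hB
  set M := max 1 (Ω₀ / (B * S))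
  have hM : 1 ≤ M := le_max_left _ _
  have hD : 0 ≤ 2 * (4 * Q + 1) * D ^ 2 := by positivity
  have hprimal : (4 * Q + 1) / 2 * ρ ^ 2 / ε ≤ T * (ε / 4) := by
    refine div_le_mul_div_four hε ?_ hT
    calc 4 * ((4 * Q + 1) / 2 * ρ ^ 2) = 2 * (4 * Q + 1) * ρ ^ 2 := by ring
      _ ≤ 2 * (4 * Q + 1) * D ^ 2 := by gcongr
      _ ≤ K := by linarith
      _ ≤ K * M := le_mul_of_one_le_right (by linarith) hM
  have hdual : 5 * (5 * s + 1) * (Ω₀ / (B * S)) / ε ≤ T * (ε / 4) := by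
    refine div_le_mul_div_four hε ?_ hT
    calc 4 * (5 * (5 * s + 1) * (Ω₀ / (B * S))) = 20 * (5 * s + 1) * (Ω₀ / (B * S)) := by ring
      _ ≤ 20 * (5 * s + 1) * M := by gcongr; exact le_max_right _ _
      _ ≤ K * M := by gcongr; linarith
  have hdual_noise : 5 / 4 * s / ((4 * (5 / 4 * s) + 1) / ε) ≤ ε / 4 :=
    div_four_mul_add_one_div_le (by positivity) hε.le
  have hprimal_noise := div_four_mul_add_one_div_le hQ hε.le
  calc _ = (4 * Q + 1) / 2 * ρ ^ 2 / ε + 5 * (5 * s + 1) * (Ω₀ / (B * S)) / ε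
        + T * (5 / 4 * s / ((4 * (5 / 4 * s) + 1) / ε) + Q / ((4 * Q + 1) / ε)) := by
        field_simp
    _ ≤ T * (ε / 4) + T * (ε / 4) + T * (ε / 4 + ε / 4) := by gcongr
    _ = T * ε := by ring

end StepSizes

end FCCO

open scoped NNReal in
theorem theorem2_general (L G s₀ s₁ : ℝ≥0) (D : ℝ) :
    ∃ cη cτ K : ℝ, 0 < cη ∧ 0 < cτ ∧ 0 < K ∧
      ∀ (d m n : ℕ) (Z : Type*) [MeasurableSpace Z] (p : Problem d m n Z),
        p.Regular L G s₀ s₁ →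
      ∀ (S B : ℕ), 1 ≤ S → S ≤ n → 1 ≤ B →
      ∀ x₀ ∈ p.X, ∀ y₀ : Fin n → Vec m, (∀ i, y₀ i ∈ p.Y i) →
      ∀ xstar : Vec d, IsArgmin p.F p.X xstar → ‖x₀ - xstar‖ ≤ D →
      ∀ (Ω : Type*) [MeasurableSpace Ω] (Pr : Measure Ω) [IsProbabilityMeasure Pr]
        (ξ : ℕ → Ω → Problem.Draw n B Z), p.IsSampling S B Pr ξ →
      ∀ ε : ℝ, 0 < ε →
      ∀ (x : ℕ → Ω → Vec d) (y : ℕ → Ω → Fin n → Vec m),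
        p.IsALEXR S B (fun _ => quad) 0 (cη / ε) (cτ / (B * ε)) x₀ y₀ ξ x y →
      ∀ T : ℕ, 1 ≤ T →
      ∀ yt : Ω → Fin n → Vec m, Measurable yt →
        (∀ ω, p.IsDualBest (avgIterate x T ω) (yt ω)) →
      ∀ Ω₀ : ℝ, Ω₀ = ∫ ω, bregmanSum (fun _ => quad) (yt ω) y₀ ∂Pr →
        Integrable (fun ω => bregmanSum (fun _ => quad) (yt ω) y₀) Pr ∧
        Ω₀ ≤ K * n ∧
        (K * max 1 (Ω₀ / (B * S)) / ε ^ 2 ≤ T →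
          (∀ ω, p.F (avgIterate x T ω) ≠ ⊤) ∧
          Integrable (fun ω => (p.F (avgIterate x T ω)).toReal - (p.F xstar).toReal) Pr ∧
          ∫ ω, ((p.F (avgIterate x T ω)).toReal - (p.F xstar).toReal) ∂Pr ≤ ε) := by
  set Q : ℝ := L ^ 2 * (3 * G ^ 2 + 2 * s₁)
  refine ⟨4 * Q + 1, 5 * s₀ + 1, 2 * (4 * Q + 1) * D ^ 2 + 20 * (5 * s₀ + 1) + 2 * L ^ 2,
    by positivity, by positivity, by positivity, ?_⟩
  intro d m n Z _ p h S B hS hSn hB x₀ hx₀ y₀ hy₀ xstar hmin hD Ω _ Pr _ ξ hξ ε hε x y hxy T hT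
    yt hyt hbest Ω₀ hΩ₀
  have R : p.Run L G s₀ s₁ S B ((4 * Q + 1) / ε) ((5 * s₀ + 1) / (B * ε)) (x₀, y₀) Pr ξ
      fun t ω => (x t ω, y t ω) :=
    ⟨h, hS, hSn, hB, by positivity, by positivity, hx₀, hy₀, hξ, hxy⟩
  obtain ⟨hint, hle⟩ := R.integrable_bregmanSum_and_integral_le hyt fun ω i => (hbest ω i).1
  obtain ⟨hgap, hgap_le⟩ := R.integrable_gap_and_mul_integral_le hT hmin hyt hbest
  refine ⟨hint, ?_, fun hTK => ⟨fun ω => ?_, hgap, ?_⟩⟩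
  · rw [hΩ₀]
    exact hle.trans (by gcongr; exact le_add_of_nonneg_left (by positivity))
  · exact (h.F_eq_coe (R.avgIterate_mem hT ω)).trans_ne (EReal.coe_ne_top _)
  · refine le_of_mul_le_mul_left (hgap_le.trans ?_) (Nat.cast_pos.2 hT)
    rw [← hΩ₀, norm_sub_rev]
    exact total_error_le_mul (by positivity) s₀.2 hε hB (norm_nonneg _) hD
      (le_add_of_nonneg_right (by positivity)) hTK

theorem theorem2 (Cf Cg σ₀ σ₁ δ μψ Lψ D : ℝ)
    (hCf : 0 < Cf) (hCg : 0 < Cg) (hμψ : 0 < μψ) (hLψ : 0 < Lψ) :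
    ∃ cη cτ K : ℝ, 0 < cη ∧ 0 < cτ ∧ 0 < K ∧
      ∀ (d m n : ℕ) (Z : Type*) [MeasurableSpace Z] (p : Problem d m n Z),
        p.Assumptions Cf Cg σ₀ σ₁ δ μψ Lψ →
      ∀ (S B : ℕ), 1 ≤ S → S ≤ n → 1 ≤ B →
      ∀ x₀ ∈ p.X, ∀ y₀ : Fin n → Vec m, (∀ i, y₀ i ∈ p.Y i) →
      ∀ xstar : Vec d, IsArgmin p.F p.X xstar → ‖x₀ - xstar‖ ≤ D →
      ∀ (Ω : Type*) [MeasurableSpace Ω] (Pr : Measure Ω) [IsProbabilityMeasure Pr]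
        (ξ : ℕ → Ω → Problem.Draw n B Z), p.IsSampling S B Pr ξ →
      ∀ ε : ℝ, 0 < ε →
      ∀ (x : ℕ → Ω → Vec d) (y : ℕ → Ω → Fin n → Vec m),
        p.IsALEXR S B (fun _ => quad) 0 (cη / ε) (cτ / (B * ε)) x₀ y₀ ξ x y →
      ∀ T : ℕ, 1 ≤ T →
      ∀ yt : Ω → Fin n → Vec m, Measurable yt →
        (∀ ω, p.IsDualBest (avgIterate x T ω) (yt ω)) →
      ∀ Ω₀ : ℝ, Ω₀ = ∫ ω, bregmanSum (fun _ => quad) (yt ω) y₀ ∂Pr →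
        Integrable (fun ω => bregmanSum (fun _ => quad) (yt ω) y₀) Pr ∧
        Ω₀ ≤ K * n ∧
        (K * max 1 (Ω₀ / (B * S)) / ε ^ 2 ≤ T →
          (∀ ω, p.F (avgIterate x T ω) ≠ ⊤) ∧
          Integrable (fun ω => (p.F (avgIterate x T ω)).toReal - (p.F xstar).toReal) Pr ∧
          ∫ ω, ((p.F (avgIterate x T ω)).toReal - (p.F xstar).toReal) ∂Pr ≤ ε) := by
  obtain ⟨cη, cτ, K, hcη, hcτ, hK, H⟩ := theorem2_general _ _ _ _ D
  exact ⟨cη, cτ, K, hcη, hcτ, hK, fun d m n Z _ p h => H d m n Z p (h.regular hCf.le hμψ hLψ.le)⟩
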